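/- \textbf{Language.} Work in two-sorted classical first-order logic with equality, with a sort $B$ (bodies) and a sort $Q$ (quantities), unary relations $IOb$ (inertial observers) and $Ph$ (light signals) on $B$, binary functions $+,\cdot$ and a binary relation $\le$ on $Q$, and a relation $W(k,b,x_0,x_1,x_2,x_3)$ of sort $B^2\times Q^4$ (observer $k$ coordinatizes body $b$ at $\bar x$). $\vdash$ is derivability. Formulas that mention partial functions assert that these are defined; subtraction, division, $|\cdot|$ and $\sqrt{\cdot}$ are eliminated through their graphs. \textbf{Abbreviations.} $space(\bar x,\bar y)=\sqrt{(x_1-y_1)^2+(x_2-y_2)^2+(x_3-y_3)^2}$; $time(\bar x,\bar y)=|x_0-y_0|$; $wl_k(b)=\{\bar x: W(k,b,\bar x)\}$; $ev_k(\bar x)=\{b:W(k,b,\bar x)\}$; $w_{kh}(\bar x,\bar y)$ iff $ev_k(\bar x)=ev_h(\bar y)$. $speed_k(b)=v$ (resp. $\bar v_k(b)=\bar v$) means that $wl_k(b)$ has two different points and that $space(\bar x,\bar y)=v\cdot time(\bar x,\bar y)$ (resp. $(y_1-x_1,y_2-x_2,y_3-x_3)=\bar v\,(y_0-x_0)$)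 for all $\bar x,\bar y\in wl_k(b)$. $Ether(e)$ means that $IOb(e)$ and that there is $c>0$ such that for all $\bar x,\bar y\in Q^4$: some light signal $p$ has $\bar x,\bar y\in wl_e(p)$ iff $space(\bar x,\bar y)=c\cdot time(\bar x,\bar y)$. $\mathfrak c_e$ is the quantity $c$ such that $speed_e(p)=c$ for every $e\in Ether$ and $p\in Ph$ for which $speed_e(p)$ is defined. \textbf{Theories.} $Kin_{Full}$ consists of the following axioms. \begin{itemize} \item (AxEField) $(Q,+,\cdot,\le)$ is a linearly ordered field in which every positive element has a square root. \item (AxEv) For all $k,h\in IOb$ and $\bar x$ there is $\bar y$ with $ev_k(\bar x)=ev_h(\bar y)$. \item (AxSelf) For $k\in IOb$: $W(k,k,\bar x)$ iff $x_1=x_2=x_3=0$. \item (AxSymD) For $k,k'\in IOb$, if $time(\bar x,\bar y)=time(\bar x',\bar y')=0$, $ev_k(\bar x)=ev_{k'}(\bar x')$ and $ev_k(\bar y)=ev_{k'}(\bar y')$, then $space(\bar x,\bar y)=space(\bar x',\bar y')$. \item (AxLine) For $k,h\in IOb$ and $\bar x,\bar y,\bar z\in wl_k(h)$ there is $a\in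 Q$ with $\bar z-\bar x=a(\bar y-\bar x)$ or $\bar y-\bar z=a(\bar z-\bar x)$. \item (AxTriv) For every trivial transformation $T$ (an isometry on space combined with a translation on time) and $k\in IOb$ there is $k'\in IOb$ with $w_{kk'}=T$. \item (AxNoAcc) If $W(k,b,\bar x)$ for some $b,\bar x$, then $IOb(k)$. \item (AxKinds) No inertial observer is a light signal. \end{itemize} $ClassicalKin_{Full}$ is $Kin_{Full}$ together with \begin{itemize} \item (AxAbsTime) For $k,k'\in IOb$, if $ev_k(\bar x)=ev_{k'}(\bar x')$ and $ev_k(\bar y)=ev_{k'}(\bar y')$, then $time(\bar x,\bar y)=time(\bar x',\bar y')$. \item (AxThExp$_+$) There is an inertial observer, and for $k\in IOb$ and $\bar x,\bar y$ with $x_0\ne y_0$ there is $k'\in IOb$ with $\bar x,\bar y\in wl_k(k')$. \item (AxEther) There is $e$ with $Ether(e)$. \end{itemize} $ClassicalKin^{STL}_{Full}$ is $ClassicalKin_{Full}$ with AxThExp$_+$ replaced by \begin{itemize} \item (AxNoFTL) $speed_e(k)<\mathfrak c_e$ for all $k\in IOb$, $e\in Ether$. \item (AxThExp$^{STL}$)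 There is an inertial observer, and for $e\in Ether$ and $\bar x,\bar y$ with $space(\bar x,\bar y)<\mathfrak c_e\cdot time(\bar x,\bar y)$ there is $k\in IOb$ with $\bar x,\bar y\in wl_e(k)$. \end{itemize} \textbf{Translations.} For $\bar u\in Q^3$ let $G_{\bar u}(t,\bar p)=(t,\bar p-t\bar u)$ be the Galilean boost. Let $X_{\bar V}=G_{\bar v}^{-1}\circ G_{\bar V}$ with $\bar v=\mathfrak c_e\bar V/(1+|\bar V|)$, and $Y_{\bar v}=G_{\bar V}^{-1}\circ G_{\bar v}$ with $\bar V=\bar v/(\mathfrak c_e-|\bar v|)$. A translation maps formulas to formulas, replaces each atomic formula $R(\ldots)$ by the corresponding instance of a fixed formula, and preserves equality, connectives and quantifiers. $Tr_*$ (from the language of $ClassicalKin^{STL}_{Full}$ to that of $ClassicalKin_{Full}$) is the translation that is the identity on every symbol but $W$, and for which $Tr_*(W(k,b,\bar x))$ is: for every $e\in Ether$, \begin{itemize} \item if $b\notin IOb$, then $W\big(k,b,X^{-1}_{\bar v_k(e)}(\bar x)\big)$; \item if $b\in IOb$, then $w_{kb}\big(X^{-1}_{\bar v_k(e)}(\bar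 x)\big)=X^{-1}_{\bar v_b(e)}(t,0,0,0)$ for some $t\in Q$. \end{itemize} $Tr'_*$, in the other direction, is defined in the same way with $Y$ in place of $X$. \textbf{Theorem.} $Tr_*$, with inverse $Tr'_*$, is a definitional equivalence between $ClassicalKin_{Full}$ and $ClassicalKin^{STL}_{Full}$; that is, for all formulas $\varphi,\psi$: \begin{enumerate} \item if $ClassicalKin^{STL}_{Full}\vdash\varphi$, then $ClassicalKin_{Full}\vdash Tr_*(\varphi)$; \item if $ClassicalKin_{Full}\vdash\psi$, then $ClassicalKin^{STL}_{Full}\vdash Tr'_*(\psi)$; \item $ClassicalKin^{STL}_{Full}\vdash Tr'_*(Tr_*(\varphi))\leftrightarrow\varphi$; \item $ClassicalKin_{Full}\vdash Tr_*(Tr'_*(\psi))\leftrightarrow\psi$. \end{enumerate} Moreover, an observer who sees the ether moving with velocity $\bar V$ is re-coordinatized as seeing it move with velocity $\mathfrak c_e\bar V/(1+|\bar V|)$: $ClassicalKin_{Full}$ proves that $Tr_*\big(Ether(e)\wedge\bar v_k(e)=\bar v\big)$ holds iff $Ether(e)$ and $\bar v=\mathfrak c_e\bar V/(1+|\bar V|)$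 for $\bar V=\bar v_k(e)$. -/

import Mathlib

namespace Kin

/-! ## The two-sorted first-order language `{B, Q; IOb, Ph, +, ·, ≤, W}`

Variables are de Bruijn indices, numbered separately for the two sorts: a quantifier over
bodies shifts only the body variables, a quantifier over quantities only the quantity
variables.  The only body terms are the body variables, so they are plain natural numbers. -/

/-- Quantity terms. -/
inductive QTerm where
  | var (n : ℕ)
  | add (a b : QTerm)
  | mul (a b : QTerm)

namespace QTerm

instance : Add QTerm := ⟨add⟩
instance : Mul QTerm := ⟨mul⟩

/-- Simultaneous substitution of quantity terms for quantity variables. -/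
def subst (σ : ℕ → QTerm) : QTerm → QTerm
  | var n => σ n
  | add a b => add (a.subst σ) (b.subst σ)
  | mul a b => mul (a.subst σ) (b.subst σ)

/-- The same term, seen from below `n` further quantity quantifiers. -/
def lift (n : ℕ) (t : QTerm) : QTerm := t.subst fun i => var (i + n)

/-- All variables of the term have an index below `n`. -/
def bounded (n : ℕ) : QTerm → Bool
  | var i => decide (i < n)
  | add a b => a.bounded n && b.bounded n
  | mul a b => a.bounded n && b.bounded n

end QTerm

/-- Formulas.  The remaining connectives and the existential quantifiers are the usual
abbreviations, given below. -/
inductive Fml where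
  /-- `k` is an inertial observer. -/
  | iob (k : ℕ)
  /-- `p` is a light signal. -/
  | ph (p : ℕ)
  /-- Observer `k` coordinatizes body `b` at `x`; `x 0` is the time coordinate. -/
  | w (k b : ℕ) (x : Fin 4 → QTerm)
  | le (s t : QTerm)
  | eqQ (s t : QTerm)
  | eqB (k h : ℕ)
  | bot
  | imp (φ ψ : Fml)
  /-- Universal quantification over bodies. -/
  | allB (φ : Fml)
  /-- Universal quantification over quantities. -/
  | allQ (φ : Fml)

infixr:25 " ⟹ " => Fml.imp
infix:50 " ≐ " => Fml.eqQ

namespace Fml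

def neg (φ : Fml) : Fml := φ ⟹ bot
def conj (φ ψ : Fml) : Fml := neg (φ ⟹ neg ψ)
def disj (φ ψ : Fml) : Fml := neg φ ⟹ ψ
def iff (φ ψ : Fml) : Fml := conj (φ ⟹ ψ) (ψ ⟹ φ)
def exB (φ : Fml) : Fml := neg (allB (neg φ))
def exQ (φ : Fml) : Fml := neg (allQ (neg φ))

/-- A block of `n` universal quantity quantifiers; it binds the variables `0, …, n - 1`. -/
def allQs : ℕ → Fml → Fml
  | 0, φ => φ
  | n + 1, φ => allQ (allQs n φ)

/-- A block of `n` existential quantity quantifiers; it binds the variables `0, …, n - 1`. -/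
def exQs : ℕ → Fml → Fml
  | 0, φ => φ
  | n + 1, φ => exQ (exQs n φ)

end Fml

infixr:35 " ⋏ " => Fml.conj
infixr:30 " ⋎ " => Fml.disj
infix:20 " ⟺ " => Fml.iff
prefix:80 "∼" => Fml.neg

namespace Fml

/-- A substitution of body variables, passed below a body quantifier. -/
def upB (β : ℕ → ℕ) : ℕ → ℕ
  | 0 => 0
  | n + 1 => β n + 1

/-- A substitution of quantity terms, passed below a quantity quantifier. -/
def upQ (σ : ℕ → QTerm) : ℕ → QTerm
  | 0 => .var 0
  | n + 1 => (σ n).lift 1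

/-- Simultaneous (capture-avoiding) substitution for the free variables. -/
def subst (β : ℕ → ℕ) (σ : ℕ → QTerm) : Fml → Fml
  | iob k => iob (β k)
  | ph p => ph (β p)
  | w k b x => w (β k) (β b) fun i => (x i).subst σ
  | le s t => le (s.subst σ) (t.subst σ)
  | eqQ s t => eqQ (s.subst σ) (t.subst σ)
  | eqB k h => eqB (β k) (β h)
  | bot => bot
  | imp φ ψ => imp (φ.subst β σ) (ψ.subst β σ)
  | allB φ => allB (φ.subst (upB β) σ)
  | allQ φ => allQ (φ.subst β (upQ σ))

/-- The same formula, seen from below a further body quantifier. -/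
def shiftB (φ : Fml) : Fml := φ.subst (fun n => n + 1) QTerm.var

/-- The same formula, seen from below a further quantity quantifier. -/
def shiftQ (φ : Fml) : Fml := φ.subst id fun n => .var (n + 1)

/-- Replace body variable `0` by `k`, removing the outermost body quantifier. -/
def instB (φ : Fml) (k : ℕ) : Fml :=
  φ.subst (fun n => match n with | 0 => k | m + 1 => m) QTerm.var

/-- Replace quantity variable `0` by `t`, removing the outermost quantity quantifier. -/
def instQ (φ : Fml) (t : QTerm) : Fml :=
  φ.subst id fun n => match n with | 0 => t | m + 1 => .var m

/-- All free body variables have an index below `m`, all free quantity variables one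
below `n`. -/
def bounded (m n : ℕ) : Fml → Bool
  | iob k => decide (k < m)
  | ph p => decide (p < m)
  | w k b x => decide (k < m) && decide (b < m) && (x 0).bounded n && (x 1).bounded n &&
      (x 2).bounded n && (x 3).bounded n
  | le s t => s.bounded n && t.bounded n
  | eqQ s t => s.bounded n && t.bounded n
  | eqB k h => decide (k < m) && decide (h < m)
  | bot => true
  | imp φ ψ => φ.bounded m n && ψ.bounded m n
  | allB φ => φ.bounded (m + 1) n
  | allQ φ => φ.bounded m (n + 1)

end Fml

/-! ## Syntactic consequence -/

/-- `Proves Γ φ` is `Γ ⊢ φ`: derivability in natural deduction for classical two-sorted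
first-order logic with equality. -/
inductive Proves : Set Fml → Fml → Prop where
  | ax {Γ : Set Fml} {φ : Fml} : φ ∈ Γ → Proves Γ φ
  | impI {Γ : Set Fml} {φ ψ : Fml} : Proves (insert φ Γ) ψ → Proves Γ (φ ⟹ ψ)
  | impE {Γ : Set Fml} {φ ψ : Fml} : Proves Γ (φ ⟹ ψ) → Proves Γ φ → Proves Γ ψ
  | byContra {Γ : Set Fml} {φ : Fml} : Proves (insert (∼φ) Γ) Fml.bot → Proves Γ φ
  | allBI {Γ : Set Fml} {φ : Fml} : Proves (Fml.shiftB '' Γ) φ → Proves Γ (Fml.allB φ)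
  | allBE {Γ : Set Fml} {φ : Fml} (k : ℕ) : Proves Γ (Fml.allB φ) → Proves Γ (φ.instB k)
  | allQI {Γ : Set Fml} {φ : Fml} : Proves (Fml.shiftQ '' Γ) φ → Proves Γ (Fml.allQ φ)
  | allQE {Γ : Set Fml} {φ : Fml} (t : QTerm) : Proves Γ (Fml.allQ φ) → Proves Γ (φ.instQ t)
  | eqBRefl {Γ : Set Fml} (k : ℕ) : Proves Γ (Fml.eqB k k)
  | eqBSubst {Γ : Set Fml} {k h : ℕ} (φ : Fml) :
      Proves Γ (Fml.eqB k h) → Proves Γ (φ.instB k) → Proves Γ (φ.instB h)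
  | eqQRefl {Γ : Set Fml} (t : QTerm) : Proves Γ (t ≐ t)
  | eqQSubst {Γ : Set Fml} {s t : QTerm} (φ : Fml) :
      Proves Γ (s ≐ t) → Proves Γ (φ.instQ s) → Proves Γ (φ.instQ t)

/-! ## Translations, interpretations, definitional equivalence -/

/-- A translation assigns to every relation symbol a formula whose only free variables are
the arguments of the symbol (numbered from `0` in each sort).  The function symbols `+` and
`·` and equality are kept. -/
structure Translation where
  iob : Fml
  ph : Fml
  le : Fml
  w : Fml
  iob_bounded : iob.bounded 1 0 = true
  ph_bounded : ph.bounded 1 0 = true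
  le_bounded : le.bounded 0 2 = true
  w_bounded : w.bounded 2 4 = true

/-- The translation of formulas: it preserves equality, connectives and quantifiers. -/
def Translation.map (Tr : Translation) : Fml → Fml
  | .iob k => Tr.iob.subst (fun _ => k) QTerm.var
  | .ph p => Tr.ph.subst (fun _ => p) QTerm.var
  | .w k b x => Tr.w.subst (fun i => if i = 0 then k else b)
      (fun i => if h : i < 4 then x ⟨i, h⟩ else .var i)
  | .le s t => Tr.le.subst id (fun i => if i = 0 then s else t)
  | .eqQ s t => .eqQ s t
  | .eqB k h => .eqB k h
  | .bot => .bot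
  | .imp φ ψ => .imp (Tr.map φ) (Tr.map ψ)
  | .allB φ => .allB (Tr.map φ)
  | .allQ φ => .allQ (Tr.map φ)

/-- `Tr` is an interpretation of the theory `T₁` in the theory `T₂`. -/
def IsInterpretation (Tr : Translation) (T₁ T₂ : Set Fml) : Prop :=
  ∀ φ : Fml, Proves T₁ φ → Proves T₂ (Tr.map φ)

/-- `Tr`, with inverse `Tr'`, is a definitional equivalence between `T₁` and `T₂`. -/
def IsDefinitionalEquivalence (Tr Tr' : Translation) (T₁ T₂ : Set Fml) : Prop :=
  IsInterpretation Tr T₁ T₂ ∧ IsInterpretation Tr' T₂ T₁ ∧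
    (∀ φ : Fml, Proves T₁ (Tr'.map (Tr.map φ) ⟺ φ)) ∧
    (∀ ψ : Fml, Proves T₂ (Tr.map (Tr'.map ψ) ⟺ ψ))

/-! ## Definable functions on quantities

`ETerm`s are expressions that also use the (partial) functions `0, 1, -, /, |·|, √`.  They are
not part of the language; a formula that mentions such an expression is an abbreviation, in
which the expression is eliminated through its graph (and is asserted to be defined). -/

inductive ETerm where
  | tm (t : QTerm)
  | zero
  | one
  | add (a b : ETerm)
  | sub (a b : ETerm)
  | mul (a b : ETerm)
  | div (a b : ETerm)
  | abs (a : ETerm)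
  | sqrt (a : ETerm)

namespace ETerm

instance : Zero ETerm := ⟨zero⟩
instance : One ETerm := ⟨one⟩
instance : Add ETerm := ⟨add⟩
instance : Sub ETerm := ⟨sub⟩
instance : Mul ETerm := ⟨mul⟩
instance : Div ETerm := ⟨div⟩

/-- The quantity variable `n` as an expression. -/
def v (n : ℕ) : ETerm := tm (.var n)

/-- The same expression, seen from below `n` further quantity quantifiers. -/
def lift (n : ℕ) : ETerm → ETerm
  | tm t => tm (t.lift n)
  | zero => zero
  | one => one
  | add a b => add (a.lift n) (b.lift n)
  | sub a b => sub (a.lift n) (b.lift n)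
  | mul a b => mul (a.lift n) (b.lift n)
  | div a b => div (a.lift n) (b.lift n)
  | abs a => abs (a.lift n)
  | sqrt a => sqrt (a.lift n)

end ETerm

/-- `t` is zero. -/
def isZero (t : QTerm) : Fml := .allQ (t.lift 1 + .var 0 ≐ .var 0)

/-- `t` is one. -/
def isOne (t : QTerm) : Fml := .allQ (t.lift 1 * .var 0 ≐ .var 0)

/-- `t` is nonnegative. -/
def isNonneg (t : QTerm) : Fml := .exQ (isZero (.var 0) ⋏ .le (.var 0) (t.lift 1))

/-- The graph of an expression: `e.lift n` is defined and its value is `t`. -/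
def isVal : ETerm → ℕ → QTerm → Fml
  | .tm s, n, t => t ≐ s.lift n
  | .zero, _, t => isZero t
  | .one, _, t => isOne t
  | .add a b, n, t => .exQs 2 (isVal a (n + 2) (.var 1) ⋏ isVal b (n + 2) (.var 0) ⋏
      t.lift 2 ≐ .var 1 + .var 0)
  | .sub a b, n, t => .exQs 2 (isVal a (n + 2) (.var 1) ⋏ isVal b (n + 2) (.var 0) ⋏
      t.lift 2 + .var 0 ≐ .var 1)
  | .mul a b, n, t => .exQs 2 (isVal a (n + 2) (.var 1) ⋏ isVal b (n + 2) (.var 0) ⋏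
      t.lift 2 ≐ .var 1 * .var 0)
  | .div a b, n, t => .exQs 2 (isVal a (n + 2) (.var 1) ⋏ isVal b (n + 2) (.var 0) ⋏
      ∼(isZero (.var 0)) ⋏ t.lift 2 * .var 0 ≐ .var 1)
  | .abs a, n, t => .exQ (isVal a (n + 1) (.var 0) ⋏ isNonneg (t.lift 1) ⋏
      (t.lift 1 ≐ .var 0 ⋎ isZero (t.lift 1 + .var 0)))
  | .sqrt a, n, t => .exQ (isVal a (n + 1) (.var 0) ⋏ isNonneg (t.lift 1) ⋏
      t.lift 1 * t.lift 1 ≐ .var 0)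

/-- Equality of expressions. -/
def eqE (a b : ETerm) : Fml := .exQ (isVal a 1 (.var 0) ⋏ isVal b 1 (.var 0))

/-- Strict inequality of expressions. -/
def ltE (a b : ETerm) : Fml :=
  .exQs 2 (isVal a 2 (.var 1) ⋏ isVal b 2 (.var 0) ⋏ .le (.var 1) (.var 0) ⋏ ∼(.var 1 ≐ .var 0))

def all3 (f : Fin 3 → Fml) : Fml := f 0 ⋏ f 1 ⋏ f 2
def all4 (f : Fin 4 → Fml) : Fml := f 0 ⋏ f 1 ⋏ f 2 ⋏ f 3

/-- The coordinate point whose coordinates are the variables `n, n + 1, n + 2, n + 3`. -/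
def pt (n : ℕ) : Fin 4 → QTerm := fun i => .var (n + i)

/-- The same point, as a tuple of expressions. -/
def P (n : ℕ) : Fin 4 → ETerm := fun i => .v (n + i)

/-- Equality of coordinate points. -/
def eqPt (x y : Fin 4 → ETerm) : Fml := all4 fun i => eqE (x i) (y i)

/-- Spatial distance. -/
def space (x y : Fin 4 → ETerm) : ETerm :=
  .sqrt ((x 1 - y 1) * (x 1 - y 1) + (x 2 - y 2) * (x 2 - y 2) + (x 3 - y 3) * (x 3 - y 3))

/-- Time difference. -/
def time (x y : Fin 4 → ETerm) : ETerm := .abs (x 0 - y 0)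

/-- Length of a spatial vector. -/
def norm (v : Fin 3 → ETerm) : ETerm := .sqrt (v 0 * v 0 + v 1 * v 1 + v 2 * v 2)

/-! ## Defined kinematical notions -/

/-- `b` has two different points on its worldline according to `k`. -/
def moves (k b : ℕ) : Fml := .exQs 8 (.w k b (pt 4) ⋏ .w k b (pt 0) ⋏ ∼(eqPt (P 4) (P 0)))

/-- `speed_k(b) = v`. -/
def speedIs (k b : ℕ) (v : QTerm) : Fml :=
  moves k b ⋏ .allQs 8 (.w k b (pt 4) ⋏ .w k b (pt 0) ⟹
    eqE (space (P 4) (P 0)) (.tm (v.lift 8) * time (P 4) (P 0)))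

/-- `v̄_k(b) = v`, for a velocity vector `v`. -/
def velIs (k b : ℕ) (v : Fin 3 → QTerm) : Fml :=
  moves k b ⋏ .allQs 8 (.w k b (pt 4) ⋏ .w k b (pt 0) ⟹
    all3 fun i => eqE (P 0 i.succ - P 4 i.succ) (.tm ((v i).lift 8) * (P 0 0 - P 4 0)))

/-- The worldview transformation as a relation, `w_{kh}(x, y)`: the same bodies are present
for `k` at `x` and for `h` at `y`. -/
def wRel (k h : ℕ) (x y : Fin 4 → QTerm) : Fml := .allB (.w (k + 1) 0 x ⟺ .w (h + 1) 0 y)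

/-- `e` is an ether observer: an inertial observer for which light has one and the same
positive speed in every direction everywhere. -/
def ether (e : ℕ) : Fml :=
  .iob e ⋏ .exQ (ltE 0 (.v 0) ⋏ .allQs 8
    (.exB (.ph 0 ⋏ .w (e + 1) 0 (pt 4) ⋏ .w (e + 1) 0 (pt 0)) ⟺
      eqE (space (P 4) (P 0)) (.v 8 * time (P 4) (P 0))))

/-- `c` is the ether-observer-independent speed of light `𝔠ₑ`: the speed, wherever it is
defined, of any light signal according to any ether observer. -/
def isCe (c : QTerm) : Fml :=
  .allB (ether 0 ⟹ .allB (.ph 0 ⟹ .allQ (speedIs 1 0 (.var 0) ⟹ .var 0 ≐ c.lift 1)))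

/-! ## Axioms of the common part -/

/-- Quantities form a Euclidean field. -/
def axEField : Fml :=
  (.allQs 2 (.var 0 + .var 1 ≐ .var 1 + .var 0)) ⋏
  (.allQs 3 ((.var 0 + .var 1) + .var 2 ≐ .var 0 + (.var 1 + .var 2))) ⋏
  (.allQs 2 (.var 0 * .var 1 ≐ .var 1 * .var 0)) ⋏
  (.allQs 3 ((.var 0 * .var 1) * .var 2 ≐ .var 0 * (.var 1 * .var 2))) ⋏
  (.allQs 3 (.var 0 * (.var 1 + .var 2) ≐ .var 0 * .var 1 + .var 0 * .var 2)) ⋏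
  -- there are distinct neutral elements, zero (variable 1) and one (variable 0)
  (.exQs 2 (∼(.var 1 ≐ .var 0) ⋏
    .allQ (.var 0 + .var 2 ≐ .var 0) ⋏ .allQ (.var 0 * .var 1 ≐ .var 0) ⋏
    .allQ (.exQ (.var 1 + .var 0 ≐ .var 3)) ⋏
    .allQ (∼(.var 0 ≐ .var 2) ⟹ .exQ (.var 1 * .var 0 ≐ .var 2)))) ⋏
  -- linear ordering
  (.allQs 2 (.le (.var 0) (.var 1) ⋎ .le (.var 1) (.var 0))) ⋏
  (.allQs 2 (.le (.var 0) (.var 1) ⋏ .le (.var 1) (.var 0) ⟹ .var 0 ≐ .var 1)) ⋏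
  (.allQs 3 (.le (.var 0) (.var 1) ⋏ .le (.var 1) (.var 2) ⟹ .le (.var 0) (.var 2))) ⋏
  (.allQs 3 (.le (.var 0) (.var 1) ⟹ .le (.var 0 + .var 2) (.var 1 + .var 2))) ⋏
  (.allQs 2 (isNonneg (.var 0) ⋏ isNonneg (.var 1) ⟹ isNonneg (.var 0 * .var 1))) ⋏
  -- every positive quantity has a square root
  (.allQ (isNonneg (.var 0) ⋏ ∼(isZero (.var 0)) ⟹ .exQ (.var 0 * .var 0 ≐ .var 1)))

/-- All inertial observers coordinatize the same events. -/
def axEv : Fml :=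
  .allB (.iob 0 ⟹ .allB (.iob 0 ⟹ .allQs 4 (.exQs 4 (wRel 1 0 (pt 4) (pt 0)))))

/-- Any inertial observer is stationary in his own coordinate system. -/
def axSelf : Fml :=
  .allB (.iob 0 ⟹ .allQs 4 (.w 0 0 (pt 0) ⟺ all3 fun i => eqE (P 0 i.succ) 0))

/-- Any two inertial observers agree on the spatial distance of two events that are
simultaneous for both of them. -/
def axSymD : Fml :=
  .allB (.iob 0 ⟹ .allB (.iob 0 ⟹ .allQs 16
    (eqE (time (P 12) (P 8)) 0 ⋏ eqE (time (P 4) (P 0)) 0 ⋏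
      wRel 1 0 (pt 12) (pt 4) ⋏ wRel 1 0 (pt 8) (pt 0) ⟹
      eqE (space (P 12) (P 8)) (space (P 4) (P 0)))))

/-- The worldline of an inertial observer is straight according to inertial observers. -/
def axLine : Fml :=
  .allB (.iob 0 ⟹ .allB (.iob 0 ⟹ .allQs 12
    (.w 1 0 (pt 8) ⋏ .w 1 0 (pt 4) ⋏ .w 1 0 (pt 0) ⟹
      .exQ ((all4 fun i => eqE (P 1 i - P 9 i) (.v 0 * (P 5 i - P 9 i))) ⋎
        (all4 fun i => eqE (P 5 i - P 1 i) (.v 0 * (P 1 i - P 9 i)))))))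

/-- The image of `x` under `(t, p) ↦ (t + τ, A p + a)`, where the entries of the matrix `A`,
the vector `a` and `τ` are the thirteen variables starting from `n`. -/
def trivMap (n : ℕ) (x : Fin 4 → ETerm) : Fin 4 → ETerm :=
  ![x 0 + .v (n + 12),
    .v n * x 1 + .v (n + 1) * x 2 + .v (n + 2) * x 3 + .v (n + 9),
    .v (n + 3) * x 1 + .v (n + 4) * x 2 + .v (n + 5) * x 3 + .v (n + 10),
    .v (n + 6) * x 1 + .v (n + 7) * x 2 + .v (n + 8) * x 3 + .v (n + 11)]

/-- Any trivial transformation (an isometry on space and a translation on time) of an inertial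
coordinate system is an inertial coordinate system. -/
def axTriv : Fml :=
  .allQs 13 (.allQs 8 (eqE (space (trivMap 8 (P 4)) (trivMap 8 (P 0))) (space (P 4) (P 0))) ⟹
    .allB (.iob 0 ⟹ .exB (.iob 0 ⋏
      .allQs 8 (wRel 1 0 (pt 4) (pt 0) ⟺ eqPt (trivMap 8 (P 4)) (P 0)))))

/-- All observers are inertial observers. -/
def axNoAcc : Fml := .allB (.exB (.exQs 4 (.w 1 0 (pt 0))) ⟹ .iob 0)

/-- Inertial observers and light signals are two distinct kinds of bodies. -/
def axKinds : Fml := .allB (∼(.iob 0 ⋏ .ph 0))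

def kinFull : Set Fml :=
  {axEField, axEv, axSelf, axSymD, axLine, axTriv, axNoAcc, axKinds}

/-! ## Classical kinematics, with and without faster-than-light observers -/

/-- The time difference between any two events is the same for all inertial observers. -/
def axAbsTime : Fml :=
  .allB (.iob 0 ⟹ .allB (.iob 0 ⟹ .allQs 16
    (wRel 1 0 (pt 12) (pt 4) ⋏ wRel 1 0 (pt 8) (pt 0) ⟹
      eqE (time (P 12) (P 8)) (time (P 4) (P 0)))))

/-- Inertial observers can move along any non-horizontal straight line. -/
def axThExpPlus : Fml :=
  .exB (.iob 0) ⋏ .allB (.iob 0 ⟹ .allQs 8 (∼(pt 4 0 ≐ pt 0 0) ⟹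
    .exB (.iob 0 ⋏ .w 1 0 (pt 4) ⋏ .w 1 0 (pt 0))))

/-- There is an ether observer. -/
def axEther : Fml := .exB (ether 0)

/-- All inertial observers move slower than light with respect to the ether frame. -/
def axNoFTL : Fml :=
  .allB (.iob 0 ⟹ .allB (ether 0 ⟹
    .exQs 2 (speedIs 0 1 (.var 1) ⋏ isCe (.var 0) ⋏ ltE (.v 1) (.v 0))))

/-- Inertial observers can move with any speed which in the ether frame is slower than that
of light. -/
def axThExpSTL : Fml :=
  .exB (.iob 0) ⋏ .allB (ether 0 ⟹ .allQs 8
    (.exQ (isCe (.var 0) ⋏ ltE (space (P 5) (P 1)) (.v 0 * time (P 5) (P 1))) ⟹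
      .exB (.iob 0 ⋏ .w 1 0 (pt 4) ⋏ .w 1 0 (pt 0))))

/-- Classical kinematics. -/
def classicalKinFull : Set Fml := kinFull ∪ {axAbsTime, axThExpPlus, axEther}

/-- Classical kinematics restricted to slower-than-light inertial observers: `axThExpPlus` is
replaced by `axNoFTL` and `axThExpSTL`. -/
def classicalKinSTLFull : Set Fml := kinFull ∪ {axAbsTime, axEther, axNoFTL, axThExpSTL}

/-! ## The translations -/

/-- The Galilean boost that maps bodies moving with velocity `v` to stationary ones. -/
def boost (v : Fin 3 → ETerm) (x : Fin 4 → ETerm) : Fin 4 → ETerm :=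
  ![x 0, x 1 - v 0 * x 0, x 2 - v 1 * x 0, x 3 - v 2 * x 0]

/-- The inverse of `boost v`. -/
def boostInv (v : Fin 3 → ETerm) (x : Fin 4 → ETerm) : Fin 4 → ETerm :=
  ![x 0, x 1 + v 0 * x 0, x 2 + v 1 * x 0, x 3 + v 2 * x 0]

/-- The velocity `c V / (1 + |V|)`, slower than `c`. -/
def slow (c : ETerm) (V : Fin 3 → ETerm) : Fin 3 → ETerm := fun i => c * V i / (1 + norm V)

/-- The velocity `v / (c - |v|)`, for `|v| < c`. -/
def fast (c : ETerm) (v : Fin 3 → ETerm) : Fin 3 → ETerm := fun i => v i / (c - norm v)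

/-- `X_V = G_v⁻¹ ∘ G_V` for `v = c V / (1 + |V|)`. -/
def mapX (c : ETerm) (V : Fin 3 → ETerm) (x : Fin 4 → ETerm) : Fin 4 → ETerm :=
  boostInv (slow c V) (boost V x)

/-- `Y_v = G_V⁻¹ ∘ G_v` for `V = v / (c - |v|)`. -/
def mapY (c : ETerm) (v : Fin 3 → ETerm) (x : Fin 4 → ETerm) : Fin 4 → ETerm :=
  boostInv (fast c v) (boost v x)

/-- `X_{v̄_k(e)}(x) = y`, that is, `X⁻¹_{v̄_k(e)}(y) = x`. -/
def relX (k e : ℕ) (x y : Fin 4 → ETerm) : Fml :=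
  .exQs 4 (isCe (.var 3) ⋏ velIs k e ![.var 0, .var 1, .var 2] ⋏
    eqPt (mapX (.v 3) ![.v 0, .v 1, .v 2] fun i => (x i).lift 4) fun i => (y i).lift 4)

/-- `Y_{v̄_k(e)}(x) = y`, that is, `Y⁻¹_{v̄_k(e)}(y) = x`. -/
def relY (k e : ℕ) (x y : Fin 4 → ETerm) : Fml :=
  .exQs 4 (isCe (.var 3) ⋏ velIs k e ![.var 0, .var 1, .var 2] ⋏
    eqPt (mapY (.v 3) ![.v 0, .v 1, .v 2] fun i => (x i).lift 4) fun i => (y i).lift 4)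

/-- The common shape of the translations of `W(k, b, x)`; here `k`, `b` are the body variables
`0`, `1`, the coordinates of `x` are the quantity variables `0`, `1`, `2`, `3`, and
`rel k e y x` stands for `y = Z⁻¹_{v̄_k(e)}(x)`:
for every ether observer `e`,
* if `b` is not an inertial observer, then `W(k, b, Z⁻¹_{v̄_k(e)}(x))`;
* if `b` is an inertial observer, then `w_{kb}(Z⁻¹_{v̄_k(e)}(x)) = Z⁻¹_{v̄_b(e)}(t, 0, 0, 0)`
  for some `t`. -/
def transW (rel : ℕ → ℕ → (Fin 4 → ETerm) → (Fin 4 → ETerm) → Fml) : Fml :=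
  -- below the quantifier, `e`, `k`, `b` are the body variables `0`, `1`, `2`
  .allB (ether 0 ⟹
    (∼(.iob 2) ⟹ .exQs 4 (rel 1 0 (P 0) (P 4) ⋏ .w 1 2 (pt 0))) ⋏
    (.iob 2 ⟹ .exQs 9 (rel 1 0 (P 0) (P 9) ⋏ rel 2 0 (P 4) ![.v 8, 0, 0, 0] ⋏
      wRel 1 2 (pt 0) (pt 4))))

/-- The translation `Tr_*`; it is the identity on every symbol but `W`. -/
def trStar : Translation where
  iob := .iob 0
  ph := .ph 0
  le := .le (.var 0) (.var 1)
  w := transW relX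
  iob_bounded := rfl
  ph_bounded := rfl
  le_bounded := rfl
  w_bounded := by decide +kernel

/-- The translation `Tr'_*`; it is the identity on every symbol but `W`. -/
def trStar' : Translation where
  iob := .iob 0
  ph := .ph 0
  le := .le (.var 0) (.var 1)
  w := transW relY
  iob_bounded := rfl
  ph_bounded := rfl
  le_bounded := rfl
  w_bounded := by decide +kernel

/-- `e` is an ether observer and `v̄_k(e) = v`, where `k`, `e` are the body variables `0`, `1`
and the coordinates of `v` are the quantity variables `0`, `1`, `2`. -/
def etherVelIs : Fml := ether 1 ⋏ velIs 0 1 ![.var 0, .var 1, .var 2]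

/-- `e` is an ether observer and `𝔠ₑ V / (1 + |V|) = v` for `V = v̄_k(e)`; variables as in
`etherVelIs`. -/
def etherSlowedVelIs : Fml :=
  ether 1 ⋏ .exQs 4 (isCe (.var 3) ⋏ velIs 0 1 ![.var 0, .var 1, .var 2] ⋏
    all3 fun i => eqE (slow (.v 3) ![.v 0, .v 1, .v 2] i) (.v (4 + i)))

end Kin

set_option linter.unusedSectionVars false

namespace Kin

/-! ## Substitution -/

namespace QTerm

/-! Both theories are finite, so soundness and a Henkin completeness theorem for finite theories
(`Proves.sound`, `Proves.complete`) turn every claim about derivability into a claim about models.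
In a model the quantities form a Euclidean ordered field (`exists_field`), and satisfying a
translated formula means satisfying the original one in the structure whose `W` has been redefined
by the translation (`sat_map_trStar`, `sat_map_trStar'`).

Models are then put in a normal form, `World`. Fix an ether observer `e₀` and use his coordinates as
base coordinates. Every inertial observer `k` is attached to the base by a Galilean map `(t, p) ↦ (ε
t + τ, A p + t b + a)`, with `ε = ±1` and `A` orthogonal; other bodies are recorded by their
worldlines in base coordinates. The difficult point is that worldview transformations are Galilean
when only the straightness of slower-than-light lines is available (`exists_gal`, `exists_chart`).
Light signals separate events, so "the same event" means "the same base point" (`same_act`). The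
ether observers are exactly the observers with `b = 0` (`ether_iff`), and `k` sees any of them move
with velocity `ε b`, of length `|b|` (`velIs_iff`).

In this form the translations are transparent. Applying `X` to the coordinates of each `k`
multiplies his `b` by `c / (1 + |b|)`, and `Y` multiplies it by `1 / (c - |b|)`; the base
worldlines, and light in particular, stay as they are (`tr_eq_boost`, `tr_relX`, `Slow.tr_relY`).
The induced radial maps on velocities are mutually inverse bijections between the whole velocity
space and the open ball of radius `c`. They therefore exchange the worlds of the two theories
(`Full.slowed`, `Slow.sped`), which gives the interpretations, and they compose to the identity
(`sped_slowed`, `Slow.slowed_sped`), which gives the equivalences. The statement on the ether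
velocity is the same rescaling applied to `ε b`. -/

theorem subst_subst (σ τ : ℕ → QTerm) (t : QTerm) :
    (t.subst σ).subst τ = t.subst fun i => (σ i).subst τ := by
  induction t with
  | var n => rfl
  | add a b iha ihb => simp [subst, iha, ihb]
  | mul a b iha ihb => simp [subst, iha, ihb]

@[simp] theorem subst_var (t : QTerm) : t.subst var = t := by
  induction t with
  | var n => rfl
  | add a b iha ihb => simp [subst, iha, ihb]
  | mul a b iha ihb => simp [subst, iha, ihb]

theorem subst_congr {n : ℕ} {σ τ : ℕ → QTerm} (t : QTerm) (ht : t.bounded n = true)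
    (h : ∀ i < n, σ i = τ i) : t.subst σ = t.subst τ := by
  induction t with
  | var i => exact h i (by simpa [bounded] using ht)
  | add a b iha ihb =>
    simp only [bounded, Bool.and_eq_true] at ht
    simp [subst, iha ht.1, ihb ht.2]
  | mul a b iha ihb =>
    simp only [bounded, Bool.and_eq_true] at ht
    simp [subst, iha ht.1, ihb ht.2]

theorem bounded_mono {m n : ℕ} (h : m ≤ n) (t : QTerm) (ht : t.bounded m = true) :
    t.bounded n = true := by
  induction t with
  | var i => simp only [bounded, decide_eq_true_eq] at ht ⊢; omega
  | add a b iha ihb =>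
    simp only [bounded, Bool.and_eq_true] at ht ⊢
    exact ⟨iha ht.1, ihb ht.2⟩
  | mul a b iha ihb =>
    simp only [bounded, Bool.and_eq_true] at ht ⊢
    exact ⟨iha ht.1, ihb ht.2⟩

theorem exists_bounded (t : QTerm) : ∃ n, t.bounded n = true := by
  induction t with
  | var i => exact ⟨i + 1, by simp [bounded]⟩
  | add a b iha ihb =>
    obtain ⟨m, hm⟩ := iha
    obtain ⟨n, hn⟩ := ihb
    exact ⟨max m n, by simp [bounded, bounded_mono (le_max_left m n) a hm,
      bounded_mono (le_max_right m n) b hn]⟩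
  | mul a b iha ihb =>
    obtain ⟨m, hm⟩ := iha
    obtain ⟨n, hn⟩ := ihb
    exact ⟨max m n, by simp [bounded, bounded_mono (le_max_left m n) a hm,
      bounded_mono (le_max_right m n) b hn]⟩

/-- An injective code of terms. -/
def code : QTerm → ℕ
  | var n => Nat.pair 0 n
  | add a b => Nat.pair 1 (Nat.pair a.code b.code)
  | mul a b => Nat.pair 2 (Nat.pair a.code b.code)

theorem code_injective : Function.Injective code := by
  intro s
  induction s with
  | var n => intro t h; cases t <;> simp_all [code]
  | add a b iha ihb =>
    intro t h
    cases t <;> simp only [code, Nat.pair_eq_pair] at h <;> simp at h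
    rw [iha h.1, ihb h.2]
  | mul a b iha ihb =>
    intro t h
    cases t <;> simp only [code, Nat.pair_eq_pair] at h <;> simp at h
    rw [iha h.1, ihb h.2]

end QTerm

/-- Prepend a value to a sequence. -/
def scons {α : Type} (a : α) (f : ℕ → α) : ℕ → α
  | 0 => a
  | n + 1 => f n

@[simp] theorem scons_zero {α : Type} (a : α) (f : ℕ → α) : scons a f 0 = a := rfl
@[simp] theorem scons_succ {α : Type} (a : α) (f : ℕ → α) (n : ℕ) : scons a f (n + 1) = f n := rfl

namespace Fml

theorem upB_comp (β β' : ℕ → ℕ) : (fun i => upB β' (upB β i)) = upB fun i => β' (β i) := by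
  funext i; cases i <;> rfl

theorem upQ_comp (σ σ' : ℕ → QTerm) :
    (fun i => (upQ σ i).subst (upQ σ')) = upQ fun i => (σ i).subst σ' := by
  funext i
  cases i with
  | zero => rfl
  | succ n => simp [upQ, QTerm.lift, QTerm.subst_subst, QTerm.subst]

theorem subst_subst (β β' : ℕ → ℕ) (σ σ' : ℕ → QTerm) (φ : Fml) :
    (φ.subst β σ).subst β' σ' = φ.subst (fun i => β' (β i)) fun i => (σ i).subst σ' := by
  induction φ generalizing β β' σ σ' with
  | allB φ ih => simp [subst, ih, upB_comp]
  | allQ φ ih => simp [subst, ih, upQ_comp]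
  | imp φ ψ ih1 ih2 => simp [subst, ih1, ih2]
  | _ => simp [subst, QTerm.subst_subst]

theorem upB_id : upB (fun i => i) = fun i => i := by funext i; cases i <;> rfl

theorem upQ_var : upQ QTerm.var = QTerm.var := by funext i; cases i <;> rfl

theorem subst_id (φ : Fml) : φ.subst (fun i => i) QTerm.var = φ := by
  induction φ with
  | allB φ ih => simp [subst, upB_id, ih]
  | allQ φ ih => simp [subst, upQ_var, ih]
  | imp φ ψ ih1 ih2 => simp [subst, ih1, ih2]
  | _ => simp [subst]

theorem instB_eq (φ : Fml) (k : ℕ) : φ.instB k = φ.subst (scons k fun i => i) QTerm.var := by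
  unfold instB; congr 1

theorem instQ_eq (φ : Fml) (t : QTerm) :
    φ.instQ t = φ.subst (fun i => i) (scons t QTerm.var) := by
  unfold instQ; congr 1

/-- Collapsing substitution and instantiation into one simultaneous substitution matches the way
quantifiers extend an assignment in `sat`; the truth lemma of the term model depends on this form.
-/
theorem subst_up_instB (φ : Fml) (β : ℕ → ℕ) (σ : ℕ → QTerm) (k : ℕ) :
    (φ.subst (upB β) σ).instB k = φ.subst (scons k β) σ := by
  rw [instB_eq, subst_subst]
  congr 1
  · funext i; cases i <;> rfl
  · funext i; simp

theorem subst_up_instQ (φ : Fml) (β : ℕ → ℕ) (σ : ℕ → QTerm) (t : QTerm) :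
    (φ.subst β (upQ σ)).instQ t = φ.subst β (scons t σ) := by
  rw [instQ_eq, subst_subst]
  congr 1
  funext i
  cases i with
  | zero => rfl
  | succ n => simp [upQ, QTerm.lift, QTerm.subst_subst, QTerm.subst]

theorem instB_subst (φ : Fml) (β : ℕ → ℕ) (σ : ℕ → QTerm) (k : ℕ) :
    (φ.instB k).subst β σ = (φ.subst (upB β) σ).instB (β k) := by
  rw [subst_up_instB, instB_eq, subst_subst]
  congr 1
  funext i; cases i <;> rfl

theorem instQ_subst (φ : Fml) (β : ℕ → ℕ) (σ : ℕ → QTerm) (t : QTerm) :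
    (φ.instQ t).subst β σ = (φ.subst β (upQ σ)).instQ (t.subst σ) := by
  rw [subst_up_instQ, instQ_eq, subst_subst]
  congr 1
  funext i; cases i <;> rfl

theorem shiftB_subst (φ : Fml) (β : ℕ → ℕ) (σ : ℕ → QTerm) :
    φ.shiftB.subst (upB β) σ = (φ.subst β σ).shiftB := by
  unfold shiftB
  rw [subst_subst, subst_subst]
  simp [QTerm.subst, upB]

theorem shiftQ_subst (φ : Fml) (β : ℕ → ℕ) (σ : ℕ → QTerm) :
    φ.shiftQ.subst β (upQ σ) = (φ.subst β σ).shiftQ := by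
  unfold shiftQ
  rw [subst_subst, subst_subst]
  rfl

/-- This is what makes a variable beyond the bound fresh: changing a substitution there has no
effect on the formula. -/
theorem subst_congr {m n : ℕ} {β β' : ℕ → ℕ} {σ σ' : ℕ → QTerm} (φ : Fml)
    (hφ : φ.bounded m n = true) (hβ : ∀ i < m, β i = β' i) (hσ : ∀ i < n, σ i = σ' i) :
    φ.subst β σ = φ.subst β' σ' := by
  induction φ generalizing m n β β' σ σ' with
  | allB φ ih =>
    simp only [bounded] at hφ
    simp only [subst]
    rw [ih hφ (β' := upB β') (σ' := σ') _ hσ]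
    rintro (_ | i) hi
    · rfl
    · simp [upB, hβ i (by omega)]
  | allQ φ ih =>
    simp only [bounded] at hφ
    simp only [subst]
    rw [ih hφ (β' := β') (σ' := upQ σ') hβ]
    rintro (_ | i) hi
    · rfl
    · simp [upQ, hσ i (by omega)]
  | imp φ ψ ih1 ih2 =>
    simp only [bounded, Bool.and_eq_true] at hφ
    simp only [subst]
    rw [ih1 hφ.1 hβ hσ, ih2 hφ.2 hβ hσ]
  | iob k => simp only [bounded, decide_eq_true_eq] at hφ; simp [subst, hβ k hφ]
  | ph k => simp only [bounded, decide_eq_true_eq] at hφ; simp [subst, hβ k hφ]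
  | eqB k h =>
    simp only [bounded, decide_eq_true_eq, Bool.and_eq_true] at hφ
    simp [subst, hβ _ hφ.1, hβ _ hφ.2]
  | w k b x =>
    simp only [bounded, decide_eq_true_eq, Bool.and_eq_true, and_assoc] at hφ
    obtain ⟨h1, h2, h3, h4, h5, h6⟩ := hφ
    have : ∀ i, (x i).bounded n = true := by intro i; fin_cases i <;> assumption
    simp [subst, hβ _ h1, hβ _ h2, fun i => QTerm.subst_congr _ (this i) hσ]
  | le s t =>
    simp only [bounded, Bool.and_eq_true] at hφ
    simp [subst, QTerm.subst_congr s hφ.1 hσ, QTerm.subst_congr t hφ.2 hσ]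
  | eqQ s t =>
    simp only [bounded, Bool.and_eq_true] at hφ
    simp [subst, QTerm.subst_congr s hφ.1 hσ, QTerm.subst_congr t hφ.2 hσ]
  | bot => rfl

theorem bounded_mono {m m' n n' : ℕ} (hm : m ≤ m') (hn : n ≤ n') (φ : Fml)
    (h : φ.bounded m n = true) : φ.bounded m' n' = true := by
  induction φ generalizing m m' n n' with
  | allB φ ih => exact ih (Nat.succ_le_succ hm) hn h
  | allQ φ ih => exact ih hm (Nat.succ_le_succ hn) h
  | imp φ ψ ih1 ih2 =>
    simp only [bounded, Bool.and_eq_true] at h ⊢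
    exact ⟨ih1 hm hn h.1, ih2 hm hn h.2⟩
  | iob k => simp only [bounded, decide_eq_true_eq] at h ⊢; omega
  | ph k => simp only [bounded, decide_eq_true_eq] at h ⊢; omega
  | eqB k l => simp only [bounded, decide_eq_true_eq, Bool.and_eq_true] at h ⊢; omega
  | w k b x =>
    simp only [bounded, decide_eq_true_eq, Bool.and_eq_true, and_assoc] at h ⊢
    obtain ⟨h1, h2, h3, h4, h5, h6⟩ := h
    exact ⟨h1.trans_le hm, h2.trans_le hm, QTerm.bounded_mono hn _ h3,
      QTerm.bounded_mono hn _ h4, QTerm.bounded_mono hn _ h5, QTerm.bounded_mono hn _ h6⟩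
  | le s t =>
    simp only [bounded, Bool.and_eq_true] at h ⊢
    exact ⟨QTerm.bounded_mono hn _ h.1, QTerm.bounded_mono hn _ h.2⟩
  | eqQ s t =>
    simp only [bounded, Bool.and_eq_true] at h ⊢
    exact ⟨QTerm.bounded_mono hn _ h.1, QTerm.bounded_mono hn _ h.2⟩
  | bot => rfl

theorem exists_bounded (φ : Fml) : ∃ n, φ.bounded n n = true := by
  induction φ with
  | allB φ ih =>
    obtain ⟨n, hn⟩ := ih
    exact ⟨n, bounded_mono (Nat.le_succ n) le_rfl φ hn⟩
  | allQ φ ih =>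
    obtain ⟨n, hn⟩ := ih
    exact ⟨n, bounded_mono le_rfl (Nat.le_succ n) φ hn⟩
  | imp φ ψ ih1 ih2 =>
    obtain ⟨m, hm⟩ := ih1
    obtain ⟨n, hn⟩ := ih2
    exact ⟨max m n, by simp [bounded, bounded_mono (le_max_left m n) (le_max_left m n) φ hm,
      bounded_mono (le_max_right m n) (le_max_right m n) ψ hn]⟩
  | iob k => exact ⟨k + 1, by simp [bounded]⟩
  | ph k => exact ⟨k + 1, by simp [bounded]⟩
  | eqB k l => exact ⟨k + l + 1, by simp only [bounded, decide_eq_true_eq, Bool.and_eq_true]; omega⟩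
  | w k b x =>
    choose n hn using fun i => (x i).exists_bounded
    refine ⟨k + b + n 0 + n 1 + n 2 + n 3 + 1, ?_⟩
    simp only [bounded, decide_eq_true_eq, Bool.and_eq_true, and_assoc]
    refine ⟨by omega, by omega, ?_, ?_, ?_, ?_⟩ <;>
      exact QTerm.bounded_mono (by omega) _ (hn _)
  | le s t =>
    obtain ⟨m, hm⟩ := s.exists_bounded
    obtain ⟨n, hn⟩ := t.exists_bounded
    exact ⟨max m n, by simp [bounded, QTerm.bounded_mono (le_max_left m n) s hm,
      QTerm.bounded_mono (le_max_right m n) t hn]⟩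
  | eqQ s t =>
    obtain ⟨m, hm⟩ := s.exists_bounded
    obtain ⟨n, hn⟩ := t.exists_bounded
    exact ⟨max m n, by simp [bounded, QTerm.bounded_mono (le_max_left m n) s hm,
      QTerm.bounded_mono (le_max_right m n) t hn]⟩
  | bot => exact ⟨0, rfl⟩

theorem exists_bounded_of_finite {Γ : Set Fml} (h : Γ.Finite) :
    ∃ n, ∀ φ ∈ Γ, φ.bounded n n = true := by
  induction Γ, h using Set.Finite.induction_on with
  | empty => exact ⟨0, by simp⟩
  | @insert φ Γ _ _ ih =>
    obtain ⟨m, hm⟩ := ih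
    obtain ⟨n, hn⟩ := φ.exists_bounded
    refine ⟨max m n, ?_⟩
    rintro ψ (rfl | hψ)
    · exact bounded_mono (le_max_right m n) (le_max_right m n) _ hn
    · exact bounded_mono (le_max_left m n) (le_max_left m n) _ (hm ψ hψ)

/-- An injective code of formulas. -/
def code : Fml → ℕ
  | iob k => Nat.pair 0 k
  | ph p => Nat.pair 1 p
  | w k b x => Nat.pair 2 (Nat.pair k (Nat.pair b (Nat.pair (x 0).code
      (Nat.pair (x 1).code (Nat.pair (x 2).code (x 3).code)))))
  | le s t => Nat.pair 3 (Nat.pair s.code t.code)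
  | eqQ s t => Nat.pair 4 (Nat.pair s.code t.code)
  | eqB k h => Nat.pair 5 (Nat.pair k h)
  | bot => Nat.pair 6 0
  | imp φ ψ => Nat.pair 7 (Nat.pair φ.code ψ.code)
  | allB φ => Nat.pair 8 φ.code
  | allQ φ => Nat.pair 9 φ.code

theorem code_injective : Function.Injective code := by
  intro φ
  induction φ with
  | imp φ ψ ih1 ih2 =>
    intro χ h
    cases χ <;> simp only [code, Nat.pair_eq_pair] at h <;> simp at h
    rw [ih1 h.1, ih2 h.2]
  | allB φ ih =>
    intro χ h
    cases χ <;> simp only [code, Nat.pair_eq_pair] at h <;> simp at h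
    rw [ih h]
  | allQ φ ih =>
    intro χ h
    cases χ <;> simp only [code, Nat.pair_eq_pair] at h <;> simp at h
    rw [ih h]
  | w k b x =>
    intro χ h
    cases χ <;> simp only [code, Nat.pair_eq_pair] at h <;> simp at h
    obtain ⟨rfl, rfl, h0, h1, h2, h3⟩ := h
    congr 1
    funext i
    apply QTerm.code_injective
    fin_cases i <;> assumption
  | _ =>
    intro χ h
    cases χ <;> simp_all [code, Nat.pair_eq_pair, QTerm.code_injective.eq_iff]

end Fml

/-! ## Structural properties of derivability -/

namespace Proves

theorem mono {Γ Δ : Set Fml} {φ : Fml} (h : Proves Γ φ) (hΓ : Γ ⊆ Δ) : Proves Δ φ := by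
  induction h generalizing Δ with
  | ax h => exact ax (hΓ h)
  | impI _ ih => exact impI (ih (Set.insert_subset_insert hΓ))
  | impE _ _ ih1 ih2 => exact impE (ih1 hΓ) (ih2 hΓ)
  | byContra _ ih => exact byContra (ih (Set.insert_subset_insert hΓ))
  | allBI _ ih => exact allBI (ih (Set.image_mono hΓ))
  | allBE k _ ih => exact allBE k (ih hΓ)
  | allQI _ ih => exact allQI (ih (Set.image_mono hΓ))
  | allQE t _ ih => exact allQE t (ih hΓ)
  | eqBRefl k => exact eqBRefl k
  | eqBSubst φ _ _ ih1 ih2 => exact eqBSubst φ (ih1 hΓ) (ih2 hΓ)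
  | eqQRefl t => exact eqQRefl t
  | eqQSubst φ _ _ ih1 ih2 => exact eqQSubst φ (ih1 hΓ) (ih2 hΓ)

/-- Needed in order to rename a fresh variable to the bound one when generalizing. In the quantifier
introductions, substitution commutes with shifting the context. -/
theorem subst {Γ : Set Fml} {φ : Fml} (h : Proves Γ φ) (β : ℕ → ℕ) (σ : ℕ → QTerm) :
    Proves (Fml.subst β σ '' Γ) (φ.subst β σ) := by
  induction h generalizing β σ with
  | ax h => exact ax ⟨_, h, rfl⟩
  | impI _ ih =>
    have := ih β σ
    rw [Set.image_insert_eq] at this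
    exact impI this
  | impE _ _ ih1 ih2 => exact impE (ih1 β σ) (ih2 β σ)
  | byContra _ ih =>
    have := ih β σ
    rw [Set.image_insert_eq] at this
    exact byContra this
  | @allBI Γ φ _ ih =>
    refine allBI (φ := φ.subst (Fml.upB β) σ) ((ih (Fml.upB β) σ).mono ?_)
    rintro _ ⟨_, ⟨ψ, hψ, rfl⟩, rfl⟩
    exact ⟨_, ⟨ψ, hψ, rfl⟩, (Fml.shiftB_subst ψ β σ).symm⟩
  | allBE k _ ih =>
    rw [Fml.instB_subst]
    exact allBE (β k) (ih β σ)
  | @allQI Γ φ _ ih =>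
    refine allQI (φ := φ.subst β (Fml.upQ σ)) ((ih β (Fml.upQ σ)).mono ?_)
    rintro _ ⟨_, ⟨ψ, hψ, rfl⟩, rfl⟩
    exact ⟨_, ⟨ψ, hψ, rfl⟩, (Fml.shiftQ_subst ψ β σ).symm⟩
  | allQE t _ ih =>
    rw [Fml.instQ_subst]
    exact allQE (t.subst σ) (ih β σ)
  | eqBRefl k => exact eqBRefl _
  | eqBSubst φ _ _ ih1 ih2 =>
    rw [Fml.instB_subst]
    refine eqBSubst _ (ih1 β σ) ?_
    rw [← Fml.instB_subst]
    exact ih2 β σ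
  | eqQRefl t => exact eqQRefl _
  | eqQSubst φ _ _ ih1 ih2 =>
    rw [Fml.instQ_subst]
    refine eqQSubst _ (ih1 β σ) ?_
    rw [← Fml.instQ_subst]
    exact ih2 β σ

theorem exists_finite_of_insert {Γ Δ : Set Fml} {φ : Fml} (hf : Δ.Finite)
    (h : Δ ⊆ insert φ Γ) : ∃ Δ' ⊆ Γ, Δ'.Finite ∧ Δ ⊆ insert φ Δ' :=
  ⟨Δ \ {φ}, fun x hx => (h hx.1).resolve_left hx.2, hf.sdiff, fun x hx => by
    by_cases hxφ : x = φ
    · exact Or.inl hxφ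
    · exact Or.inr ⟨hx, hxφ⟩⟩

/-- Derivations are finite. This keeps the union of a chain of consistent sets consistent. -/
theorem finite_support {Γ : Set Fml} {φ : Fml} (h : Proves Γ φ) :
    ∃ Δ ⊆ Γ, Δ.Finite ∧ Proves Δ φ := by
  induction h with
  | @ax Γ φ h => exact ⟨{φ}, by simpa using h, Set.finite_singleton φ, ax rfl⟩
  | impI _ ih =>
    obtain ⟨Δ, hΔ, hf, h⟩ := ih
    obtain ⟨Δ', h1, h2, h3⟩ := exists_finite_of_insert hf hΔ
    exact ⟨Δ', h1, h2, impI (h.mono h3)⟩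
  | impE _ _ ih1 ih2 =>
    obtain ⟨Δ, hΔ, hf, h⟩ := ih1
    obtain ⟨Δ', hΔ', hf', h'⟩ := ih2
    exact ⟨Δ ∪ Δ', Set.union_subset hΔ hΔ', hf.union hf',
      impE (h.mono Set.subset_union_left) (h'.mono Set.subset_union_right)⟩
  | byContra _ ih =>
    obtain ⟨Δ, hΔ, hf, h⟩ := ih
    obtain ⟨Δ', h1, h2, h3⟩ := exists_finite_of_insert hf hΔ
    exact ⟨Δ', h1, h2, byContra (h.mono h3)⟩
  | allBI _ ih =>
    obtain ⟨Δ, hΔ, hf, h⟩ := ih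
    -- A finite part of the shifted context is the shift of a finite part of the context.
    obtain ⟨Δ', h1, h2, rfl⟩ := Set.exists_subset_image_finite_and.1 ⟨Δ, hΔ, hf, rfl⟩
    exact ⟨Δ', h1, h2, allBI h⟩
  | allBE k _ ih =>
    obtain ⟨Δ, hΔ, hf, h⟩ := ih
    exact ⟨Δ, hΔ, hf, allBE k h⟩
  | allQI _ ih =>
    obtain ⟨Δ, hΔ, hf, h⟩ := ih
    obtain ⟨Δ', h1, h2, rfl⟩ := Set.exists_subset_image_finite_and.1 ⟨Δ, hΔ, hf, rfl⟩
    exact ⟨Δ', h1, h2, allQI h⟩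
  | allQE t _ ih =>
    obtain ⟨Δ, hΔ, hf, h⟩ := ih
    exact ⟨Δ, hΔ, hf, allQE t h⟩
  | eqBRefl k => exact ⟨∅, Set.empty_subset _, Set.finite_empty, eqBRefl k⟩
  | eqBSubst φ _ _ ih1 ih2 =>
    obtain ⟨Δ, hΔ, hf, h⟩ := ih1
    obtain ⟨Δ', hΔ', hf', h'⟩ := ih2
    exact ⟨Δ ∪ Δ', Set.union_subset hΔ hΔ', hf.union hf',
      eqBSubst φ (h.mono Set.subset_union_left) (h'.mono Set.subset_union_right)⟩
  | eqQRefl t => exact ⟨∅, Set.empty_subset _, Set.finite_empty, eqQRefl t⟩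
  | eqQSubst φ _ _ ih1 ih2 =>
    obtain ⟨Δ, hΔ, hf, h⟩ := ih1
    obtain ⟨Δ', hΔ', hf', h'⟩ := ih2
    exact ⟨Δ ∪ Δ', Set.union_subset hΔ hΔ', hf.union hf',
      eqQSubst φ (h.mono Set.subset_union_left) (h'.mono Set.subset_union_right)⟩

/-- Generalization over a fresh body variable. -/
theorem allB_of_fresh {Γ : Set Fml} {φ : Fml} {n : ℕ} (hΓ : ∀ ψ ∈ Γ, ψ.bounded n n = true)
    (hφ : φ.bounded n n = true) (h : Proves Γ (φ.instB n)) : Proves Γ (Fml.allB φ) := by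
  refine allBI ?_
  -- Sending `n` to `0` and shifting everything else turns `φ.instB n` back into `φ`; on formulas of
  -- `Γ`, where `n` does not occur, it is just `shiftB`.
  have := h.subst (fun i => if i = n then 0 else i + 1) QTerm.var
  rw [Fml.instB_eq, Fml.subst_subst] at this
  rw [Fml.subst_congr (n := n) (m := n) φ hφ (β' := fun i => i) (σ' := QTerm.var)] at this
  · rw [Fml.subst_id] at this
    refine this.mono ?_
    rintro _ ⟨ψ, hψ, rfl⟩
    refine ⟨ψ, hψ, (Fml.subst_congr ψ (hΓ ψ hψ) (fun i hi => ?_) fun i _ => rfl)⟩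
    simp [hi.ne]
  · rintro (_ | i) hi
    · simp
    · have : i ≠ n := by omega
      simp [this]
  · intro i _; rfl

/-- Generalization over a fresh quantity variable. -/
theorem allQ_of_fresh {Γ : Set Fml} {φ : Fml} {n : ℕ} (hΓ : ∀ ψ ∈ Γ, ψ.bounded n n = true)
    (hφ : φ.bounded n n = true) (h : Proves Γ (φ.instQ (.var n))) : Proves Γ (Fml.allQ φ) := by
  refine allQI ?_
  have := h.subst (fun i => i) (fun i => .var (if i = n then 0 else i + 1))
  rw [Fml.instQ_eq, Fml.subst_subst] at this
  rw [Fml.subst_congr (n := n) (m := n) φ hφ (β' := fun i => i) (σ' := QTerm.var)] at this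
  · rw [Fml.subst_id] at this
    refine this.mono ?_
    rintro _ ⟨ψ, hψ, rfl⟩
    refine ⟨ψ, hψ, (Fml.subst_congr ψ (hΓ ψ hψ) (fun i hi => rfl) fun i hi => ?_)⟩
    simp [hi.ne]
  · intro i _; rfl
  · rintro (_ | i) hi
    · simp [QTerm.subst]
    · have : i ≠ n := by omega
      simp [QTerm.subst, this]

theorem exfalso {Γ : Set Fml} (φ : Fml) (h : Proves Γ Fml.bot) : Proves Γ φ :=
  byContra (h.mono (Set.subset_insert _ _))

end Proves


/-! ## Semantics -/

/-- The interpretation of the relation symbols in a structure with bodies `B` and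
quantities `Q`. -/
structure Str (B Q : Type) where
  iob : B → Prop
  ph : B → Prop
  w : B → B → (Fin 4 → Q) → Prop

namespace QTerm

/-- The value of a term under an assignment. -/
def eval {Q : Type} [Add Q] [Mul Q] (ρ : ℕ → Q) : QTerm → Q
  | var n => ρ n
  | add a b => a.eval ρ + b.eval ρ
  | mul a b => a.eval ρ * b.eval ρ

theorem eval_subst {Q : Type} [Add Q] [Mul Q] (ρ : ℕ → Q) (σ : ℕ → QTerm) (t : QTerm) :
    (t.subst σ).eval ρ = t.eval fun i => (σ i).eval ρ := by
  induction t with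
  | var n => rfl
  | add a b iha ihb => simp [subst, eval, iha, ihb]
  | mul a b iha ihb => simp [subst, eval, iha, ihb]

end QTerm

/-- Satisfaction. -/
def sat {B Q : Type} [Add Q] [Mul Q] [LE Q] (S : Str B Q) (b : ℕ → B) (ρ : ℕ → Q) : Fml → Prop
  | .iob k => S.iob (b k)
  | .ph p => S.ph (b p)
  | .w k h x => S.w (b k) (b h) fun i => (x i).eval ρ
  | .le s t => s.eval ρ ≤ t.eval ρ
  | .eqQ s t => s.eval ρ = t.eval ρ
  | .eqB k h => b k = b h
  | .bot => False
  | .imp φ ψ => sat S b ρ φ → sat S b ρ ψ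
  | .allB φ => ∀ a, sat S (scons a b) ρ φ
  | .allQ φ => ∀ a, sat S b (scons a ρ) φ

section Semantics

variable {B Q : Type} [Add Q] [Mul Q] [LE Q] (S : Str B Q)

theorem sat_subst (b : ℕ → B) (ρ : ℕ → Q) (β : ℕ → ℕ) (σ : ℕ → QTerm) (φ : Fml) :
    sat S b ρ (φ.subst β σ) ↔ sat S (fun i => b (β i)) (fun i => (σ i).eval ρ) φ := by
  induction φ generalizing b ρ β σ with
  | allB φ ih =>
    simp only [Fml.subst, sat, ih]
    refine forall_congr' fun a => ?_
    have : (fun i => scons a b (Fml.upB β i)) = scons a fun i => b (β i) := by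
      funext i; cases i <;> rfl
    rw [this]
  | allQ φ ih =>
    simp only [Fml.subst, sat, ih]
    refine forall_congr' fun a => ?_
    have : (fun i => (Fml.upQ σ i).eval (scons a ρ)) = scons a fun i => (σ i).eval ρ := by
      funext i
      cases i with
      | zero => rfl
      | succ n => simp [Fml.upQ, QTerm.lift, QTerm.eval_subst, QTerm.eval]
    rw [this]
  | imp φ ψ ih1 ih2 => simp only [Fml.subst, sat, ih1, ih2]
  | _ => simp only [Fml.subst, sat, QTerm.eval_subst]

theorem sat_instB (b : ℕ → B) (ρ : ℕ → Q) (k : ℕ) (φ : Fml) :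
    sat S b ρ (φ.instB k) ↔ sat S (scons (b k) b) ρ φ := by
  rw [Fml.instB_eq, sat_subst]
  have : (fun i => b (scons k (fun i => i) i)) = scons (b k) b := by
    funext i; cases i <;> rfl
  rw [this]
  rfl

theorem sat_instQ (b : ℕ → B) (ρ : ℕ → Q) (t : QTerm) (φ : Fml) :
    sat S b ρ (φ.instQ t) ↔ sat S b (scons (t.eval ρ) ρ) φ := by
  rw [Fml.instQ_eq, sat_subst]
  have : (fun i => (scons t QTerm.var i).eval ρ) = scons (t.eval ρ) ρ := by
    funext i; cases i <;> rfl
  rw [this]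

theorem Proves.sound {Γ : Set Fml} {φ : Fml} (h : Proves Γ φ) (b : ℕ → B) (ρ : ℕ → Q)
    (hΓ : ∀ ψ ∈ Γ, sat S b ρ ψ) : sat S b ρ φ := by
  induction h generalizing b ρ with
  | ax h => exact hΓ _ h
  | impI _ ih =>
    intro h
    refine ih b ρ ?_
    rintro ψ (rfl | hψ)
    exacts [h, hΓ ψ hψ]
  | impE _ _ ih1 ih2 => exact ih1 b ρ hΓ (ih2 b ρ hΓ)
  | byContra _ ih =>
    by_contra hc
    refine ih b ρ ?_
    rintro ψ (rfl | hψ)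
    exacts [hc, hΓ ψ hψ]
  | allBI _ ih =>
    intro a
    refine ih _ ρ ?_
    rintro _ ⟨ψ, hψ, rfl⟩
    exact (sat_subst S _ _ _ _ ψ).2 (hΓ ψ hψ)
  | allBE k _ ih => exact (sat_instB S b ρ k _).2 (ih b ρ hΓ _)
  | allQI _ ih =>
    intro a
    refine ih b _ ?_
    rintro _ ⟨ψ, hψ, rfl⟩
    exact (sat_subst S _ _ _ _ ψ).2 (hΓ ψ hψ)
  | allQE t _ ih => exact (sat_instQ S b ρ t _).2 (ih b ρ hΓ _)
  | eqBRefl k => exact rfl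
  | eqBSubst φ _ _ ih1 ih2 =>
    have h1 := ih1 b ρ hΓ
    have h2 := ih2 b ρ hΓ
    rw [sat_instB] at h2 ⊢
    rwa [← show b _ = b _ from h1]
  | eqQRefl t => exact rfl
  | eqQSubst φ _ _ ih1 ih2 =>
    have h1 := ih1 b ρ hΓ
    have h2 := ih2 b ρ hΓ
    rw [sat_instQ] at h2 ⊢
    rwa [← show QTerm.eval ρ _ = QTerm.eval ρ _ from h1]

end Semantics

/-! ## Completeness -/

/-- No contradiction is derivable. -/
def Consistent (Γ : Set Fml) : Prop := ¬ Proves Γ Fml.bot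

/-- The formula `φ` is decided by `Δ`, with witnesses if it is refuted and universal. -/
def DecidedBy (Δ : Set Fml) (φ : Fml) : Prop :=
  φ ∈ Δ ∨ (∼φ ∈ Δ ∧ (∀ χ, φ = Fml.allB χ → ∃ k, ∼(χ.instB k) ∈ Δ) ∧
    ∀ χ, φ = Fml.allQ χ → ∃ t, ∼(χ.instQ t) ∈ Δ)

/-- If `φ` cannot be added consistently, then `∼φ` can. For a universal `φ` a refuted instance at a
fresh variable can be added as well, since otherwise generalization would derive `φ`. Finiteness of
`Δ` supplies the fresh variable, so the language needs no new constants. -/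
theorem Consistent.exists_decidedBy {Δ : Set Fml} (hf : Δ.Finite) (hc : Consistent Δ) (φ : Fml) :
    ∃ Δ' : Set Fml, Δ ⊆ Δ' ∧ Δ'.Finite ∧ Consistent Δ' ∧ DecidedBy Δ' φ := by
  by_cases h : Consistent (insert φ Δ)
  · exact ⟨_, Set.subset_insert _ _, hf.insert φ, h, Or.inl (Set.mem_insert _ _)⟩
  have hneg : Consistent (insert (∼φ) Δ) := fun h' =>
    h fun h'' => hc (.impE (.impI h'') (.byContra h'))
  have hf' := hf.insert (∼φ)
  obtain ⟨m, hm⟩ := Fml.exists_bounded_of_finite hf'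
  have hmem : ∼φ ∈ insert (∼φ) Δ := Set.mem_insert _ _
  by_cases hB : ∃ χ, φ = Fml.allB χ
  · obtain ⟨χ, rfl⟩ := hB
    obtain ⟨n, hn⟩ := χ.exists_bounded
    refine ⟨insert (∼(χ.instB (max m n))) (insert (∼(Fml.allB χ)) Δ),
      (Set.subset_insert _ _).trans (Set.subset_insert _ _), hf'.insert _, fun h' => ?_,
      Or.inr ⟨Or.inr hmem, ?_, ?_⟩⟩
    · refine hneg (.impE (.ax hmem) (Proves.allB_of_fresh (n := max m n) ?_ ?_ (.byContra h')))
      · exact fun ψ hψ => Fml.bounded_mono (le_max_left _ _) (le_max_left _ _) ψ (hm ψ hψ)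
      · exact Fml.bounded_mono (le_max_right _ _) (le_max_right _ _) χ hn
    · rintro χ' ⟨⟩
      exact ⟨_, Or.inl rfl⟩
    · rintro χ' ⟨⟩
  by_cases hQ : ∃ χ, φ = Fml.allQ χ
  · obtain ⟨χ, rfl⟩ := hQ
    obtain ⟨n, hn⟩ := χ.exists_bounded
    refine ⟨insert (∼(χ.instQ (.var (max m n)))) (insert (∼(Fml.allQ χ)) Δ),
      (Set.subset_insert _ _).trans (Set.subset_insert _ _), hf'.insert _, fun h' => ?_,
      Or.inr ⟨Or.inr hmem, ?_, ?_⟩⟩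
    · refine hneg (.impE (.ax hmem) (Proves.allQ_of_fresh (n := max m n) ?_ ?_ (.byContra h')))
      · exact fun ψ hψ => Fml.bounded_mono (le_max_left _ _) (le_max_left _ _) ψ (hm ψ hψ)
      · exact Fml.bounded_mono (le_max_right _ _) (le_max_right _ _) χ hn
    · rintro χ' ⟨⟩
    · rintro χ' ⟨⟩
      exact ⟨_, Or.inl rfl⟩
  exact ⟨_, Set.subset_insert _ _, hf', hneg, Or.inr ⟨hmem, fun χ h => (hB ⟨χ, h⟩).elim,
    fun χ h => (hQ ⟨χ, h⟩).elim⟩⟩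

theorem DecidedBy.mono {Δ Δ' : Set Fml} {φ : Fml} (h : DecidedBy Δ φ) (hs : Δ ⊆ Δ') :
    DecidedBy Δ' φ := by
  rcases h with h | ⟨h, hB, hQ⟩
  · exact Or.inl (hs h)
  · exact Or.inr ⟨hs h, fun χ hχ => (hB χ hχ).imp fun _ h => hs h,
      fun χ hχ => (hQ χ hχ).imp fun _ h => hs h⟩

/-- Every finite consistent set extends to a consistent Henkin set. -/
theorem Consistent.exists_henkin {Γ : Set Fml} (hf : Γ.Finite) (hc : Consistent Γ) :
    ∃ Δ : Set Fml, Γ ⊆ Δ ∧ Consistent Δ ∧ ∀ φ, DecidedBy Δ φ := by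
  have : Countable Fml := Fml.code_injective.countable
  have : Nonempty Fml := ⟨Fml.bot⟩
  obtain ⟨f, hsurj⟩ := exists_surjective_nat Fml
  let T := {Δ : Set Fml // Δ.Finite ∧ Consistent Δ}
  have step : ∀ (Δ : T) (φ : Fml), ∃ Δ' : T, Δ.1 ⊆ Δ'.1 ∧ DecidedBy Δ'.1 φ := by
    rintro ⟨Δ, h1, h2⟩ φ
    obtain ⟨Δ', h3, h4, h5, h6⟩ := h2.exists_decidedBy h1 φ
    exact ⟨⟨Δ', h4, h5⟩, h3, h6⟩
  choose next hsub hdec using step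
  let s : ℕ → T := fun n => Nat.rec ⟨Γ, hf, hc⟩ (fun n Δ => next Δ (f n)) n
  have hs : ∀ n, s (n + 1) = next (s n) (f n) := fun n => rfl
  have hmono : Monotone fun n => (s n).1 := monotone_nat_of_le_succ fun n => hsub _ _
  refine ⟨⋃ n, (s n).1, Set.subset_iUnion (fun n => (s n).1) 0, fun h => ?_, fun φ => ?_⟩
  -- A derivation of a contradiction uses finitely many formulas, all present at a single stage of
  -- the chain.
  · obtain ⟨Δ, hΔ, hΔf, hΔp⟩ := h.finite_support
    obtain ⟨n, hn⟩ := (hmono.directed_le).exists_mem_subset_of_finset_subset_biUnion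
      (s := hΔf.toFinset) (by simpa using hΔ)
    exact (s n).2.2 (hΔp.mono (by simpa using hn))
  · obtain ⟨n, rfl⟩ := hsurj φ
    exact (hdec (s n) (f n)).mono (Set.subset_iUnion (fun n => (s n).1) (n + 1))

/-- A consistent set that decides every formula, with witnesses. -/
structure Henkin where
  carrier : Set Fml
  consistent : Consistent carrier
  decided : ∀ φ, DecidedBy carrier φ

namespace Henkin

variable (H : Henkin)

theorem mem_of_proves {φ : Fml} (h : Proves H.carrier φ) : φ ∈ H.carrier :=
  (H.decided φ).resolve_right fun h' => H.consistent (.impE (.ax h'.1) h)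

theorem neg_mem_iff {φ : Fml} : ∼φ ∈ H.carrier ↔ φ ∉ H.carrier := by
  constructor
  · intro h h'
    exact H.consistent (.impE (.ax h) (.ax h'))
  · intro h
    exact ((H.decided φ).resolve_left h).1

theorem imp_mem_iff {φ ψ : Fml} : (φ ⟹ ψ) ∈ H.carrier ↔ (φ ∈ H.carrier → ψ ∈ H.carrier) := by
  constructor
  · intro h h'
    exact H.mem_of_proves (.impE (.ax h) (.ax h'))
  · intro h
    by_cases h' : φ ∈ H.carrier
    · exact H.mem_of_proves (.impI (.ax (Or.inr (h h'))))
    · refine H.mem_of_proves (.impI (Proves.exfalso _ ?_))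
      exact .impE (.ax (Or.inr (H.neg_mem_iff.2 h'))) (.ax (Or.inl rfl))

theorem allB_mem_iff {φ : Fml} : Fml.allB φ ∈ H.carrier ↔ ∀ k, φ.instB k ∈ H.carrier := by
  constructor
  · intro h k
    exact H.mem_of_proves (.allBE k (.ax h))
  · intro h
    refine (H.decided _).resolve_right fun ⟨_, h', _⟩ => ?_
    obtain ⟨k, hk⟩ := h' φ rfl
    exact H.neg_mem_iff.1 hk (h k)

theorem allQ_mem_iff {φ : Fml} : Fml.allQ φ ∈ H.carrier ↔ ∀ t, φ.instQ t ∈ H.carrier := by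
  constructor
  · intro h t
    exact H.mem_of_proves (.allQE t (.ax h))
  · intro h
    refine (H.decided _).resolve_right fun ⟨_, _, h'⟩ => ?_
    obtain ⟨k, hk⟩ := h' φ rfl
    exact H.neg_mem_iff.1 hk (h k)

theorem eqB_congr {k h : ℕ} (β : ℕ → ℕ) (σ : ℕ → QTerm) (φ : Fml)
    (e : Fml.eqB k h ∈ H.carrier) (hk : φ.subst (scons k β) σ ∈ H.carrier) :
    φ.subst (scons h β) σ ∈ H.carrier := by
  rw [← Fml.subst_up_instB] at hk ⊢
  exact H.mem_of_proves (.eqBSubst _ (.ax e) (.ax hk))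

theorem eqQ_congr {s t : QTerm} (β : ℕ → ℕ) (σ : ℕ → QTerm) (φ : Fml)
    (e : (s ≐ t) ∈ H.carrier) (hs : φ.subst β (scons s σ) ∈ H.carrier) :
    φ.subst β (scons t σ) ∈ H.carrier := by
  rw [← Fml.subst_up_instQ] at hs ⊢
  exact H.mem_of_proves (.eqQSubst _ (.ax e) (.ax hs))

theorem eqB_refl (k : ℕ) : Fml.eqB k k ∈ H.carrier := H.mem_of_proves (.eqBRefl k)

theorem eqQ_refl (t : QTerm) : (t ≐ t) ∈ H.carrier := H.mem_of_proves (.eqQRefl t)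

/-- Provable equality of bodies. -/
def setoidB : Setoid ℕ where
  r k h := Fml.eqB k h ∈ H.carrier
  iseqv := by
    have symm : ∀ {k h}, Fml.eqB k h ∈ H.carrier → Fml.eqB h k ∈ H.carrier := fun {k h} e =>
      H.eqB_congr (fun _ => k) QTerm.var (.eqB 0 1) e (H.eqB_refl k)
    exact ⟨H.eqB_refl, symm, fun {x y z} e e' =>
      H.eqB_congr (fun _ => x) QTerm.var (.eqB 1 0) e' e⟩

/-- Provable equality of quantities. -/
def setoidQ : Setoid QTerm where
  r s t := (s ≐ t) ∈ H.carrier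
  iseqv := by
    have symm : ∀ {s t : QTerm}, (s ≐ t) ∈ H.carrier → (t ≐ s) ∈ H.carrier := fun {s t} e =>
      H.eqQ_congr id (fun _ => s) (.var 0 ≐ .var 1) e (H.eqQ_refl s)
    exact ⟨H.eqQ_refl, symm, fun {x y z} e e' =>
      H.eqQ_congr id (fun _ => x) (.var 1 ≐ .var 0) e' e⟩

/-- The bodies of the term model. -/
abbrev Bodies := Quotient H.setoidB

/-- The quantities of the term model. -/
abbrev Quantities := Quotient H.setoidQ

/-- Variables `2` and `3` keep the original terms, so `φ` can compare the old value of an operation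
with the new one. The arguments are exchanged one after the other; swapping brings the second one to
position `0`, where `eqQ_congr` acts. -/
theorem eqQ_of_op {a a' b b' : QTerm} (φ : Fml) (ha : (a ≐ a') ∈ H.carrier)
    (hb : (b ≐ b') ∈ H.carrier)
    (h : φ.subst id (scons a (scons b (scons a (scons b QTerm.var)))) ∈ H.carrier) :
    φ.subst id (scons a' (scons b' (scons a (scons b QTerm.var)))) ∈ H.carrier := by
  have h1 := H.eqQ_congr id (scons b (scons a (scons b QTerm.var))) φ ha h
  have swap : ∀ x y : QTerm, φ.subst id (scons x (scons y (scons a (scons b QTerm.var)))) =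
      (φ.subst id (scons (.var 1) (scons (.var 0) fun i => .var (i + 2)))).subst id
        (scons y (scons x (scons a (scons b QTerm.var)))) := by
    intro x y
    rw [Fml.subst_subst]
    congr 1
    funext i
    rcases i with _ | _ | i <;> rfl
  rw [swap] at h1 ⊢
  exact H.eqQ_congr id _ _ hb h1

instance : Add H.Quantities where
  add := Quotient.map₂ (fun a b => a + b) fun a _ ha b _ hb =>
    H.eqQ_of_op (.var 2 + .var 3 ≐ .var 0 + .var 1) ha hb (H.eqQ_refl (a + b))

instance : Mul H.Quantities where
  mul := Quotient.map₂ (fun a b => a * b) fun a _ ha b _ hb =>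
    H.eqQ_of_op (.var 2 * .var 3 ≐ .var 0 * .var 1) ha hb (H.eqQ_refl (a * b))

/-- Membership is tested on chosen representatives; `le_congr` shows that the choice is immaterial,
and the other relations of the term model are treated in the same way. -/
instance : LE H.Quantities where
  le x y := Fml.le x.out y.out ∈ H.carrier

/-- The term model. -/
def str : Str H.Bodies H.Quantities where
  iob k := Fml.iob k.out ∈ H.carrier
  ph p := Fml.ph p.out ∈ H.carrier
  w k b x := Fml.w k.out b.out (fun i => (x i).out) ∈ H.carrier

theorem out_eqB (k : ℕ) : Fml.eqB (Quotient.mk H.setoidB k).out k ∈ H.carrier :=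
  Quotient.exact (s := H.setoidB) (Quotient.out_eq _)

theorem out_eqQ (t : QTerm) : ((Quotient.mk H.setoidQ t).out ≐ t) ∈ H.carrier :=
  Quotient.exact (s := H.setoidQ) (Quotient.out_eq _)

theorem mk_eval (σ : ℕ → QTerm) (t : QTerm) :
    t.eval (fun i => Quotient.mk H.setoidQ (σ i)) = Quotient.mk H.setoidQ (t.subst σ) := by
  induction t with
  | var n => rfl
  | add a b iha ihb => simp only [QTerm.eval, iha, ihb]; rfl
  | mul a b iha ihb => simp only [QTerm.eval, iha, ihb]; rfl

theorem iob_congr {k k' : ℕ} (e : Fml.eqB k k' ∈ H.carrier) (h : Fml.iob k ∈ H.carrier) :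
    Fml.iob k' ∈ H.carrier :=
  H.eqB_congr id QTerm.var (.iob 0) e h

theorem ph_congr {k k' : ℕ} (e : Fml.eqB k k' ∈ H.carrier) (h : Fml.ph k ∈ H.carrier) :
    Fml.ph k' ∈ H.carrier :=
  H.eqB_congr id QTerm.var (.ph 0) e h

theorem le_congr {s s' t t' : QTerm} (e : (s ≐ s') ∈ H.carrier) (e' : (t ≐ t') ∈ H.carrier)
    (h : Fml.le s t ∈ H.carrier) : Fml.le s' t' ∈ H.carrier :=
  H.eqQ_of_op (.le (.var 0) (.var 1)) e e' h

theorem w_congr {k k' b b' : ℕ} {x x' : Fin 4 → QTerm} (e : Fml.eqB k k' ∈ H.carrier)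
    (e' : Fml.eqB b b' ∈ H.carrier) (ex : ∀ i, (x i ≐ x' i) ∈ H.carrier)
    (h : Fml.w k b x ∈ H.carrier) : Fml.w k' b' x' ∈ H.carrier := by
  have h1 : Fml.w k' b x ∈ H.carrier := by
    have := H.eqB_congr (fun _ => b) QTerm.var (.w 0 1 x) e (by simpa [Fml.subst] using h)
    simpa [Fml.subst] using this
  have h2 : Fml.w k' b' x ∈ H.carrier := by
    have := H.eqB_congr (fun _ => k') QTerm.var (.w 1 0 x) e' (by simpa [Fml.subst] using h1)
    simpa [Fml.subst] using this
  -- The equality rule exchanges one term at a time, so the coordinates are updated successively.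
  have hstep : ∀ (i : Fin 4) (y : Fin 4 → QTerm), y i = x i → Fml.w k' b' y ∈ H.carrier →
      Fml.w k' b' (Function.update y i (x' i)) ∈ H.carrier := by
    intro i y hy hw
    have key : ∀ s, Fml.w k' b' (Function.update y i s) =
        (Fml.w k' b' (Function.update (fun j => (y j).lift 1) i (.var 0))).subst id
          (scons s QTerm.var) := by
      intro s
      simp only [Fml.subst, id]
      congr 1
      funext j
      by_cases hj : j = i
      · subst hj; simp [QTerm.subst]
      · simp [hj, QTerm.lift, QTerm.subst_subst, QTerm.subst]
    rw [key]
    refine H.eqQ_congr id QTerm.var _ (ex i) ?_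
    rw [← key, ← hy, Function.update_eq_self]
    exact hw
  have h3 := hstep 0 x rfl h2
  have h4 := hstep 1 _ (by simp) h3
  have h5 := hstep 2 _ (by simp) h4
  have h6 := hstep 3 _ (by simp) h5
  convert h6 using 2
  funext i
  fin_cases i <;> simp [Function.update]

/-- The truth lemma. Arbitrary `β` and `σ` are carried along so that the instance arising from a
quantifier is again of the same form; the Henkin witnesses enter through `allB_mem_iff` and
`allQ_mem_iff`. -/
theorem sat_iff (φ : Fml) (β : ℕ → ℕ) (σ : ℕ → QTerm) :
    sat H.str (fun i => Quotient.mk H.setoidB (β i)) (fun i => Quotient.mk H.setoidQ (σ i)) φ ↔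
      φ.subst β σ ∈ H.carrier := by
  have symmB : ∀ {k h}, Fml.eqB k h ∈ H.carrier → Fml.eqB h k ∈ H.carrier :=
    fun e => H.setoidB.symm e
  have symmQ : ∀ {s t : QTerm}, (s ≐ t) ∈ H.carrier → (t ≐ s) ∈ H.carrier :=
    fun e => H.setoidQ.symm e
  induction φ generalizing β σ with
  | iob k => exact ⟨H.iob_congr (H.out_eqB _), H.iob_congr (symmB (H.out_eqB _))⟩
  | ph k => exact ⟨H.ph_congr (H.out_eqB _), H.ph_congr (symmB (H.out_eqB _))⟩
  | w k b x =>
    simp only [sat, mk_eval]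
    exact ⟨H.w_congr (H.out_eqB _) (H.out_eqB _) fun i => H.out_eqQ _,
      H.w_congr (symmB (H.out_eqB _)) (symmB (H.out_eqB _)) fun i => symmQ (H.out_eqQ _)⟩
  | le s t =>
    simp only [sat, mk_eval]
    exact ⟨H.le_congr (H.out_eqQ _) (H.out_eqQ _),
      H.le_congr (symmQ (H.out_eqQ _)) (symmQ (H.out_eqQ _))⟩
  | eqQ s t =>
    simp only [sat, mk_eval]
    exact ⟨fun h => Quotient.exact h, fun h => Quotient.sound h⟩
  | eqB k h => exact ⟨fun h => Quotient.exact h, fun h => Quotient.sound h⟩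
  | bot => exact ⟨False.elim, fun h => H.consistent (.ax h)⟩
  | imp φ ψ ih1 ih2 =>
    simp only [sat, Fml.subst]
    rw [H.imp_mem_iff]
    exact imp_congr (ih1 β σ) (ih2 β σ)
  | allB φ ih =>
    simp only [sat, Fml.subst]
    rw [H.allB_mem_iff, Quotient.forall]
    refine forall_congr' fun k => ?_
    rw [Fml.subst_up_instB]
    refine Iff.trans (iff_of_eq (congrArg (fun f => sat H.str f _ φ) ?_)) (ih (scons k β) σ)
    funext i; cases i <;> rfl
  | allQ φ ih =>
    simp only [sat, Fml.subst]
    rw [H.allQ_mem_iff, Quotient.forall]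
    refine forall_congr' fun k => ?_
    rw [Fml.subst_up_instQ]
    refine Iff.trans (iff_of_eq (congrArg (fun f => sat H.str _ f φ) ?_)) (ih β (scons k σ))
    funext i; cases i <;> rfl

end Henkin

/-- Completeness for finite theories. -/
theorem Proves.complete {Γ : Set Fml} (hf : Γ.Finite) {φ : Fml}
    (h : ∀ (B Q : Type) [Add Q] [Mul Q] [LE Q] (S : Str B Q) (b : ℕ → B) (ρ : ℕ → Q),
      (∀ ψ ∈ Γ, sat S b ρ ψ) → sat S b ρ φ) : Proves Γ φ := by
  refine .byContra ?_
  by_contra hc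
  obtain ⟨Δ, hΔ, hΔc, hΔd⟩ := Consistent.exists_henkin (hf.insert (∼φ)) hc
  let H : Henkin := ⟨Δ, hΔc, hΔd⟩
  have key : ∀ ψ, sat H.str (fun i => Quotient.mk H.setoidB i)
      (fun i => Quotient.mk H.setoidQ (.var i)) ψ ↔ ψ ∈ H.carrier := by
    intro ψ
    rw [H.sat_iff ψ (fun i => i) QTerm.var, Fml.subst_id]
  refine H.neg_mem_iff.1 (hΔ (Or.inl rfl)) ((key φ).1 (h _ _ H.str _ _ fun ψ hψ => ?_))
  exact (key ψ).2 (hΔ (Or.inr hψ))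


/-! ### Satisfaction of the defined connectives. -/

section Connectives

variable {B Q : Type} [Add Q] [Mul Q] [LE Q] (S : Str B Q) (b : ℕ → B) (ρ : ℕ → Q)

@[simp] theorem sat_imp (φ ψ : Fml) : sat S b ρ (φ ⟹ ψ) ↔ (sat S b ρ φ → sat S b ρ ψ) := Iff.rfl

@[simp] theorem sat_neg (φ : Fml) : sat S b ρ (∼φ) ↔ ¬ sat S b ρ φ := Iff.rfl

@[simp] theorem sat_conj (φ ψ : Fml) : sat S b ρ (φ ⋏ ψ) ↔ sat S b ρ φ ∧ sat S b ρ ψ := by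
  simp [Fml.conj]

@[simp] theorem sat_disj (φ ψ : Fml) : sat S b ρ (φ ⋎ ψ) ↔ sat S b ρ φ ∨ sat S b ρ ψ := by
  simp [Fml.disj, or_iff_not_imp_left]

@[simp] theorem sat_iff_iff (φ ψ : Fml) :
    sat S b ρ (φ ⟺ ψ) ↔ (sat S b ρ φ ↔ sat S b ρ ψ) := by
  simp [Fml.iff, iff_def]

@[simp] theorem sat_allB (φ : Fml) : sat S b ρ (.allB φ) ↔ ∀ a, sat S (scons a b) ρ φ := Iff.rfl

@[simp] theorem sat_allQ (φ : Fml) : sat S b ρ (.allQ φ) ↔ ∀ a, sat S b (scons a ρ) φ := Iff.rfl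

@[simp] theorem sat_exB (φ : Fml) : sat S b ρ (.exB φ) ↔ ∃ a, sat S (scons a b) ρ φ := by
  simp [Fml.exB]

@[simp] theorem sat_exQ (φ : Fml) : sat S b ρ (.exQ φ) ↔ ∃ a, sat S b (scons a ρ) φ := by
  simp [Fml.exQ]

@[simp] theorem sat_iob (k : ℕ) : sat S b ρ (.iob k) ↔ S.iob (b k) := Iff.rfl

@[simp] theorem sat_ph (k : ℕ) : sat S b ρ (.ph k) ↔ S.ph (b k) := Iff.rfl

@[simp] theorem sat_le (s t : QTerm) : sat S b ρ (.le s t) ↔ s.eval ρ ≤ t.eval ρ := Iff.rfl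

@[simp] theorem sat_eqQ (s t : QTerm) : sat S b ρ (s ≐ t) ↔ s.eval ρ = t.eval ρ := Iff.rfl

@[simp] theorem eval_var (n : ℕ) : (QTerm.var n).eval ρ = ρ n := rfl

@[simp] theorem eval_add (s t : QTerm) : (s + t).eval ρ = s.eval ρ + t.eval ρ := rfl

@[simp] theorem eval_mul (s t : QTerm) : (s * t).eval ρ = s.eval ρ * t.eval ρ := rfl

@[simp] theorem eval_lift (n : ℕ) (t : QTerm) : (t.lift n).eval ρ = t.eval fun i => ρ (i + n) := by
  simp [QTerm.lift, QTerm.eval_subst]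

@[simp] theorem scons_one {α : Type} (a : α) (f : ℕ → α) : scons a f 1 = f 0 := rfl
@[simp] theorem scons_two {α : Type} (a : α) (f : ℕ → α) : scons a f 2 = f 1 := rfl
@[simp] theorem scons_three {α : Type} (a : α) (f : ℕ → α) : scons a f 3 = f 2 := rfl

end Connectives

/-! ## The field of quantities -/

/-- Every nonnegative element has a square root. -/
class Euclidean (K : Type) [Field K] [LinearOrder K] : Prop where
  exists_sqrt : ∀ x : K, 0 ≤ x → ∃ y, 0 ≤ y ∧ y * y = x

abbrev fieldAdd (K : Type) [Field K] : Add K := inferInstance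
abbrev fieldMul (K : Type) [Field K] : Mul K := inferInstance
abbrev linearLE (K : Type) [LinearOrder K] : LE K := inferInstance

/-- The closing equations identify the operations of the model with those of the field that is
built, so substituting them turns any model of the axioms into a structure over a Euclidean ordered
field. -/
theorem exists_field {B Q : Type} [iA : Add Q] [iM : Mul Q] [iL : LE Q] {S : Str B Q}
    {b : ℕ → B} {ρ : ℕ → Q} (h : sat S b ρ axEField) :
    ∃ (_ : Field Q) (_ : LinearOrder Q), IsStrictOrderedRing Q ∧ Euclidean Q ∧
      iA = fieldAdd Q ∧ iM = fieldMul Q ∧ iL = linearLE Q := by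
  simp only [axEField, Fml.allQs, Fml.exQs, isNonneg, isZero, sat_conj, sat_allQ, sat_exQ, sat_disj,
    sat_imp, sat_neg, sat_eqQ, sat_le, eval_var, eval_add, eval_mul, eval_lift, scons_zero,
    scons_succ] at h
  obtain ⟨hac, haa, hmc, hma, hd, ⟨z, o, hzo, hz, ho, hneg, hinv⟩, htot, hanti, htrans, hadd,
    hmul, hsqrt⟩ := h
  choose neg hneg using hneg
  -- The inverse is made total before choosing; below, its value at zero is set to zero as a field
  -- structure demands.
  have hinv' : ∀ x, ∃ y, ¬ x = z → x * y = o := fun x => by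
    by_cases hx : x = z
    · exact ⟨z, fun h => (h hx).elim⟩
    · exact (hinv x hx).imp fun _ h _ => h
  choose inv hinv using hinv'
  have hzz : ∀ x, (∀ a, x + a = a) ↔ x = z := fun x =>
    ⟨fun h => (hz x).symm.trans (h z), fun h a => by rw [h, hac, hz]⟩
  classical
  let iZ : Zero Q := ⟨z⟩
  let iO : One Q := ⟨o⟩
  let iN : Neg Q := ⟨neg⟩
  let F : Field Q :=
    { add := iA.add
      mul := iM.mul
      zero := z
      one := o
      neg := neg
      inv := fun x => if x = z then z else inv x
      add_assoc := fun x y w => haa w y x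
      zero_add := fun x => (hac x z).trans (hz x)
      add_zero := hz
      nsmul := nsmulRec
      zsmul := zsmulRec
      neg_add_cancel := fun x => (hac x (neg x)).trans (hneg x)
      add_comm := fun x y => hac y x
      mul_assoc := fun x y w => hma w y x
      one_mul := fun x => (hmc x o).trans (ho x)
      mul_one := ho
      mul_comm := fun x y => hmc y x
      left_distrib := fun x y w => hd w y x
      right_distrib := fun x y w =>
        (hmc w (x + y)).trans ((hd y x w).trans (by rw [hmc x w, hmc y w]))
      zero_mul := fun x => by
        have h1 : x * (z + z) = x * z + x * z := hd z z x
        have h2 : x * z + neg (x * z) = z := hneg _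
        have h3 : (x * z + x * z) + neg (x * z) = x * z + (x * z + neg (x * z)) := haa _ _ _
        rw [← h1, hz z, h2, hz] at h3
        exact (hmc x z).trans h3.symm
      mul_zero := fun x => by
        have h1 : x * (z + z) = x * z + x * z := hd z z x
        have h2 : x * z + neg (x * z) = z := hneg _
        have h3 : (x * z + x * z) + neg (x * z) = x * z + (x * z + neg (x * z)) := haa _ _ _
        rw [← h1, hz z, h2, hz] at h3
        exact h3.symm
      exists_pair_ne := ⟨z, o, hzo⟩
      mul_inv_cancel := fun x hx => by
        change x * (if x = z then z else inv x) = o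
        rw [if_neg (show ¬ x = z from hx)]
        exact hinv x hx
      inv_zero := if_pos rfl
      nnqsmul := _
      nnqsmul_def := fun _ _ => rfl
      qsmul := _
      qsmul_def := fun _ _ => rfl }
  let L : LinearOrder Q :=
    { le := iL.le
      le_refl := fun x => (htot x x).elim id id
      le_trans := fun x y w h1 h2 => htrans w y x ⟨h1, h2⟩
      le_antisymm := fun x y h1 h2 => hanti y x ⟨h1, h2⟩
      le_total := fun x y => htot y x
      toDecidableLE := Classical.decRel _ }
  have hord : IsStrictOrderedRing Q := by
    have : IsOrderedAddMonoid Q := { add_le_add_left := fun a b hab c => hadd c b a hab }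
    -- The axioms do not mention `0 ≤ 1`. If `1 ≤ 0`, then `0 ≤ -1`, and the square of `-1` is
    -- nonnegative.
    have : ZeroLEOneClass Q := ⟨by
      rcases htot (1 : Q) (0 : Q) with h | h
      · exact h
      · have h' : (0 : Q) ≤ -1 := neg_nonneg.2 h
        obtain ⟨w, hw, hw'⟩ := hmul (-1 : Q) (-1 : Q) ⟨⟨0, (hzz _).2 rfl, h'⟩, ⟨0, (hzz _).2 rfl, h'⟩⟩
        rw [hzz] at hw
        subst hw
        have e : (-1 : Q) * (-1) = 1 := by ring
        exact hw'.trans_eq e⟩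
    refine IsStrictOrderedRing.of_mul_pos fun a b ha hb => ?_
    obtain ⟨w, hw, hw'⟩ := hmul b a ⟨⟨0, (hzz _).2 rfl, ha.le⟩, ⟨0, (hzz _).2 rfl, hb.le⟩⟩
    rw [hzz] at hw
    subst hw
    exact lt_of_le_of_ne hw' (mul_ne_zero ha.ne' hb.ne').symm
  refine ⟨F, L, hord, ⟨fun x hx => ?_⟩, rfl, rfl, rfl⟩
  rcases eq_or_ne x 0 with rfl | h0
  · exact ⟨0, le_rfl, mul_zero 0⟩
  obtain ⟨y, hy⟩ := hsqrt x ⟨⟨0, (hzz _).2 rfl, hx⟩, fun h => h0 ((hzz x).1 h)⟩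
  -- The axiom leaves the sign of the root open.
  exact ⟨|y|, abs_nonneg y, (abs_mul_abs_self y).trans hy⟩

/-! ### Values and definedness of expressions. -/

section Field

variable {B K : Type} [Field K] [LinearOrder K] [IsStrictOrderedRing K]

theorem forall_mul_eq_iff (x : K) : (∀ a, x * a = a) ↔ x = 1 := by
  constructor
  · intro h; simpa using h 1
  · rintro rfl a; simp

@[simp] theorem sat_isZero (S : Str B K) (b : ℕ → B) (ρ : ℕ → K) (t : QTerm) :
    sat S b ρ (isZero t) ↔ t.eval ρ = 0 := by
  simp [isZero]

@[simp] theorem sat_isOne (S : Str B K) (b : ℕ → B) (ρ : ℕ → K) (t : QTerm) :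
    sat S b ρ (isOne t) ↔ t.eval ρ = 1 := by
  rw [← forall_mul_eq_iff]
  simp only [isOne, sat_allQ, sat_eqQ, eval_mul, eval_lift, eval_var, scons_zero, scons_succ]

@[simp] theorem sat_isNonneg (S : Str B K) (b : ℕ → B) (ρ : ℕ → K) (t : QTerm) :
    sat S b ρ (isNonneg t) ↔ 0 ≤ t.eval ρ := by
  simp [isNonneg]

theorem sat_axEField [Euclidean K] (S : Str B K) (b : ℕ → B) (ρ : ℕ → K) :
    sat S b ρ axEField := by
  simp only [axEField, Fml.allQs, Fml.exQs, sat_conj, sat_allQ, sat_exQ, sat_disj,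
    sat_imp, sat_neg, sat_eqQ, sat_le, eval_var, eval_add, eval_mul, scons_zero,
    scons_one, scons_two, scons_three, sat_isNonneg, sat_isZero]
  refine ⟨fun x y => add_comm _ _, fun x y z => add_assoc _ _ _, fun x y => mul_comm _ _,
    fun x y z => mul_assoc _ _ _, fun x y z => mul_add _ _ _,
    ⟨0, 1, zero_ne_one, add_zero, mul_one, fun a => ⟨-a, add_neg_cancel a⟩,
      fun a ha => ⟨a⁻¹, mul_inv_cancel₀ ha⟩⟩, fun x y => le_total _ _,
    fun x y h => le_antisymm h.1 h.2, fun x y z h => le_trans h.1 h.2,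
    fun x y z h => by gcongr, fun x y h => mul_nonneg h.1 h.2, fun x h => ?_⟩
  obtain ⟨y, _, hy⟩ := Euclidean.exists_sqrt x h.1
  exact ⟨y, hy⟩

variable [Euclidean K]

/-- The square root. -/
noncomputable def rt (x : K) : K :=
  if h : 0 ≤ x then (Euclidean.exists_sqrt x h).choose else 0

theorem rt_nonneg (x : K) : 0 ≤ rt x := by
  unfold rt
  split_ifs with h
  · exact (Euclidean.exists_sqrt x h).choose_spec.1
  · exact le_rfl

theorem rt_mul_self {x : K} (h : 0 ≤ x) : rt x * rt x = x := by
  unfold rt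
  rw [dif_pos h]
  exact (Euclidean.exists_sqrt x h).choose_spec.2

theorem eq_rt_iff {x y : K} (hx : 0 ≤ x) : y = rt x ↔ 0 ≤ y ∧ y * y = x := by
  constructor
  · rintro rfl
    exact ⟨rt_nonneg x, rt_mul_self hx⟩
  · rintro ⟨h1, h2⟩
    exact (mul_self_inj h1 (rt_nonneg x)).1 (h2.trans (rt_mul_self hx).symm)

namespace ETerm

/-- The value of an expression (with junk values where it is undefined). -/
noncomputable def ev (ρ : ℕ → K) : ETerm → K
  | tm t => t.eval ρ
  | zero => 0
  | one => 1
  | add a b => a.ev ρ + b.ev ρ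
  | sub a b => a.ev ρ - b.ev ρ
  | mul a b => a.ev ρ * b.ev ρ
  | div a b => a.ev ρ / b.ev ρ
  | abs a => |a.ev ρ|
  | sqrt a => rt (a.ev ρ)

/-- The expression is defined. -/
def Def (ρ : ℕ → K) : ETerm → Prop
  | tm _ => True
  | zero => True
  | one => True
  | add a b => a.Def ρ ∧ b.Def ρ
  | sub a b => a.Def ρ ∧ b.Def ρ
  | mul a b => a.Def ρ ∧ b.Def ρ
  | div a b => a.Def ρ ∧ b.Def ρ ∧ b.ev ρ ≠ 0
  | abs a => a.Def ρ
  | sqrt a => a.Def ρ ∧ 0 ≤ a.ev ρ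

variable (ρ : ℕ → K) (a b : ETerm)

@[simp] theorem ev_tm (t : QTerm) : (tm t).ev ρ = t.eval ρ := rfl
@[simp] theorem ev_v (n : ℕ) : (v n).ev ρ = ρ n := rfl
@[simp] theorem ev_zero : (0 : ETerm).ev ρ = 0 := rfl
@[simp] theorem ev_one : (1 : ETerm).ev ρ = 1 := rfl
@[simp] theorem ev_add : (a + b).ev ρ = a.ev ρ + b.ev ρ := rfl
@[simp] theorem ev_sub : (a - b).ev ρ = a.ev ρ - b.ev ρ := rfl
@[simp] theorem ev_mul : (a * b).ev ρ = a.ev ρ * b.ev ρ := rfl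
@[simp] theorem ev_div : (a / b).ev ρ = a.ev ρ / b.ev ρ := rfl
@[simp] theorem ev_abs : (abs a).ev ρ = |a.ev ρ| := rfl
@[simp] theorem ev_sqrt : (sqrt a).ev ρ = rt (a.ev ρ) := rfl
@[simp] theorem def_tm (t : QTerm) : (tm t).Def ρ := trivial
@[simp] theorem def_v (n : ℕ) : (v n).Def ρ := trivial
@[simp] theorem def_zero : (0 : ETerm).Def ρ := trivial
@[simp] theorem def_one : (1 : ETerm).Def ρ := trivial
@[simp] theorem def_add : (a + b).Def ρ ↔ a.Def ρ ∧ b.Def ρ := Iff.rfl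
@[simp] theorem def_sub : (a - b).Def ρ ↔ a.Def ρ ∧ b.Def ρ := Iff.rfl
@[simp] theorem def_mul : (a * b).Def ρ ↔ a.Def ρ ∧ b.Def ρ := Iff.rfl
@[simp] theorem def_div : (a / b).Def ρ ↔ a.Def ρ ∧ b.Def ρ ∧ b.ev ρ ≠ 0 := Iff.rfl
@[simp] theorem def_abs : (abs a).Def ρ ↔ a.Def ρ := Iff.rfl
@[simp] theorem def_sqrt : (sqrt a).Def ρ ↔ a.Def ρ ∧ 0 ≤ a.ev ρ := Iff.rfl

@[simp] theorem ev_lift (n : ℕ) : (a.lift n).ev ρ = a.ev fun i => ρ (i + n) := by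
  induction a <;> simp_all [lift, ev]

@[simp] theorem def_lift (n : ℕ) : (a.lift n).Def ρ ↔ a.Def fun i => ρ (i + n) := by
  induction a <;> simp_all [lift, Def]

end ETerm

variable (S : Str B K) (b : ℕ → B) (ρ : ℕ → K)

-- Eliminating partial functions through their graphs has the intended meaning: definedness,
-- together with the right value. From here on, formulas with expressions are computed with `Def`
-- and `ev`.
@[simp] theorem sat_isVal (e : ETerm) (n : ℕ) (t : QTerm) : sat S b ρ (isVal e n t) ↔
    e.Def (fun i => ρ (i + n)) ∧ t.eval ρ = e.ev fun i => ρ (i + n) := by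
  -- The two auxiliary values take up indices `0` and `1`, which the increase of `n` by `2` skips.
  have shift : ∀ (n : ℕ) (p q : K) (ρ : ℕ → K),
    (fun i => scons q (scons p ρ) (i + (n + 2))) = fun i => ρ (i + n) := fun _ _ _ _ => rfl
  have shift1 : ∀ (n : ℕ) (p : K) (ρ : ℕ → K),
    (fun i => scons p ρ (i + (n + 1))) = fun i => ρ (i + n) := fun _ _ _ => rfl
  induction e generalizing n t ρ with
  | tm s => simp [isVal, ETerm.Def, ETerm.ev]
  | zero => simp [isVal, ETerm.Def, ETerm.ev]
  | one => simp [isVal, ETerm.Def, ETerm.ev]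
  | add a c iha ihc =>
    simp only [isVal, Fml.exQs, sat_exQ, sat_conj, iha, ihc, shift, sat_eqQ, eval_lift,
      eval_add, eval_var, scons_zero, scons_one, ETerm.Def, ETerm.ev]
    constructor
    · rintro ⟨p, q, ⟨h1, rfl⟩, ⟨h2, rfl⟩, h3⟩
      exact ⟨⟨h1, h2⟩, h3⟩
    · rintro ⟨⟨h1, h2⟩, h3⟩
      exact ⟨_, _, ⟨h1, rfl⟩, ⟨h2, rfl⟩, h3⟩
  | sub a c iha ihc =>
    simp only [isVal, Fml.exQs, sat_exQ, sat_conj, iha, ihc, shift, sat_eqQ, eval_lift,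
      eval_add, eval_var, scons_zero, scons_one, ETerm.Def, ETerm.ev]
    constructor
    · rintro ⟨p, q, ⟨h1, rfl⟩, ⟨h2, rfl⟩, h3⟩
      exact ⟨⟨h1, h2⟩, eq_sub_of_add_eq h3⟩
    · rintro ⟨⟨h1, h2⟩, h3⟩
      exact ⟨_, _, ⟨h1, rfl⟩, ⟨h2, rfl⟩, (congrArg (· + ETerm.ev (fun i => ρ (i + n)) c) h3).trans (sub_add_cancel _ _)⟩
  | mul a c iha ihc =>
    simp only [isVal, Fml.exQs, sat_exQ, sat_conj, iha, ihc, shift, sat_eqQ, eval_lift,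
      eval_mul, eval_var, scons_zero, scons_one, ETerm.Def, ETerm.ev]
    constructor
    · rintro ⟨p, q, ⟨h1, rfl⟩, ⟨h2, rfl⟩, h3⟩
      exact ⟨⟨h1, h2⟩, h3⟩
    · rintro ⟨⟨h1, h2⟩, h3⟩
      exact ⟨_, _, ⟨h1, rfl⟩, ⟨h2, rfl⟩, h3⟩
  | div a c iha ihc =>
    simp only [isVal, Fml.exQs, sat_exQ, sat_conj, iha, ihc, shift, sat_eqQ, eval_lift,
      eval_mul, eval_var, scons_zero, scons_one, ETerm.Def, ETerm.ev, sat_neg, sat_isZero]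
    constructor
    · rintro ⟨p, q, ⟨h1, rfl⟩, ⟨h2, rfl⟩, h3, h4⟩
      exact ⟨⟨h1, h2, h3⟩, eq_div_of_mul_eq h3 h4⟩
    · rintro ⟨⟨h1, h2, h3⟩, h4⟩
      exact ⟨_, _, ⟨h1, rfl⟩, ⟨h2, rfl⟩, h3, 
        (congrArg (· * ETerm.ev (fun i => ρ (i + n)) c) h4).trans (div_mul_cancel₀ _ h3)⟩
  | abs a iha =>
    simp only [isVal, sat_exQ, sat_conj, iha, shift1, sat_eqQ, eval_lift, sat_disj, sat_isZero,
      eval_add, eval_var, scons_zero, scons_succ, ETerm.Def, ETerm.ev, sat_isNonneg]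
    constructor
    · rintro ⟨p, ⟨h1, rfl⟩, h2, h3⟩
      refine ⟨h1, ?_⟩
      rcases h3 with h3 | h3
      · rw [← h3, abs_of_nonneg h2]
      · rw [← eq_neg_iff_add_eq_zero] at h3
        rw [← abs_neg, ← h3, abs_of_nonneg h2]
    · rintro ⟨h1, h2⟩
      refine ⟨_, ⟨h1, rfl⟩, h2 ▸ abs_nonneg _, ?_⟩
      rw [h2, ← eq_neg_iff_add_eq_zero]
      exact abs_choice _
  | sqrt a iha =>
    simp only [isVal, sat_exQ, sat_conj, iha, shift1, sat_eqQ, eval_lift,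
      eval_mul, eval_var, scons_zero, scons_succ, ETerm.Def, ETerm.ev, sat_isNonneg]
    constructor
    · rintro ⟨p, ⟨h1, rfl⟩, h2, h3⟩
      have h4 := h3 ▸ mul_self_nonneg (QTerm.eval ρ t)
      exact ⟨⟨h1, h4⟩, (eq_rt_iff h4).2 ⟨h2, h3⟩⟩
    · rintro ⟨⟨h1, h2⟩, h3⟩
      exact ⟨_, ⟨h1, rfl⟩, (eq_rt_iff h2).1 h3⟩

@[simp] theorem sat_eqE (x y : ETerm) : sat S b ρ (eqE x y) ↔
    x.Def ρ ∧ y.Def ρ ∧ x.ev ρ = y.ev ρ := by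
  simp only [eqE, sat_exQ, sat_conj, sat_isVal, scons_succ, eval_var, scons_zero]
  constructor
  · rintro ⟨_, ⟨h1, rfl⟩, h2, h3⟩
    exact ⟨h1, h2, h3⟩
  · rintro ⟨h1, h2, h3⟩
    exact ⟨_, ⟨h1, rfl⟩, h2, h3⟩

@[simp] theorem sat_ltE (x y : ETerm) : sat S b ρ (ltE x y) ↔
    x.Def ρ ∧ y.Def ρ ∧ x.ev ρ < y.ev ρ := by
  have shift' : ∀ (p q : K) (ρ : ℕ → K),
    (fun i => scons q (scons p ρ) (i + 2)) = ρ := fun _ _ _ => rfl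
  simp only [ltE, Fml.exQs, sat_exQ, sat_conj, sat_isVal, shift', eval_var, scons_zero, scons_one,
    sat_le, sat_neg, sat_eqQ, lt_iff_le_and_ne]
  constructor
  · rintro ⟨_, _, ⟨h1, rfl⟩, ⟨h2, rfl⟩, h3, h4⟩
    exact ⟨h1, h2, h3, h4⟩
  · rintro ⟨h1, h2, h3, h4⟩
    exact ⟨_, _, ⟨h1, rfl⟩, ⟨h2, rfl⟩, h3, h4⟩

end Field


/-! ## Coordinate points -/

section Points

variable {K : Type} [Field K] [LinearOrder K] [IsStrictOrderedRing K]

/-- Spacetime points in coordinates. -/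
abbrev Pt (K : Type) := Fin 4 → K

/-- The spatial part of a coordinate point. -/
def sp (x : Pt K) : Fin 3 → K := fun i => x i.succ

/-- The coordinate point with given time and place. -/
def pmk (t : K) (p : Fin 3 → K) : Pt K := Matrix.vecCons t p

@[simp] theorem pmk_zero (t : K) (p : Fin 3 → K) : pmk t p 0 = t := rfl
@[simp] theorem sp_pmk (t : K) (p : Fin 3 → K) : sp (pmk t p) = p := rfl
@[simp] theorem pmk_sp (x : Pt K) : pmk (x 0) (sp x) = x := by
  funext i; refine Fin.cases ?_ (fun j => ?_) i <;> rfl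

theorem pt_ext {x y : Pt K} (h0 : x 0 = y 0) (h : sp x = sp y) : x = y := by
  rw [← pmk_sp x, ← pmk_sp y, h0, h]

/-- The squared Euclidean length. -/
def nsq (u : Fin 3 → K) : K := u ⬝ᵥ u

theorem nsq_eq (u : Fin 3 → K) : nsq u = u 0 * u 0 + u 1 * u 1 + u 2 * u 2 := by
  simp [nsq, dotProduct, Fin.sum_univ_three]

theorem nsq_nonneg (u : Fin 3 → K) : 0 ≤ nsq u := by
  rw [nsq_eq]
  exact add_nonneg (add_nonneg (mul_self_nonneg _) (mul_self_nonneg _)) (mul_self_nonneg _)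

theorem nsq_eq_zero {u : Fin 3 → K} : nsq u = 0 ↔ u = 0 := dotProduct_self_eq_zero

@[simp] theorem nsq_zero : nsq (0 : Fin 3 → K) = 0 := nsq_eq_zero.2 rfl

theorem nsq_smul (a : K) (u : Fin 3 → K) : nsq (a • u) = a * a * nsq u := by
  simp only [nsq, smul_dotProduct, dotProduct_smul, smul_eq_mul]
  ring

theorem nsq_neg (u : Fin 3 → K) : nsq (-u) = nsq u := by simp [nsq]

theorem nsq_sub_comm (u v : Fin 3 → K) : nsq (u - v) = nsq (v - u) := by
  rw [← nsq_neg, neg_sub]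

theorem nsq_add (u v : Fin 3 → K) : nsq (u + v) = nsq u + 2 * (u ⬝ᵥ v) + nsq v := by
  simp only [nsq, add_dotProduct, dotProduct_add, dotProduct_comm v u]
  ring

theorem nsq_sub (u v : Fin 3 → K) : nsq (u - v) = nsq u - 2 * (u ⬝ᵥ v) + nsq v := by
  simp only [nsq, sub_dotProduct, dotProduct_sub, dotProduct_comm v u]
  ring

variable [Euclidean K]

/-- The Euclidean length. -/
noncomputable def len (u : Fin 3 → K) : K := rt (nsq u)

theorem len_nonneg (u : Fin 3 → K) : 0 ≤ len u := rt_nonneg _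

theorem len_mul_self (u : Fin 3 → K) : len u * len u = nsq u := rt_mul_self (nsq_nonneg u)

theorem len_inj {u v : Fin 3 → K} : len u = len v ↔ nsq u = nsq v := by
  constructor
  · intro h; rw [← len_mul_self, ← len_mul_self, h]
  · intro h; simp [len, h]

theorem len_eq_iff {u : Fin 3 → K} {a : K} (ha : 0 ≤ a) : len u = a ↔ nsq u = a * a := by
  rw [len, eq_comm, eq_rt_iff (nsq_nonneg u), eq_comm (a := nsq u)]
  exact and_iff_right ha

theorem len_smul (a : K) (u : Fin 3 → K) : len (a • u) = |a| * len u := by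
  rw [len_eq_iff (mul_nonneg (abs_nonneg a) (len_nonneg u)), nsq_smul, mul_mul_mul_comm,
    abs_mul_abs_self, len_mul_self]

@[simp] theorem len_zero : len (0 : Fin 3 → K) = 0 := (len_eq_iff le_rfl).2 (by simp)

theorem len_eq_zero {u : Fin 3 → K} : len u = 0 ↔ u = 0 := by
  rw [len_eq_iff le_rfl, mul_zero, nsq_eq_zero]

end Points

/-! ## Defined notions in a structure -/

namespace Str

variable {B K : Type} (S : Str B K)

/-- `k` at `x` and `h` at `y` coordinatize the same event. -/
def Same (k h : B) (x y : Pt K) : Prop := ∀ a, S.w k a x ↔ S.w h a y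

/-- The worldline of `b` according to `k` has two points. -/
def Moves (k b : B) : Prop := ∃ x y, S.w k b x ∧ S.w k b y ∧ x ≠ y

variable [Field K] [LinearOrder K] [IsStrictOrderedRing K]

/-- The velocity of `b` according to `k` is `V`. -/
def VelIs (k b : B) (V : Fin 3 → K) : Prop :=
  S.Moves k b ∧ ∀ x y, S.w k b x → S.w k b y → sp y - sp x = (y 0 - x 0) • V

variable [Euclidean K]

/-- The speed of `b` according to `k` is `v`. -/
def SpeedIs (k b : B) (v : K) : Prop :=
  S.Moves k b ∧ ∀ x y, S.w k b x → S.w k b y → len (sp x - sp y) = v * |x 0 - y 0|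

/-- `e` is an ether observer. -/
def Ether (e : B) : Prop :=
  S.iob e ∧ ∃ c, 0 < c ∧ ∀ x y, (∃ p, S.ph p ∧ S.w e p x ∧ S.w e p y) ↔
    len (sp x - sp y) = c * |x 0 - y 0|

/-- `c` is the speed of light according to the ether observers. -/
def IsCe (c : K) : Prop :=
  ∀ e, S.Ether e → ∀ p, S.ph p → ∀ v, S.SpeedIs e p v → v = c

end Str

/-! ## Satisfaction of the defined notions -/

/-- Prepend the coordinates of a point to an assignment. -/
def push {K : Type} (x : Pt K) (ρ : ℕ → K) : ℕ → K :=
  scons (x 0) (scons (x 1) (scons (x 2) (scons (x 3) ρ)))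

/-- The point whose coordinates are the values of the variables `n, …, n + 3`. -/
def ptAt {K : Type} (ρ : ℕ → K) (n : ℕ) : Pt K := fun i => ρ (n + i)

section PtAt

variable {K : Type} (x : Pt K) (a : K) (ρ : ℕ → K)

@[simp] theorem ptAt_push_zero : ptAt (push x ρ) 0 = x := by
  funext i; fin_cases i <;> rfl

theorem ptAt_push_add (n : ℕ) : ptAt (push x ρ) (n + 4) = ptAt ρ n := by
  funext i
  change push x ρ (n + 4 + i) = ρ (n + i)
  rw [add_right_comm]
  rfl

@[simp] theorem ptAt_push_4 : ptAt (push x ρ) 4 = ptAt ρ 0 := ptAt_push_add x ρ 0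
@[simp] theorem ptAt_push_8 : ptAt (push x ρ) 8 = ptAt ρ 4 := ptAt_push_add x ρ 4
@[simp] theorem ptAt_push_12 : ptAt (push x ρ) 12 = ptAt ρ 8 := ptAt_push_add x ρ 8

theorem ptAt_scons (n : ℕ) : ptAt (scons a ρ) (n + 1) = ptAt ρ n := by
  funext i
  change scons a ρ (n + 1 + i) = ρ (n + i)
  rw [add_right_comm]
  rfl

@[simp] theorem ptAt_scons_1 : ptAt (scons a ρ) 1 = ptAt ρ 0 := ptAt_scons a ρ 0
@[simp] theorem ptAt_scons_5 : ptAt (scons a ρ) 5 = ptAt ρ 4 := ptAt_scons a ρ 4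
@[simp] theorem ptAt_scons_9 : ptAt (scons a ρ) 9 = ptAt ρ 8 := ptAt_scons a ρ 8

@[simp] theorem push_add (n : ℕ) : push x ρ (n + 4) = ρ n := rfl
@[simp] theorem push_0 : push x ρ 0 = x 0 := rfl
@[simp] theorem push_1 : push x ρ 1 = x 1 := rfl
@[simp] theorem push_2 : push x ρ 2 = x 2 := rfl
@[simp] theorem push_3 : push x ρ 3 = x 3 := rfl

end PtAt

/-! ### Blocks of quantity quantifiers read as quantifiers over coordinate points. -/

section Blocks

variable {B Q : Type} [Add Q] [Mul Q] [LE Q] (S : Str B Q) (b : ℕ → B) (ρ : ℕ → Q)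

theorem sat_allQs_add_four (n : ℕ) (φ : Fml) : sat S b ρ (.allQs (n + 4) φ) ↔
    ∀ x : Pt Q, sat S b (push x ρ) (.allQs n φ) := by
  constructor
  · intro h x
    -- The outermost quantifier of a block binds its largest index.
    exact h (x 3) (x 2) (x 1) (x 0)
  · intro h a₃ a₂ a₁ a₀
    exact h ![a₀, a₁, a₂, a₃]

theorem sat_exQs_add_four (n : ℕ) (φ : Fml) : sat S b ρ (.exQs (n + 4) φ) ↔
    ∃ x : Pt Q, sat S b (push x ρ) (.exQs n φ) := by
  simp only [Fml.exQs, sat_exQ]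
  constructor
  · rintro ⟨a₃, a₂, a₁, a₀, h⟩
    exact ⟨![a₀, a₁, a₂, a₃], h⟩
  · rintro ⟨x, h⟩
    exact ⟨x 3, x 2, x 1, x 0, h⟩

@[simp] theorem sat_allQs_4 (φ : Fml) : sat S b ρ (.allQs 4 φ) ↔ ∀ x, sat S b (push x ρ) φ :=
  sat_allQs_add_four S b ρ 0 φ

@[simp] theorem sat_allQs_8 (φ : Fml) :
    sat S b ρ (.allQs 8 φ) ↔ ∀ x y, sat S b (push y (push x ρ)) φ :=
  (sat_allQs_add_four S b ρ 4 φ).trans (forall_congr' fun _ => sat_allQs_4 S b _ φ)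

@[simp] theorem sat_allQs_12 (φ : Fml) :
    sat S b ρ (.allQs 12 φ) ↔ ∀ x y z, sat S b (push z (push y (push x ρ))) φ :=
  (sat_allQs_add_four S b ρ 8 φ).trans (forall_congr' fun _ => sat_allQs_8 S b _ φ)

@[simp] theorem sat_allQs_16 (φ : Fml) : sat S b ρ (.allQs 16 φ) ↔
    ∀ x y z w, sat S b (push w (push z (push y (push x ρ)))) φ :=
  (sat_allQs_add_four S b ρ 12 φ).trans (forall_congr' fun _ => sat_allQs_12 S b _ φ)

@[simp] theorem sat_exQs_4 (φ : Fml) : sat S b ρ (.exQs 4 φ) ↔ ∃ x, sat S b (push x ρ) φ :=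
  sat_exQs_add_four S b ρ 0 φ

@[simp] theorem sat_exQs_8 (φ : Fml) :
    sat S b ρ (.exQs 8 φ) ↔ ∃ x y, sat S b (push y (push x ρ)) φ :=
  (sat_exQs_add_four S b ρ 4 φ).trans (exists_congr fun _ => sat_exQs_4 S b _ φ)

@[simp] theorem sat_exQs_9 (φ : Fml) :
    sat S b ρ (.exQs 9 φ) ↔ ∃ t x y, sat S b (push y (push x (scons t ρ))) φ := by
  simp only [← sat_exQs_8]
  exact sat_exQ S b ρ _

@[simp] theorem sat_exQs_2 (φ : Fml) :
    sat S b ρ (.exQs 2 φ) ↔ ∃ s t, sat S b (scons t (scons s ρ)) φ := by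
  simp [Fml.exQs]

@[simp] theorem sat_w (k h : ℕ) (x : Fin 4 → QTerm) :
    sat S b ρ (.w k h x) ↔ S.w (b k) (b h) fun i => (x i).eval ρ := Iff.rfl

@[simp] theorem eval_pt (n : ℕ) : (fun i => (pt n i).eval ρ) = ptAt ρ n := rfl

@[simp] theorem sat_wRel (k h : ℕ) (x y : Fin 4 → QTerm) : sat S b ρ (wRel k h x y) ↔
    S.Same (b k) (b h) (fun i => (x i).eval ρ) fun i => (y i).eval ρ := by
  simp [wRel, Str.Same]

@[simp] theorem sat_all3 (f : Fin 3 → Fml) : sat S b ρ (all3 f) ↔ ∀ i, sat S b ρ (f i) := by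
  simp [all3, Fin.forall_fin_succ]

@[simp] theorem sat_all4 (f : Fin 4 → Fml) : sat S b ρ (all4 f) ↔ ∀ i, sat S b ρ (f i) := by
  simp [all4, Fin.forall_fin_succ]

end Blocks

section Field

variable {B K : Type} [Field K] [LinearOrder K] [IsStrictOrderedRing K] [Euclidean K]

/-- The value of a tuple of expressions. -/
noncomputable def evs {n : ℕ} (ρ : ℕ → K) (x : Fin n → ETerm) : Fin n → K := fun i => (x i).ev ρ

/-- All components of the tuple are defined. -/
def Defs {n : ℕ} (ρ : ℕ → K) (x : Fin n → ETerm) : Prop := ∀ i, (x i).Def ρ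

variable (S : Str B K) (b : ℕ → B) (ρ : ℕ → K)

@[simp] theorem evs_P (n : ℕ) : evs ρ (P n) = ptAt ρ n := rfl

@[simp] theorem defs_P (n : ℕ) : Defs ρ (P n) := fun _ => trivial

@[simp] theorem sat_eqPt (x y : Fin 4 → ETerm) : sat S b ρ (eqPt x y) ↔
    Defs ρ x ∧ Defs ρ y ∧ evs ρ x = evs ρ y := by
  simp only [eqPt, sat_all4, sat_eqE, Defs, evs, funext_iff]
  exact ⟨fun h => ⟨fun i => (h i).1, fun i => (h i).2.1, fun i => (h i).2.2⟩,
    fun h i => ⟨h.1 i, h.2.1 i, h.2.2 i⟩⟩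

@[simp] theorem ev_norm (v : Fin 3 → ETerm) : (norm v).ev ρ = len (evs ρ v) := by
  simp [norm, len, nsq_eq, evs]

@[simp] theorem def_norm (v : Fin 3 → ETerm) : (norm v).Def ρ ↔ Defs ρ v := by
  have h := nsq_nonneg (evs ρ v)
  rw [nsq_eq] at h
  simp only [evs] at h
  simp [norm, Defs, Fin.forall_fin_succ, h, and_assoc]

theorem space_eq_norm (x y : Fin 4 → ETerm) :
    space x y = norm fun i => x i.succ - y i.succ := rfl

@[simp] theorem ev_space (x y : Fin 4 → ETerm) :
    (space x y).ev ρ = len (sp (evs ρ x) - sp (evs ρ y)) := by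
  rw [space_eq_norm, ev_norm]; rfl

@[simp] theorem def_space {x y : Fin 4 → ETerm} (hx : Defs ρ x) (hy : Defs ρ y) :
    (space x y).Def ρ := by
  rw [space_eq_norm, def_norm]
  exact fun i => ⟨hx _, hy _⟩

@[simp] theorem ev_time (x y : Fin 4 → ETerm) :
    (time x y).ev ρ = |evs ρ x 0 - evs ρ y 0| := rfl

@[simp] theorem def_time {x y : Fin 4 → ETerm} (hx : Defs ρ x) (hy : Defs ρ y) :
    (time x y).Def ρ := ⟨hx 0, hy 0⟩

@[simp] theorem sat_moves (k h : ℕ) : sat S b ρ (moves k h) ↔ S.Moves (b k) (b h) := by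
  simp [moves, Str.Moves]

@[simp] theorem sat_speedIs (k h : ℕ) (v : QTerm) :
    sat S b ρ (speedIs k h v) ↔ S.SpeedIs (b k) (b h) (v.eval ρ) := by
  simp [speedIs, Str.SpeedIs]

@[simp] theorem sat_velIs (k h : ℕ) (v : Fin 3 → QTerm) :
    sat S b ρ (velIs k h v) ↔ S.VelIs (b k) (b h) fun i => (v i).eval ρ := by
  have e : ∀ x y : Pt K, (fun i => push y (push x ρ) (i + 8)) = ρ := fun _ _ => rfl
  have e1 : ∀ x y : Pt K, ∀ i, (P 4 i).ev (push y (push x ρ)) = x i := fun x y i => by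
    have := congrFun (evs_P (push y (push x ρ)) 4) i
    simpa [evs] using this
  have e2 : ∀ x y : Pt K, ∀ i, (P 0 i).ev (push y (push x ρ)) = y i := fun x y i => by
    have := congrFun (evs_P (push y (push x ρ)) 0) i
    simpa [evs] using this
  have d : ∀ ρ' : ℕ → K, ∀ n i, (P n i).Def ρ' := fun _ _ _ => trivial
  simp only [velIs, Str.VelIs, sat_conj, sat_moves, sat_allQs_8, sat_imp, sat_w, eval_pt,
    ptAt_push_4, ptAt_push_zero, and_imp, sat_all3, sat_eqE, ETerm.def_sub, ETerm.def_mul, d,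
    ETerm.def_tm, true_and, ETerm.ev_sub, ETerm.ev_mul, ETerm.ev_tm, eval_lift, e, e1, e2]
  refine and_congr_right fun _ => forall₄_congr fun x y _ _ => ?_
  rw [funext_iff]
  refine forall_congr' fun i => ?_
  simp [sp, mul_comm]

@[simp] theorem sat_ether (e : ℕ) : sat S b ρ (ether e) ↔ S.Ether (b e) := by
  simp [ether, Str.Ether]

@[simp] theorem sat_isCe (c : QTerm) : sat S b ρ (isCe c) ↔ S.IsCe (c.eval ρ) := by
  simp [isCe, Str.IsCe]

end Field


/-! ### The meaning of the axioms and of the translations in a structure. -/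

section Axioms

variable {B K : Type} [Field K] [LinearOrder K] [IsStrictOrderedRing K] [Euclidean K]
variable (S : Str B K) (b : ℕ → B) (ρ : ℕ → K)

theorem sat_axEv : sat S b ρ axEv ↔
    ∀ k, S.iob k → ∀ h, S.iob h → ∀ x, ∃ y, S.Same k h x y := by
  simp [axEv]

theorem sat_axSelf : sat S b ρ axSelf ↔ ∀ k, S.iob k → ∀ x, S.w k k x ↔ sp x = 0 := by
  have e : ∀ x : Pt K, ∀ i, (P 0 i).ev (push x ρ) = x i := fun x i => by
    have := congrFun (evs_P (push x ρ) 0) i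
    simpa [evs] using this
  have d : ∀ ρ' : ℕ → K, ∀ n i, (P n i).Def ρ' := fun _ _ _ => trivial
  simp [axSelf, e, d, funext_iff, sp]

theorem sat_axSymD : sat S b ρ axSymD ↔ ∀ k, S.iob k → ∀ h, S.iob h → ∀ x y x' y',
    x 0 = y 0 → x' 0 = y' 0 → S.Same k h x x' → S.Same k h y y' →
      len (sp x - sp y) = len (sp x' - sp y') := by
  simp [axSymD, sub_eq_zero]

theorem sat_axLine : sat S b ρ axLine ↔ ∀ k, S.iob k → ∀ h, S.iob h → ∀ x y z,
    S.w k h x → S.w k h y → S.w k h z →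
      ∃ a : K, z - x = a • (y - x) ∨ y - z = a • (z - x) := by
  have e1 : ∀ (x y z : Pt K) (a : K) (i),
      (P 1 i).ev (scons a (push z (push y (push x ρ)))) = z i := fun x y z a i => by
    simpa [evs] using congrFun (evs_P (scons a (push z (push y (push x ρ)))) 1) i
  have e5 : ∀ (x y z : Pt K) (a : K) (i),
      (P 5 i).ev (scons a (push z (push y (push x ρ)))) = y i := fun x y z a i => by
    simpa [evs] using congrFun (evs_P (scons a (push z (push y (push x ρ)))) 5) i
  have e9 : ∀ (x y z : Pt K) (a : K) (i),
      (P 9 i).ev (scons a (push z (push y (push x ρ)))) = x i := fun x y z a i => by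
    simpa [evs] using congrFun (evs_P (scons a (push z (push y (push x ρ)))) 9) i
  have d : ∀ ρ' : ℕ → K, ∀ n i, (P n i).Def ρ' := fun _ _ _ => trivial
  simp [axLine, e1, e5, e9, d, funext_iff]

theorem sat_axNoAcc : sat S b ρ axNoAcc ↔ ∀ k h x, S.w k h x → S.iob k := by
  simp [axNoAcc]

theorem sat_axKinds : sat S b ρ axKinds ↔ ∀ k, S.iob k → ¬ S.ph k := by
  simp [axKinds]

theorem sat_axAbsTime : sat S b ρ axAbsTime ↔ ∀ k, S.iob k → ∀ h, S.iob h → ∀ x y x' y',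
    S.Same k h x x' → S.Same k h y y' → |x 0 - y 0| = |x' 0 - y' 0| := by
  simp [axAbsTime]

theorem sat_axThExpPlus : sat S b ρ axThExpPlus ↔ (∃ k, S.iob k) ∧ ∀ k, S.iob k → ∀ x y : Pt K,
    x 0 ≠ y 0 → ∃ h, S.iob h ∧ S.w k h x ∧ S.w k h y := by
  have e4 : ∀ x y : Pt K, (pt 4 0).eval (push y (push x ρ)) = x 0 := fun _ _ => rfl
  have e0 : ∀ x y : Pt K, (pt 0 0).eval (push y (push x ρ)) = y 0 := fun _ _ => rfl
  simp [axThExpPlus, e4, e0]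

theorem sat_axEther : sat S b ρ axEther ↔ ∃ e, S.Ether e := by
  simp [axEther]

theorem sat_axNoFTL : sat S b ρ axNoFTL ↔ ∀ k, S.iob k → ∀ e, S.Ether e →
    ∃ v c, S.SpeedIs e k v ∧ S.IsCe c ∧ v < c := by
  simp [axNoFTL]

theorem sat_axThExpSTL : sat S b ρ axThExpSTL ↔ (∃ k, S.iob k) ∧ ∀ e, S.Ether e → ∀ x y : Pt K,
    (∃ c, S.IsCe c ∧ len (sp x - sp y) < c * |x 0 - y 0|) →
      ∃ h, S.iob h ∧ S.w e h x ∧ S.w e h y := by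
  simp [axThExpSTL]

/-- The trivial transformation given by a matrix, a spatial and a temporal translation. -/
def tmap (A : Matrix (Fin 3) (Fin 3) K) (a : Fin 3 → K) (τ : K) (x : Pt K) : Pt K :=
  pmk (x 0 + τ) (A.mulVec (sp x) + a)

/-- Prepend the thirteen parameters of a trivial transformation to an assignment. -/
def pushTriv (A : Matrix (Fin 3) (Fin 3) K) (a : Fin 3 → K) (τ : K) (ρ : ℕ → K) : ℕ → K :=
  scons (A 0 0) (scons (A 0 1) (scons (A 0 2) (scons (A 1 0) (scons (A 1 1) (scons (A 1 2)
    (scons (A 2 0) (scons (A 2 1) (scons (A 2 2) (scons (a 0) (scons (a 1) (scons (a 2)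
      (scons τ ρ))))))))))))

theorem sat_allQs_13 (φ : Fml) : sat S b ρ (.allQs 13 φ) ↔
    ∀ (A : Matrix (Fin 3) (Fin 3) K) (a : Fin 3 → K) (τ : K), sat S b (pushTriv A a τ ρ) φ := by
  constructor
  · intro h A a τ
    exact h τ (a 2) (a 1) (a 0) (A 2 2) (A 2 1) (A 2 0) (A 1 2) (A 1 1) (A 1 0) (A 0 2) (A 0 1)
      (A 0 0)
  · intro h τ a2 a1 a0 A22 A21 A20 A12 A11 A10 A02 A01 A00
    exact h !![A00, A01, A02; A10, A11, A12; A20, A21, A22] ![a0, a1, a2] τ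

theorem evs_trivMap (A : Matrix (Fin 3) (Fin 3) K) (a : Fin 3 → K) (τ : K) (y z : Pt K)
    (x : Fin 4 → ETerm) : evs (push z (push y (pushTriv A a τ ρ))) (trivMap 8 x) =
      tmap A a τ (evs (push z (push y (pushTriv A a τ ρ))) x) := by
  funext i
  fin_cases i
  · simp [evs, trivMap, tmap, pmk]
    rfl
  all_goals
    simp [evs, trivMap, tmap, pmk, Matrix.mulVec, dotProduct, Fin.sum_univ_three, sp]
    rfl

theorem defs_trivMap {x : Fin 4 → ETerm} (hx : Defs ρ x) (n : ℕ) : Defs ρ (trivMap n x) := by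
  have h0 := hx 0
  have h1 := hx 1
  have h2 := hx 2
  have h3 := hx 3
  intro i
  fin_cases i <;> simp [trivMap, h0, h1, h2, h3]

theorem sat_axTriv : sat S b ρ axTriv ↔
    ∀ (A : Matrix (Fin 3) (Fin 3) K) (a : Fin 3 → K) (τ : K),
      (∀ x y, len (sp (tmap A a τ x) - sp (tmap A a τ y)) = len (sp x - sp y)) →
      ∀ k, S.iob k → ∃ k', S.iob k' ∧ ∀ x y, S.Same k k' x y ↔ tmap A a τ x = y := by
  simp only [axTriv, sat_allQs_13]
  simp [evs_trivMap, defs_trivMap]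

/-- Passing from a frame where something moves with velocity `V` to one where it moves with
velocity `s`. -/
def reboost (V s : Fin 3 → K) (x : Pt K) : Pt K := pmk (x 0) (sp x - x 0 • V + x 0 • s)

/-- The relation that `relX` expresses. -/
def Str.RelX (k e : B) (x y : Pt K) : Prop :=
  ∃ (c : K) (V : Fin 3 → K), S.IsCe c ∧ S.VelIs k e V ∧ reboost V ((c / (1 + len V)) • V) x = y

/-- The relation that `relY` expresses. -/
def Str.RelY (k e : B) (x y : Pt K) : Prop :=
  ∃ (c : K) (V : Fin 3 → K), S.IsCe c ∧ S.VelIs k e V ∧ c - len V ≠ 0 ∧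
    reboost V ((c - len V)⁻¹ • V) x = y

theorem one_add_len_ne_zero (V : Fin 3 → K) : 1 + len V ≠ 0 :=
  (add_pos_of_pos_of_nonneg one_pos (len_nonneg V)).ne'

theorem evs_vec (c : Pt K) : evs (push c ρ) ![.v 0, .v 1, .v 2] = ![c 0, c 1, c 2] := by
  funext i; fin_cases i <;> rfl

theorem evs_slow (c : ETerm) (V : Fin 3 → ETerm) :
    evs ρ (slow c V) = (c.ev ρ / (1 + len (evs ρ V))) • evs ρ V := by
  funext i
  simp [slow, evs, ev_norm]
  ring

theorem evs_fast (c : ETerm) (V : Fin 3 → ETerm) :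
    evs ρ (fast c V) = (c.ev ρ - len (evs ρ V))⁻¹ • evs ρ V := by
  funext i
  simp [fast, evs, ev_norm]
  ring

theorem defs_slow {c : ETerm} {V : Fin 3 → ETerm} (hc : c.Def ρ) (hV : Defs ρ V) :
    Defs ρ (slow c V) := by
  intro i
  simp [slow, hc, hV, hV i, one_add_len_ne_zero]

theorem defs_fast {c : ETerm} {V : Fin 3 → ETerm} (hc : c.Def ρ) (hV : Defs ρ V) :
    Defs ρ (fast c V) ↔ c.ev ρ - len (evs ρ V) ≠ 0 := by
  simp [Defs, fast, hc, hV _]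

theorem evs_boostInv_boost (s V : Fin 3 → ETerm) (x : Fin 4 → ETerm) :
    evs ρ (boostInv s (boost V x)) = reboost (evs ρ V) (evs ρ s) (evs ρ x) := by
  funext i
  fin_cases i <;> simp [evs, boostInv, boost, reboost, pmk, sp, mul_comm]

theorem defs_boostInv_boost {s V : Fin 3 → ETerm} {x : Fin 4 → ETerm} (hV : Defs ρ V)
    (hx : Defs ρ x) : Defs ρ (boostInv s (boost V x)) ↔ Defs ρ s := by
  have h0 := hx 0
  have h1 := hx 1
  have h2 := hx 2
  have h3 := hx 3
  have h4 := hV 0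
  have h5 := hV 1
  have h6 := hV 2
  simp [Defs, boostInv, boost, Fin.forall_fin_succ, h0, h1, h2, h3, h4, h5, h6]

theorem evs_lift (n : ℕ) (x : Fin 4 → ETerm) :
    evs ρ (fun i => (x i).lift n) = evs (fun i => ρ (i + n)) x := by
  funext i; simp [evs]

theorem defs_lift (n : ℕ) (x : Fin 4 → ETerm) :
    Defs ρ (fun i => (x i).lift n) ↔ Defs (fun i => ρ (i + n)) x := by
  simp [Defs]

theorem eval_vec (c : Pt K) :
    (fun i => QTerm.eval (push c ρ) (![.var 0, .var 1, .var 2] i : QTerm)) = ![c 0, c 1, c 2] := by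
  funext i; fin_cases i <;> rfl

theorem exists_pt_iff {p : K → (Fin 3 → K) → Prop} :
    (∃ c : Pt K, p (c 3) ![c 0, c 1, c 2]) ↔ ∃ c V, p c V := by
  constructor
  · rintro ⟨c, h⟩
    exact ⟨_, _, h⟩
  · rintro ⟨c, V, h⟩
    refine ⟨![V 0, V 1, V 2, c], ?_⟩
    have hV : ![V 0, V 1, V 2] = V := by funext i; fin_cases i <;> rfl
    exact hV.symm ▸ h

theorem defs_vec (ρ : ℕ → K) : Defs ρ ![.v 0, .v 1, .v 2] := by
  intro i; fin_cases i <;> trivial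

/-- No condition of definedness survives because `1 + |V|` is positive. In `sat_relY` the condition
that `c - |V|` is nonzero remains, and it will be met only thanks to the ban on faster-than-light
observers. -/
theorem sat_relX (k e : ℕ) {x y : Fin 4 → ETerm} (hx : Defs ρ x) (hy : Defs ρ y) :
    sat S b ρ (relX k e x y) ↔ S.RelX (b k) (b e) (evs ρ x) (evs ρ y) := by
  rw [Str.RelX, ← exists_pt_iff]
  simp [relX, mapX, evs_boostInv_boost, defs_boostInv_boost, defs_vec, defs_lift, evs_lift, hx,
    hy, defs_slow, evs_slow, evs_vec, eval_vec]

theorem sat_relY (k e : ℕ) {x y : Fin 4 → ETerm} (hx : Defs ρ x) (hy : Defs ρ y) :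
    sat S b ρ (relY k e x y) ↔ S.RelY (b k) (b e) (evs ρ x) (evs ρ y) := by
  rw [Str.RelY, ← exists_pt_iff]
  simp [relY, mapY, evs_boostInv_boost, defs_boostInv_boost, defs_vec, defs_lift, evs_lift, hx,
    hy, defs_fast, evs_fast, evs_vec, eval_vec]

/-- The relation that `transW` expresses. -/
def Str.TransW (R : B → B → Pt K → Pt K → Prop) (k h : B) (x : Pt K) : Prop :=
  ∀ e, S.Ether e → (¬ S.iob h → ∃ y, R k e y x ∧ S.w k h y) ∧
    (S.iob h → ∃ (t : K) (z y : Pt K), R k e y x ∧ R h e z (pmk t 0) ∧ S.Same k h y z)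

theorem sat_transW {rel : ℕ → ℕ → (Fin 4 → ETerm) → (Fin 4 → ETerm) → Fml}
    {R : B → B → Pt K → Pt K → Prop}
    (hrel : ∀ (b : ℕ → B) (ρ : ℕ → K) (k e : ℕ) (x y : Fin 4 → ETerm), Defs ρ x → Defs ρ y →
      (sat S b ρ (rel k e x y) ↔ R (b k) (b e) (evs ρ x) (evs ρ y))) :
    sat S b ρ (transW rel) ↔ S.TransW R (b 0) (b 1) (ptAt ρ 0) := by
  have e9 : ∀ (y z : Pt K) (t : K), ptAt (push y (push z (scons t ρ))) 9 = ptAt ρ 0 :=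
    fun y z t => (ptAt_push_add _ _ 5).trans ((ptAt_push_add _ _ 1).trans (ptAt_scons_1 t ρ))
  have d8 : ∀ ρ' : ℕ → K, Defs ρ' ![.v 8, 0, 0, 0] := by
    intro ρ' i; fin_cases i <;> trivial
  have e8 : ∀ (y z : Pt K) (t : K),
      evs (push y (push z (scons t ρ))) ![.v 8, 0, 0, 0] = pmk t 0 := by
    intro y z t
    funext i; fin_cases i <;> rfl
  simp [transW, Str.TransW, hrel, e9, d8, e8]

/-- The structure that a translation of `W` defines. -/
def Str.tr (R : B → B → Pt K → Pt K → Prop) : Str B K := ⟨S.iob, S.ph, S.TransW R⟩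

/-- Translating a formula amounts to evaluating the formula itself in a modified structure. This is
how the syntactic translations become operations on models. -/
theorem sat_map_of_sat_w {Tr : Translation} {S' : Str B K} (hi : Tr.iob = .iob 0)
    (hp : Tr.ph = .ph 0) (hl : Tr.le = .le (.var 0) (.var 1)) (h1 : S'.iob = S.iob)
    (h2 : S'.ph = S.ph) (hw : ∀ b ρ, sat S b ρ Tr.w ↔ S'.w (b 0) (b 1) (ptAt ρ 0)) (φ : Fml) :
    sat S b ρ (Tr.map φ) ↔ sat S' b ρ φ := by
  induction φ generalizing b ρ with
  | iob k => simp [Translation.map, hi, h1, Fml.subst]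
  | ph k => simp [Translation.map, hp, h2, Fml.subst]
  | le s t => simp [Translation.map, hl, Fml.subst, QTerm.subst]
  | eqQ s t => rfl
  | eqB k h => rfl
  | bot => rfl
  | imp φ ψ ih1 ih2 => exact imp_congr (ih1 b ρ) (ih2 b ρ)
  | allB φ ih => exact forall_congr' fun a => ih _ _
  | allQ φ ih => exact forall_congr' fun a => ih _ _
  | w k h x =>
    simp only [Translation.map, sat_subst, hw, sat_w]
    refine iff_of_eq (congrArg (S'.w (b k) (b h)) ?_)
    funext i; fin_cases i <;> rfl

theorem sat_map_trStar (φ : Fml) : sat S b ρ (trStar.map φ) ↔ sat (S.tr S.RelX) b ρ φ :=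
  sat_map_of_sat_w S b ρ (Tr := trStar) (S' := S.tr S.RelX) rfl rfl rfl rfl rfl
    (fun b ρ => sat_transW S b ρ fun b ρ k e _ _ hx hy => sat_relX S b ρ k e hx hy) φ

theorem sat_map_trStar' (φ : Fml) : sat S b ρ (trStar'.map φ) ↔ sat (S.tr S.RelY) b ρ φ :=
  sat_map_of_sat_w S b ρ (Tr := trStar') (S' := S.tr S.RelY) rfl rfl rfl rfl rfl
    (fun b ρ => sat_transW S b ρ fun b ρ k e _ _ hx hy => sat_relY S b ρ k e hx hy) φ

theorem sat_etherVelIs : sat S b ρ etherVelIs ↔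
    S.Ether (b 1) ∧ S.VelIs (b 0) (b 1) ![ρ 0, ρ 1, ρ 2] := by
  have : (fun i => QTerm.eval ρ (![.var 0, .var 1, .var 2] i : QTerm)) = ![ρ 0, ρ 1, ρ 2] := by
    funext i; fin_cases i <;> rfl
  simp [etherVelIs, this]

theorem sat_etherSlowedVelIs : sat S b ρ etherSlowedVelIs ↔
    S.Ether (b 1) ∧ ∃ (c : K) (V : Fin 3 → K), S.IsCe c ∧ S.VelIs (b 0) (b 1) V ∧
      (c / (1 + len V)) • V = ![ρ 0, ρ 1, ρ 2] := by
  rw [← exists_pt_iff]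
  have e4 : ∀ (c : Pt K) (i : Fin 3), push c ρ (4 + i) = ![ρ 0, ρ 1, ρ 2] i := by
    intro c i; fin_cases i <;> rfl
  have es : ∀ (c : Pt K) (i : Fin 3), (slow (.v 3) ![.v 0, .v 1, .v 2] i).ev (push c ρ) =
      ((c 3 / (1 + len ![c 0, c 1, c 2])) • ![c 0, c 1, c 2]) i := by
    intro c i
    have := congrFun (evs_slow (push c ρ) (.v 3) ![.v 0, .v 1, .v 2]) i
    rw [evs_vec] at this
    exact this
  have ed : ∀ (c : Pt K) (i : Fin 3), (slow (.v 3) ![.v 0, .v 1, .v 2] i).Def (push c ρ) :=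
    fun c => defs_slow _ trivial (defs_vec _)
  simp only [etherSlowedVelIs, sat_conj, sat_ether, sat_exQs_4, sat_isCe, eval_var, push_3,
    sat_velIs, eval_vec, sat_all3, sat_eqE, ed, ETerm.def_v, ETerm.ev_v, e4, es, true_and,
    ← funext_iff]

end Axioms


/-! ### Galilean transformations, and worlds seen from an ether observer. -/

section Galilean

variable {B K : Type} [Field K] [LinearOrder K] [IsStrictOrderedRing K] [Euclidean K]

/-- A Galilean transformation `(t, p) ↦ (ε t + τ, A p + t b + a)` with `ε = ±1` and `A`
orthogonal. -/
@[ext] structure Gal (K : Type) [Field K] where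
  ε : K
  τ : K
  A : (Fin 3 → K) ≃ₗ[K] (Fin 3 → K)
  b : Fin 3 → K
  a : Fin 3 → K
  ε_mul_self : ε * ε = 1
  dot_A : ∀ u v, A u ⬝ᵥ A v = u ⬝ᵥ v

namespace Gal

variable (g : Gal K)

/-- The action on coordinate points. -/
def act (x : Pt K) : Pt K := pmk (g.ε * x 0 + g.τ) (g.A (sp x) + x 0 • g.b + g.a)

/-- The inverse action on coordinate points. -/
def inv (x : Pt K) : Pt K :=
  pmk (g.ε * (x 0 - g.τ)) (g.A.symm (sp x - (g.ε * (x 0 - g.τ)) • g.b - g.a))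

@[simp] theorem act_time (x : Pt K) : g.act x 0 = g.ε * x 0 + g.τ := rfl

@[simp] theorem sp_act (x : Pt K) : sp (g.act x) = g.A (sp x) + x 0 • g.b + g.a := rfl

theorem ε_ne_zero : g.ε ≠ 0 := fun h => by simpa [h] using g.ε_mul_self

@[simp] theorem act_inv (x : Pt K) : g.act (g.inv x) = x := by
  refine pt_ext ?_ ?_
  · simp [inv, ← mul_assoc, g.ε_mul_self]
  · simp only [sp_act, inv, sp_pmk, LinearEquiv.apply_symm_apply, pmk_zero]
    abel

@[simp] theorem inv_act (x : Pt K) : g.inv (g.act x) = x := by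
  have h : g.ε * (g.ε * x 0 + g.τ - g.τ) = x 0 := by
    rw [add_sub_cancel_right, ← mul_assoc, g.ε_mul_self, one_mul]
  refine pt_ext ?_ ?_
  · simpa [inv] using h
  · simp only [inv, sp_act, act_time, h, sp_pmk]
    rw [add_sub_cancel_right] at *
    rw [LinearEquiv.symm_apply_eq]
    abel

theorem act_surjective : Function.Surjective g.act := fun x => ⟨g.inv x, g.act_inv x⟩

theorem act_injective : Function.Injective g.act := fun x y h => by
  rw [← g.inv_act x, h, inv_act]

theorem nsq_A (u : Fin 3 → K) : nsq (g.A u) = nsq u := g.dot_A u u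

theorem abs_ε_mul (t : K) : |g.ε * t| = |t| := by
  have : |g.ε| * |g.ε| = 1 := by rw [← abs_mul, g.ε_mul_self, abs_one]
  have h : |g.ε| = 1 := by
    rcases mul_self_eq_one_iff.1 this with h | h
    · exact h
    · linarith [abs_nonneg g.ε]
  rw [abs_mul, h, one_mul]

theorem act_time_sub (x y : Pt K) : g.act x 0 - g.act y 0 = g.ε * (x 0 - y 0) := by
  simp only [act_time]; ring

theorem sp_act_sub (x y : Pt K) :
    sp (g.act x) - sp (g.act y) = g.A (sp x - sp y) + (x 0 - y 0) • g.b := by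
  simp only [sp_act, map_sub, sub_smul]; abel

/-- A Galilean transformation is determined by its action. -/
theorem act_inj {g h : Gal K} (H : ∀ x, g.act x = h.act x) : g = h := by
  -- The images of the origin, of its successor in time, and of the points at time `0` reveal all
  -- parameters in turn.
  have hτ : g.τ = h.τ := by simpa using congrFun (H 0) 0
  have hε : g.ε = h.ε := by
    have := congrFun (H (pmk 1 0)) 0
    simpa [hτ] using this
  have ha : g.a = h.a := by simpa using congrArg sp (H (pmk 0 0))
  have hb : g.b = h.b := by simpa [ha] using congrArg sp (H (pmk 1 0))
  have hA : g.A = h.A := by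
    ext1 u
    simpa [ha, hb] using congrArg sp (H (pmk 0 u))
  exact Gal.ext hε hτ hA hb ha

/-- The identity. -/
def one (K : Type) [Field K] : Gal K where
  ε := 1
  τ := 0
  A := LinearEquiv.refl K _
  b := 0
  a := 0
  ε_mul_self := one_mul 1
  dot_A _ _ := rfl

@[simp] theorem one_act (x : Pt K) : (one K).act x = x := by
  refine pt_ext ?_ ?_ <;> simp [one]

/-- Composition with a trivial transformation. -/
def post (A : (Fin 3 → K) ≃ₗ[K] (Fin 3 → K)) (hA : ∀ u v, A u ⬝ᵥ A v = u ⬝ᵥ v)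
    (a : Fin 3 → K) (τ : K) : Gal K where
  ε := g.ε
  τ := g.τ + τ
  A := g.A.trans A
  b := A g.b
  a := A g.a + a
  ε_mul_self := g.ε_mul_self
  dot_A u v := (hA _ _).trans (g.dot_A u v)

theorem post_act (A : (Fin 3 → K) ≃ₗ[K] (Fin 3 → K)) (hA : ∀ u v, A u ⬝ᵥ A v = u ⬝ᵥ v)
    (a : Fin 3 → K) (τ : K) (x : Pt K) :
    (g.post A hA a τ).act x = pmk (g.act x 0 + τ) (A (sp (g.act x)) + a) := by
  refine pt_ext ?_ ?_
  · simp [post, add_assoc]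
  · simp [post, add_assoc]

end Gal

/-- A description of a model from the point of view of one of its ether observers: worldlines
of the bodies that are not inertial observers, and coordinate systems of the inertial
observers. -/
structure World (B K : Type) [Field K] [LinearOrder K] [IsStrictOrderedRing K] [Euclidean K] where
  iob : B → Prop
  ph : B → Prop
  line : B → Pt K → Prop
  chart : B → Gal K
  e₀ : B
  c : K
  iob_e₀ : iob e₀
  chart_e₀ : chart e₀ = Gal.one K
  kinds : ∀ k, iob k → ¬ ph k
  c_pos : 0 < c
  light : ∀ x y, (∃ p, ph p ∧ line p x ∧ line p y) ↔ len (sp x - sp y) = c * |x 0 - y 0|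
  triv : ∀ k, iob k → ∀ A hA a τ, ∃ k', iob k' ∧ chart k' = (chart k).post A hA a τ

namespace World

variable (D : World B K)

/-- The model that is described. -/
def toStr : Str B K where
  iob := D.iob
  ph := D.ph
  w k h x := D.iob k ∧ (¬ D.iob h → D.line h ((D.chart k).inv x)) ∧
    (D.iob h → sp ((D.chart h).act ((D.chart k).inv x)) = 0)

@[simp] theorem toStr_iob : D.toStr.iob = D.iob := rfl

theorem w_act (k h : B) (x : Pt K) : D.toStr.w k h ((D.chart k).act x) ↔
    D.iob k ∧ (¬ D.iob h → D.line h x) ∧ (D.iob h → sp ((D.chart h).act x) = 0) := by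
  simp [toStr]

theorem w_act_iob {k h : B} (hk : D.iob k) (hh : D.iob h) (x : Pt K) :
    D.toStr.w k h ((D.chart k).act x) ↔ sp ((D.chart h).act x) = 0 := by
  simp [w_act, hk, hh]

theorem w_act_ph {k p : B} (hk : D.iob k) (hp : D.ph p) (x : Pt K) :
    D.toStr.w k p ((D.chart k).act x) ↔ D.line p x := by
  have : ¬ D.iob p := fun h => D.kinds p h hp
  simp [w_act, hk, this]

theorem light_iff {c : K} (hc : 0 ≤ c) (x y : Pt K) : len (sp x - sp y) = c * |x 0 - y 0| ↔
    nsq (sp x - sp y) = c * c * ((x 0 - y 0) * (x 0 - y 0)) := by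
  rw [len_eq_iff (mul_nonneg hc (abs_nonneg _)), mul_mul_mul_comm, abs_mul_abs_self]

theorem light' (x y : Pt K) : (∃ p, D.ph p ∧ D.line p x ∧ D.line p y) ↔
    nsq (sp x - sp y) = D.c * D.c * ((x 0 - y 0) * (x 0 - y 0)) := by
  rw [D.light, light_iff D.c_pos.le]

/-- Light signals distinguish events. -/
theorem eq_of_line {x y : Pt K} (h : ∀ p, D.ph p → D.line p x → D.line p y) : x = y := by
  have key : ∀ z, nsq (sp x - sp z) = D.c * D.c * ((x 0 - z 0) * (x 0 - z 0)) →
      nsq (sp y - sp z) = D.c * D.c * ((y 0 - z 0) * (y 0 - z 0)) := by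
    intro z hz
    obtain ⟨p, hp, h1, h2⟩ := (D.light' x z).2 hz
    exact (D.light' y z).1 ⟨p, hp, h p hp h1, h2⟩
  have hc := D.c_pos.ne'
  -- The cone of `x` contains `x` and the points one time unit later at distance `c` in two opposite
  -- directions. With `d = y - x` and `T` the time difference, the first gives `|d|² = c² T²`;
  -- adding the relations from the other two cancels the product of `d` with the direction and
  -- leaves `4 c² T = 0`.
  have h0 := key x (by simp)
  have h1 := key (pmk (x 0 + 1) (sp x + D.c • ![1, 0, 0])) (by
    rw [sp_pmk, sub_add_cancel_left, nsq_neg, nsq_smul, nsq_eq]; simp)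
  have h2 := key (pmk (x 0 + 1) (sp x - D.c • ![1, 0, 0])) (by
    rw [sp_pmk, sub_sub_cancel, nsq_smul, nsq_eq]; simp)
  set d := sp y - sp x with hd
  rw [sp_pmk, ← sub_sub, ← hd, nsq_sub, h0, nsq_smul, nsq_eq, pmk_zero, dotProduct_smul] at h1
  rw [sp_pmk, ← sub_add, ← hd, nsq_add, h0, nsq_smul, nsq_eq, pmk_zero, dotProduct_smul] at h2
  simp only [smul_eq_mul, Matrix.cons_val_zero, Matrix.cons_val_one, Matrix.cons_val] at h1 h2
  have h3 : 4 * (D.c * D.c) * (y 0 - x 0) = 0 := by linear_combination h1 + h2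
  have h4 : y 0 - x 0 = 0 := by
    rcases mul_eq_zero.1 h3 with h | h
    · simp [hc] at h
    · exact h
  rw [h4, mul_zero, mul_zero, nsq_eq_zero] at h0
  exact (pt_ext (sub_eq_zero.1 h4) (sub_eq_zero.1 h0)).symm

/-- Base points are faithful labels of events: light signals separate different points, and which
bodies are present is defined through the base point alone. -/
theorem same_act {k h : B} (hk : D.iob k) (hh : D.iob h) (x y : Pt K) :
    D.toStr.Same k h ((D.chart k).act x) ((D.chart h).act y) ↔ x = y := by
  constructor
  · intro H
    refine D.eq_of_line fun p hp hx => ?_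
    exact (D.w_act_ph hh hp y).1 ((H p).1 ((D.w_act_ph hk hp x).2 hx))
  · rintro rfl a
    rw [w_act, w_act]
    simp [hk, hh]

theorem same_iff {k h : B} (hk : D.iob k) (hh : D.iob h) (x y : Pt K) :
    D.toStr.Same k h x y ↔ (D.chart k).inv x = (D.chart h).inv y := by
  rw [← D.same_act hk hh, Gal.act_inv, Gal.act_inv]

/-- Light that `e` should see moving with velocity `c u`, apart from the drift `b`, has squared
speed `c² + 2 c (u · b) + |b|²`. For this to be the same for `u` and `-u`, `b` must be orthogonal to
every unit vector `u`. -/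
theorem ether_iff (e : B) : D.toStr.Ether e ↔ D.iob e ∧ (D.chart e).b = 0 := by
  have hph : ∀ x y, D.iob e → ((∃ p, D.ph p ∧ D.toStr.w e p ((D.chart e).act x) ∧
      D.toStr.w e p ((D.chart e).act y)) ↔
      nsq (sp x - sp y) = D.c * D.c * ((x 0 - y 0) * (x 0 - y 0))) := by
    intro x y he
    rw [← D.light']
    refine exists_congr fun p => and_congr_right fun hp => ?_
    rw [D.w_act_ph he hp, D.w_act_ph he hp]
  have hεε : ∀ t : K, (D.chart e).ε * t * ((D.chart e).ε * t) = t * t := fun t => by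
    rw [mul_mul_mul_comm, Gal.ε_mul_self, one_mul]
  constructor
  · rintro ⟨he, c, hc, H⟩
    refine ⟨he, ?_⟩
    have key : ∀ u, nsq u = 1 → D.c * D.c + 2 * (D.c * (u ⬝ᵥ (D.chart e).b)) +
        nsq (D.chart e).b = c * c := by
      intro u hu
      have h1 := (hph (pmk 1 ((D.chart e).A.symm (D.c • u))) 0 he).2 (by
        have h2 := (D.chart e).nsq_A ((D.chart e).A.symm (D.c • u))
        rw [LinearEquiv.apply_symm_apply, nsq_smul, hu] at h2
        have h3 : sp (0 : Pt K) = 0 := rfl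
        rw [sp_pmk, h3, sub_zero, ← h2]
        simp)
      have h4 := (light_iff hc.le _ _).1 ((H _ _).1 h1)
      have h3 : sp (0 : Pt K) = 0 := rfl
      rw [Gal.sp_act_sub, Gal.act_time_sub, hεε, sp_pmk, h3, sub_zero,
        LinearEquiv.apply_symm_apply, nsq_add, nsq_smul, hu] at h4
      simpa using h4
    have hcoord : ∀ u, nsq u = 1 → u ⬝ᵥ (D.chart e).b = 0 := by
      intro u hu
      have h1 := key u hu
      have h2 := key (-u) (by rw [nsq_neg, hu])
      rw [neg_dotProduct] at h2
      have h3 : D.c * (u ⬝ᵥ (D.chart e).b) = 0 := by linear_combination (h1 - h2) / 4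
      exact (mul_eq_zero.1 h3).resolve_left D.c_pos.ne'
    funext i
    simpa using hcoord (Pi.single i 1) (by simp [nsq])
  · rintro ⟨he, hb⟩
    refine ⟨he, D.c, D.c_pos, fun x y => ?_⟩
    obtain ⟨x, rfl⟩ := (D.chart e).act_surjective x
    obtain ⟨y, rfl⟩ := (D.chart e).act_surjective y
    rw [light_iff D.c_pos.le, Gal.sp_act_sub, Gal.act_time_sub, hεε, hb, smul_zero, add_zero,
      Gal.nsq_A]
    exact hph x y he

theorem chart_e₀_b : (D.chart D.e₀).b = 0 := by rw [D.chart_e₀]; rfl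

theorem ether_e₀ : D.toStr.Ether D.e₀ := (D.ether_iff _).2 ⟨D.iob_e₀, D.chart_e₀_b⟩

/-- Ether coordinate systems have the same spatial distances as the basic one. -/
theorem len_sp_act_sub {e : B} (hb : (D.chart e).b = 0) (x y : Pt K) :
    len (sp ((D.chart e).act x) - sp ((D.chart e).act y)) = len (sp x - sp y) := by
  rw [Gal.sp_act_sub, hb, smul_zero, add_zero, len_inj, Gal.nsq_A]

theorem abs_act_time_sub (e : B) (x y : Pt K) :
    |(D.chart e).act x 0 - (D.chart e).act y 0| = |x 0 - y 0| := by
  rw [Gal.act_time_sub, Gal.abs_ε_mul]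

/-- `IsCe` would hold vacuously if no light signal had a speed, so a signal through two points of
one light cone has to be exhibited; `light` then controls its entire worldline. -/
theorem isCe_iff (q : K) : D.toStr.IsCe q ↔ q = D.c := by
  constructor
  · intro h
    obtain ⟨p, hp, h1, h2⟩ := (D.light' (pmk 1 (D.c • ![1, 0, 0])) (pmk 0 0)).2 (by
      rw [sp_pmk, sp_pmk, sub_zero, nsq_smul, nsq_eq]; simp)
    refine (h _ D.ether_e₀ p hp D.c ⟨⟨_, _, (D.w_act_ph D.iob_e₀ hp _).2 h1,
      (D.w_act_ph D.iob_e₀ hp _).2 h2, fun h => ?_⟩, fun x y hx hy => ?_⟩).symm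
    · simpa using congrFun (Gal.act_injective _ h) 0
    · obtain ⟨x, rfl⟩ := (D.chart D.e₀).act_surjective x
      obtain ⟨y, rfl⟩ := (D.chart D.e₀).act_surjective y
      rw [D.len_sp_act_sub D.chart_e₀_b, D.abs_act_time_sub]
      exact (D.light x y).1 ⟨p, hp, (D.w_act_ph D.iob_e₀ hp _).1 hx,
        (D.w_act_ph D.iob_e₀ hp _).1 hy⟩
  · rintro rfl e he p hp v ⟨⟨x, y, hx, hy, hne⟩, H⟩
    have hv := H x y hx hy
    obtain ⟨he, hb⟩ := (D.ether_iff e).1 he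
    obtain ⟨x, rfl⟩ := (D.chart e).act_surjective x
    obtain ⟨y, rfl⟩ := (D.chart e).act_surjective y
    have hc := (D.light x y).1 ⟨p, hp, (D.w_act_ph he hp _).1 hx, (D.w_act_ph he hp _).1 hy⟩
    rw [D.len_sp_act_sub hb, D.abs_act_time_sub, hc] at hv
    -- Two simultaneous points of a light signal have distance zero and hence coincide.
    by_cases ht : |x 0 - y 0| = 0
    · rw [ht, mul_zero, len_eq_zero, sub_eq_zero] at hc
      rw [abs_eq_zero, sub_eq_zero] at ht
      exact (hne (by rw [pt_ext ht hc])).elim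
    · exact (mul_right_cancel₀ ht hv).symm

/-- An ether observer rests at one place of the base. Over a base duration `t` the chart of `k`
carries that place along `t b` while the time of `k` changes by `ε t`; since `ε = ±1`, the quotient
is `ε b`. In particular it does not depend on the ether observer. -/
theorem velIs_iff {k e : B} (he : D.toStr.Ether e) (V : Fin 3 → K) :
    D.toStr.VelIs k e V ↔ D.iob k ∧ V = (D.chart k).ε • (D.chart k).b := by
  obtain ⟨he, hb⟩ := (D.ether_iff e).1 he
  have hw : ∀ x, D.iob k → (D.toStr.w k e ((D.chart k).act x) ↔
      (D.chart e).A (sp x) + (D.chart e).a = 0) := by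
    intro x hk
    rw [D.w_act_iob hk he, Gal.sp_act, hb, smul_zero, add_zero]
  have h0 : ∀ t, D.iob k →
      D.toStr.w k e ((D.chart k).act (pmk t ((D.chart e).A.symm (-(D.chart e).a)))) := by
    intro t hk
    rw [hw _ hk, sp_pmk]
    simp
  constructor
  · rintro ⟨⟨x, y, hx, _, _⟩, H⟩
    refine ⟨hx.1, ?_⟩
    have := H _ _ (h0 0 hx.1) (h0 1 hx.1)
    rw [Gal.sp_act_sub, Gal.act_time_sub] at this
    simp only [sp_pmk, sub_self, map_zero, zero_add, pmk_zero, sub_zero, one_smul, mul_one] at this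
    rw [this, smul_smul, Gal.ε_mul_self, one_smul]
  · rintro ⟨hk, rfl⟩
    refine ⟨⟨_, _, h0 0 hk, h0 1 hk, fun h => ?_⟩, fun x y hx hy => ?_⟩
    · simpa using congrFun (Gal.act_injective _ h) 0
    · obtain ⟨x, rfl⟩ := (D.chart k).act_surjective x
      obtain ⟨y, rfl⟩ := (D.chart k).act_surjective y
      rw [hw _ hk] at hx hy
      have hxy : sp y = sp x := (D.chart e).A.injective (add_right_cancel (hy.trans hx.symm))
      rw [Gal.sp_act_sub, Gal.act_time_sub, hxy, sub_self, map_zero, zero_add, smul_smul,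
        mul_right_comm, Gal.ε_mul_self, one_mul]

/-- The worldline of an inertial observer in the basic coordinates. -/
theorem sp_act_eq_zero_iff (k : B) (x : Pt K) : sp ((D.chart k).act x) = 0 ↔
    sp x = (D.chart k).A.symm (-(x 0 • (D.chart k).b + (D.chart k).a)) := by
  rw [LinearEquiv.eq_symm_apply, Gal.sp_act, eq_neg_iff_add_eq_zero, add_assoc]

theorem sp_sub_of_sp_act_eq_zero {k : B} {x y : Pt K} (hx : sp ((D.chart k).act x) = 0)
    (hy : sp ((D.chart k).act y) = 0) :
    sp y - sp x = (y 0 - x 0) • (D.chart k).A.symm (-(D.chart k).b) := by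
  rw [sp_act_eq_zero_iff] at hx hy
  rw [hx, hy, ← map_sub, ← map_smul]
  congr 1
  rw [smul_neg, sub_smul]
  abel

theorem nsq_A_symm (k : B) (u : Fin 3 → K) : nsq ((D.chart k).A.symm u) = nsq u := by
  rw [← (D.chart k).nsq_A, LinearEquiv.apply_symm_apply]

/-- In base coordinates `k` moves with velocity `-A⁻¹ b`, and `A` is orthogonal; ether charts keep
distances and durations. -/
theorem speedIs_iff {e k : B} (he : D.toStr.Ether e) (hk : D.iob k) (v : K) :
    D.toStr.SpeedIs e k v ↔ v = len (D.chart k).b := by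
  obtain ⟨he, hb⟩ := (D.ether_iff e).1 he
  have hw := D.w_act_iob he hk
  have h0 : ∀ t, D.toStr.w e k ((D.chart e).act
      (pmk t ((D.chart k).A.symm (-(t • (D.chart k).b + (D.chart k).a))))) := by
    intro t
    rw [hw, sp_act_eq_zero_iff]
    rfl
  have hl : ∀ x y, sp ((D.chart k).act x) = 0 → sp ((D.chart k).act y) = 0 →
      len (sp x - sp y) = len (D.chart k).b * |x 0 - y 0| := by
    intro x y hx hy
    rw [D.sp_sub_of_sp_act_eq_zero hy hx, len_smul, mul_comm]
    congr 1
    rw [len_inj, nsq_A_symm, nsq_neg]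
  constructor
  · rintro ⟨_, H⟩
    have h1 := H _ _ (h0 1) (h0 0)
    rw [D.len_sp_act_sub hb, D.abs_act_time_sub, hl _ _ ((hw _).1 (h0 1)) ((hw _).1 (h0 0))] at h1
    simpa using h1.symm
  · rintro rfl
    refine ⟨⟨_, _, h0 0, h0 1, fun h => ?_⟩, fun x y hx hy => ?_⟩
    · simpa using congrFun (Gal.act_injective _ h) 0
    · obtain ⟨x, rfl⟩ := (D.chart e).act_surjective x
      obtain ⟨y, rfl⟩ := (D.chart e).act_surjective y
      rw [D.len_sp_act_sub hb, D.abs_act_time_sub]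
      exact hl x y ((hw _).1 hx) ((hw _).1 hy)

end World

end Galilean


/-! ### Worlds satisfy the axioms. -/

section Galilean

variable {B K : Type} [Field K] [LinearOrder K] [IsStrictOrderedRing K] [Euclidean K]

/-- A linear map that preserves lengths is an orthogonal automorphism. -/
theorem exists_orthogonal (f : (Fin 3 → K) →ₗ[K] (Fin 3 → K)) (hf : ∀ u, nsq (f u) = nsq u) :
    ∃ A : (Fin 3 → K) ≃ₗ[K] (Fin 3 → K), (∀ u, A u = f u) ∧ ∀ u v, A u ⬝ᵥ A v = u ⬝ᵥ v := by
  have hinj : Function.Injective f := by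
    rw [injective_iff_map_eq_zero]
    intro u hu
    rw [← nsq_eq_zero, ← hf, hu, nsq_zero]
  refine ⟨LinearEquiv.ofInjectiveEndo f hinj, fun u => rfl, fun u v => ?_⟩
  change f u ⬝ᵥ f v = u ⬝ᵥ v
  have h := hf (u + v)
  rw [map_add, nsq_add, nsq_add, hf, hf] at h
  linear_combination h / 2

namespace World

variable (D : World B K)

/-- Some inertial observer has velocity `w` in the basic coordinates. -/
def HasVel (w : Fin 3 → K) : Prop := ∃ h, D.iob h ∧ (D.chart h).A w + (D.chart h).b = 0

/-- Inertial observers have all velocities. -/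
def Full : Prop := ∀ w, D.HasVel w

/-- Inertial observers have exactly the velocities slower than light. -/
def Slow : Prop := (∀ k, len (D.chart k).b < D.c) ∧ ∀ w, len w < D.c → D.HasVel w

variable {D}

/-- An observer with the right velocity is shifted in space by a trivial transformation until he
passes through `x`; the velocity then takes him through `y`. -/
theorem HasVel.exists_through {x y : Pt K} (h0 : x 0 ≠ y 0)
    (h : D.HasVel ((y 0 - x 0)⁻¹ • (sp y - sp x))) :
    ∃ h, D.iob h ∧ sp ((D.chart h).act x) = 0 ∧ sp ((D.chart h).act y) = 0 := by
  obtain ⟨k, hk, hw⟩ := h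
  have hne : y 0 - x 0 ≠ 0 := sub_ne_zero.2 h0.symm
  have hd : ∀ u v : Fin 3 → K, LinearEquiv.refl K (Fin 3 → K) u ⬝ᵥ LinearEquiv.refl K (Fin 3 → K) v =
    u ⬝ᵥ v := fun _ _ => rfl
  obtain ⟨k', hk', hc⟩ := D.triv k hk (LinearEquiv.refl K _) hd
    (-sp ((D.chart k).act x)) 0
  refine ⟨k', hk', ?_, ?_⟩
  · rw [hc, Gal.post_act, sp_pmk, LinearEquiv.refl_apply, add_neg_cancel]
  · rw [hc, Gal.post_act, sp_pmk, LinearEquiv.refl_apply, ← sub_eq_add_neg, Gal.sp_act_sub]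
    have := congrArg (fun u => (y 0 - x 0) • u) hw
    simpa [smul_smul, hne] using this

theorem HasVel.of_through {w : Fin 3 → K}
    (h : ∃ h, D.iob h ∧ sp ((D.chart h).act 0) = 0 ∧ sp ((D.chart h).act (pmk 1 w)) = 0) :
    D.HasVel w := by
  obtain ⟨k, hk, h1, h2⟩ := h
  refine ⟨k, hk, ?_⟩
  have h3 := (D.chart k).sp_act_sub (pmk 1 w) 0
  have h4 : sp (0 : Pt K) = 0 := rfl
  rw [h1, h2, h4] at h3
  simpa using h3.symm

variable (D)

theorem sat_of_mem_kinFull (b : ℕ → B) (ρ : ℕ → K) : ∀ φ ∈ kinFull, sat D.toStr b ρ φ := by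
  simp only [kinFull, Set.mem_insert_iff, Set.mem_singleton_iff, forall_eq_or_imp, forall_eq]
  refine ⟨sat_axEField _ b ρ, (sat_axEv _ b ρ).2 ?_, (sat_axSelf _ b ρ).2 ?_,
    (sat_axSymD _ b ρ).2 ?_, (sat_axLine _ b ρ).2 ?_, (sat_axTriv _ b ρ).2 ?_,
    (sat_axNoAcc _ b ρ).2 ?_, (sat_axKinds _ b ρ).2 D.kinds⟩
  · intro k hk h hh x
    exact ⟨(D.chart h).act ((D.chart k).inv x), (D.same_iff hk hh _ _).2 (by simp)⟩
  · intro k hk x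
    obtain ⟨x, rfl⟩ := (D.chart k).act_surjective x
    exact D.w_act_iob hk hk x
  · intro k hk h hh x y x' y' h0 h0' hx hy
    obtain ⟨x, rfl⟩ := (D.chart k).act_surjective x
    obtain ⟨y, rfl⟩ := (D.chart k).act_surjective y
    obtain ⟨x', rfl⟩ := (D.chart h).act_surjective x'
    obtain ⟨y', rfl⟩ := (D.chart h).act_surjective y'
    rw [D.same_act hk hh] at hx hy
    subst hx hy
    have h1 : x 0 - y 0 = 0 := by
      have := (D.chart k).act_time_sub x y
      rw [h0, sub_self, eq_comm, mul_eq_zero] at this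
      exact this.resolve_left (D.chart k).ε_ne_zero
    rw [len_inj, Gal.sp_act_sub, Gal.sp_act_sub, h1, zero_smul, zero_smul, add_zero, add_zero,
      Gal.nsq_A, Gal.nsq_A]
  · intro k hk h hh x y z hx hy hz
    obtain ⟨x, rfl⟩ := (D.chart k).act_surjective x
    obtain ⟨y, rfl⟩ := (D.chart k).act_surjective y
    obtain ⟨z, rfl⟩ := (D.chart k).act_surjective z
    rw [D.w_act_iob hk hh] at hx hy hz
    have e1 := D.sp_sub_of_sp_act_eq_zero hx hy
    have e2 := D.sp_sub_of_sp_act_eq_zero hx hz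
    by_cases hxy : y 0 = x 0
    -- Simultaneous points of the worldline of an inertial observer are equal, so here `x = y`. The
    -- first alternative may then fail, and the second holds with factor `-1`.
    · refine ⟨-1, Or.inr ?_⟩
      rw [hxy, sub_self, zero_smul, sub_eq_zero] at e1
      rw [pt_ext hxy e1, neg_one_smul, neg_sub]
    · have hne : y 0 - x 0 ≠ 0 := sub_ne_zero.2 hxy
      refine ⟨(z 0 - x 0) / (y 0 - x 0), Or.inl (pt_ext ?_ ?_)⟩
      · have t1 := (D.chart k).act_time_sub z x
        have t2 := (D.chart k).act_time_sub y x
        rw [Pi.smul_apply, Pi.sub_apply, Pi.sub_apply, t1, t2, smul_eq_mul]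
        field_simp
      · change sp ((D.chart k).act z) - sp ((D.chart k).act x) =
          ((z 0 - x 0) / (y 0 - x 0)) • (sp ((D.chart k).act y) - sp ((D.chart k).act x))
        rw [Gal.sp_act_sub, Gal.sp_act_sub, e1, e2, map_smul, map_smul, ← smul_add, ← smul_add,
          smul_smul, div_mul_cancel₀ _ hne]
  · intro A a τ hiso k hk
    -- The isometry condition between a point at time `0` and the origin says that `A` preserves
    -- lengths.
    obtain ⟨A', hA', hdot⟩ := exists_orthogonal A.mulVecLin fun u => by
      have := hiso (pmk 0 u) (pmk 0 0)
      rw [len_inj] at this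
      simpa [tmap] using this
    obtain ⟨k', hk', hc⟩ := D.triv k hk A' hdot a τ
    refine ⟨k', hk', fun x y => ?_⟩
    obtain ⟨x, rfl⟩ := (D.chart k).act_surjective x
    have h1 : tmap A a τ ((D.chart k).act x) = (D.chart k').act x := by
      rw [hc, Gal.post_act, hA']; rfl
    obtain ⟨y, rfl⟩ := (D.chart k').act_surjective y
    rw [h1, D.same_act hk hk', (D.chart k').act_injective.eq_iff]
  · intro k h x hw
    exact hw.1

theorem sat_axAbsTime (b : ℕ → B) (ρ : ℕ → K) : sat D.toStr b ρ axAbsTime := by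
  rw [Kin.sat_axAbsTime]
  intro k hk h hh x y x' y' hx hy
  obtain ⟨x, rfl⟩ := (D.chart k).act_surjective x
  obtain ⟨y, rfl⟩ := (D.chart k).act_surjective y
  obtain ⟨x', rfl⟩ := (D.chart h).act_surjective x'
  obtain ⟨y', rfl⟩ := (D.chart h).act_surjective y'
  rw [D.same_act hk hh] at hx hy
  subst hx hy
  rw [D.abs_act_time_sub, D.abs_act_time_sub]

theorem sat_axEther (b : ℕ → B) (ρ : ℕ → K) : sat D.toStr b ρ axEther :=
  (Kin.sat_axEther _ b ρ).2 ⟨_, D.ether_e₀⟩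

variable {D}

theorem Full.sat_of_mem (hD : D.Full) (b : ℕ → B) (ρ : ℕ → K) :
    ∀ φ ∈ classicalKinFull, sat D.toStr b ρ φ := by
  rintro φ (hφ | hφ)
  · exact D.sat_of_mem_kinFull b ρ φ hφ
  simp only [Set.mem_insert_iff, Set.mem_singleton_iff] at hφ
  rcases hφ with rfl | rfl | rfl
  · exact D.sat_axAbsTime b ρ
  · rw [sat_axThExpPlus]
    refine ⟨⟨_, D.iob_e₀⟩, fun k hk x y hne => ?_⟩
    obtain ⟨x, rfl⟩ := (D.chart k).act_surjective x
    obtain ⟨y, rfl⟩ := (D.chart k).act_surjective y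
    have h0 : x 0 ≠ y 0 := fun h => hne (by simp [h])
    obtain ⟨h, hh, h1, h2⟩ := (hD _).exists_through h0
    exact ⟨h, hh, (D.w_act_iob hk hh x).2 h1, (D.w_act_iob hk hh y).2 h2⟩
  · exact D.sat_axEther b ρ

theorem Slow.sat_of_mem (hD : D.Slow) (b : ℕ → B) (ρ : ℕ → K) :
    ∀ φ ∈ classicalKinSTLFull, sat D.toStr b ρ φ := by
  rintro φ (hφ | hφ)
  · exact D.sat_of_mem_kinFull b ρ φ hφ
  simp only [Set.mem_insert_iff, Set.mem_singleton_iff] at hφ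
  rcases hφ with rfl | rfl | rfl | rfl
  · exact D.sat_axAbsTime b ρ
  · exact D.sat_axEther b ρ
  · rw [sat_axNoFTL]
    intro k hk e he
    exact ⟨_, _, (D.speedIs_iff he hk _).2 rfl, (D.isCe_iff _).2 rfl, hD.1 k⟩
  · rw [sat_axThExpSTL]
    refine ⟨⟨_, D.iob_e₀⟩, ?_⟩
    rintro e he x y ⟨c, hc, hlt⟩
    obtain rfl := (D.isCe_iff c).1 hc
    obtain ⟨he, hb⟩ := (D.ether_iff e).1 he
    obtain ⟨x, rfl⟩ := (D.chart e).act_surjective x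
    obtain ⟨y, rfl⟩ := (D.chart e).act_surjective y
    rw [D.len_sp_act_sub hb, D.abs_act_time_sub] at hlt
    have h0 : x 0 ≠ y 0 := fun h => by
      rw [h, sub_self, abs_zero, mul_zero] at hlt
      exact (len_nonneg _).not_gt hlt
    obtain ⟨h, hh, h1, h2⟩ := (hD.2 _ (by
      have hpos : 0 < |y 0 - x 0| := abs_pos.2 (sub_ne_zero.2 h0.symm)
      rw [len_smul, abs_inv, inv_mul_lt_iff₀ hpos, abs_sub_comm, mul_comm]
      rwa [len_inj.2 (nsq_sub_comm (sp y) (sp x))])).exists_through h0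
    exact ⟨h, hh, (D.w_act_iob he hh x).2 h1, (D.w_act_iob he hh y).2 h2⟩

end World

/-! ## Change of coordinates of all inertial observers -/

/-- Multiply the velocity of the basic frame by `s`, keeping the point of rest at time `0`. -/
def Gal.boost (g : Gal K) (s : K) : Gal K where
  ε := g.ε
  τ := g.τ
  A := g.A
  b := s • g.b
  a := g.a + (g.ε * g.τ * (s - 1)) • g.b
  ε_mul_self := g.ε_mul_self
  dot_A := g.dot_A

/-- Reboosting adds `(s - 1) t (ε b)` at the observer's own time `t = ε x₀ + τ`. Since `t ε = x₀ + ε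
τ`, the part proportional to `x₀` replaces `b` by `s b`, and the constant part is the correction of
`a` in `Gal.boost`. -/
theorem Gal.boost_act (g : Gal K) (s : K) (x : Pt K) :
    (g.boost s).act x = reboost (g.ε • g.b) (s • g.ε • g.b) (g.act x) := by
  refine pt_ext rfl ?_
  simp only [Gal.sp_act, boost, reboost, sp_pmk, Gal.act_time]
  have h : (g.ε * x 0 + g.τ) * g.ε = x 0 + g.ε * g.τ := by linear_combination x 0 * g.ε_mul_self
  have h' : (g.ε * x 0 + g.τ) • g.ε • g.b = (x 0 + g.ε * g.τ) • g.b := by rw [smul_smul, h]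
  rw [smul_comm (g.ε * x 0 + g.τ) s, h']
  module

theorem Gal.boost_boost (g : Gal K) {s s' : K} (h : s' * s = 1) : (g.boost s).boost s' = g := by
  refine Gal.ext rfl rfl rfl ?_ ?_
  · simp [boost, smul_smul, h]
  · simp only [boost, smul_smul, add_assoc, ← add_smul, add_eq_left]
    rw [show g.ε * g.τ * (s - 1) + g.ε * g.τ * (s' - 1) * s = 0 by
      linear_combination g.ε * g.τ * h, zero_smul]

namespace World

variable (D : World B K)

/-- Change the speed of the basic frame according to each inertial observer. -/
def boost (f : K → K) : World B K where
  iob := D.iob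
  ph := D.ph
  line := D.line
  chart k := (D.chart k).boost (f (nsq (D.chart k).b))
  e₀ := D.e₀
  c := D.c
  iob_e₀ := D.iob_e₀
  chart_e₀ := by
    rw [D.chart_e₀]
    refine Gal.ext rfl rfl rfl (smul_zero _) ?_
    simp [Gal.boost, Gal.one]
  kinds := D.kinds
  c_pos := D.c_pos
  light := D.light
  triv k hk A hA a τ := by
    set s := f (nsq (D.chart k).b) with hs
    -- The correction made by `Gal.boost` depends on the time offset, which the trivial
    -- transformation alters by `τ`; the spatial translation is adjusted in advance. The factor `s`
    -- is the same for `k'` because `A` preserves `|b|`.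
    obtain ⟨k', hk', hc⟩ := D.triv k hk A hA
      (a - ((D.chart k).ε * τ * (s - 1)) • A (D.chart k).b) τ
    have hb : nsq (D.chart k').b = nsq (D.chart k).b := by rw [hc]; exact hA _ _
    refine ⟨k', hk', ?_⟩
    rw [hb, ← hs, hc]
    refine Gal.ext rfl rfl rfl ?_ ?_
    · simp [Gal.boost, Gal.post]
    · simp only [Gal.boost, Gal.post, map_add, map_smul]
      module

theorem boost_boost (f f' : K → K)
    (h : ∀ k, f' (nsq (f (nsq (D.chart k).b) • (D.chart k).b)) * f (nsq (D.chart k).b) = 1) :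
    (D.boost f).boost f' = D := by
  have : (fun k => (((D.boost f).boost f').chart k)) = D.chart :=
    funext fun k => (D.chart k).boost_boost (h k)
  cases D
  simp only [boost] at this ⊢
  congr

variable {D} in
-- From `A w = -b` with `A` orthogonal, `b` and `w` have equal length, so one factor rescales both.
theorem HasVel.boost {w : Fin 3 → K} (h : D.HasVel w) (f : K → K) :
    (D.boost f).HasVel (f (nsq w) • w) := by
  obtain ⟨k, hk, hw⟩ := h
  refine ⟨k, hk, ?_⟩
  have hb : nsq (D.chart k).b = nsq w := by
    rw [← neg_eq_of_add_eq_zero_right hw, nsq_neg, Gal.nsq_A]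
  simp only [World.boost, Gal.boost, hb]
  rw [map_smul, ← smul_add, hw, smul_zero]

/-- Here `R` passes from the old to the new coordinates that `k` gives to one base point. The
translated `W` then keeps the base worldlines of non-observers, while its clause for an observer `h`
says that the base point lies on the time axis of the new coordinates of `h`. Both agree with the
boosted world. -/
theorem tr_eq_boost {f : K → K} {R : B → B → Pt K → Pt K → Prop}
    (hR : ∀ e, D.toStr.Ether e → ∀ k x y, R k e ((D.chart k).act x) y ↔
      D.iob k ∧ ((D.boost f).chart k).act x = y) :
    D.toStr.tr R = (D.boost f).toStr := by
  have key : D.toStr.TransW R = (D.boost f).toStr.w := by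
    funext k h x
    obtain ⟨x, rfl⟩ := ((D.boost f).chart k).act_surjective x
    rw [w_act]
    refine propext ⟨fun H => ?_, fun ⟨hk, h1, h2⟩ e he => ⟨fun hh => ?_, fun hh => ?_⟩⟩
    -- One ether observer is enough in this direction; the converse must serve all of them.
    · obtain ⟨H1, H2⟩ := H _ D.ether_e₀
      by_cases hh : D.iob h
      · obtain ⟨t, z, y, hy, hz, hs⟩ := H2 hh
        obtain ⟨y, rfl⟩ := (D.chart k).act_surjective y
        obtain ⟨z, rfl⟩ := (D.chart h).act_surjective z
        rw [hR _ D.ether_e₀] at hy hz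
        rw [D.same_act hy.1 hh] at hs
        subst hs
        have := Gal.act_injective _ hy.2
        subst this
        exact ⟨hy.1, fun hn => (hn hh).elim, fun _ => by rw [hz.2, sp_pmk]⟩
      · obtain ⟨y, hy, hw⟩ := H1 hh
        obtain ⟨y, rfl⟩ := (D.chart k).act_surjective y
        rw [hR _ D.ether_e₀] at hy
        have := Gal.act_injective _ hy.2
        subst this
        exact ⟨hy.1, fun _ => ((D.w_act k h y).1 hw).2.1 hh, fun hh' => (hh hh').elim⟩
    · exact ⟨_, (hR e he k x _).2 ⟨hk, rfl⟩, (D.w_act k h x).2 ⟨hk, h1, fun hh' => (hh hh').elim⟩⟩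
    -- The witness `t` is the time that `h` assigns to the event in his new coordinates.
    · refine ⟨((D.boost f).chart h).act x 0, _, _, (hR e he k x _).2 ⟨hk, rfl⟩,
        (hR e he h x _).2 ⟨hh, ?_⟩, (D.same_act hk hh x x).2 rfl⟩
      rw [← h2 hh, pmk_sp]
  rw [Str.tr, key]
  rfl

/-- The effect of `X`. -/
noncomputable def slowed : World B K := D.boost fun n => D.c / (1 + rt n)

/-- The effect of `Y`. -/
noncomputable def sped : World B K := D.boost fun n => (D.c - rt n)⁻¹

theorem len_ε_smul_b (k : B) : len ((D.chart k).ε • (D.chart k).b) = rt (nsq (D.chart k).b) := by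
  have := (D.chart k).abs_ε_mul 1
  rw [mul_one, abs_one] at this
  rw [len_smul, this, one_mul]
  rfl

theorem tr_relX : D.toStr.tr D.toStr.RelX = D.slowed.toStr := by
  refine D.tr_eq_boost fun e he k x y => ?_
  simp only [Str.RelX, isCe_iff, D.velIs_iff he]
  constructor
  · rintro ⟨_, _, rfl, ⟨hk, rfl⟩, h⟩
    rw [len_ε_smul_b] at h
    exact ⟨hk, (Gal.boost_act _ _ _).trans h⟩
  · rintro ⟨hk, h⟩
    refine ⟨_, _, rfl, ⟨hk, rfl⟩, ?_⟩
    rw [len_ε_smul_b]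
    exact (Gal.boost_act _ _ _).symm.trans h

variable {D}

theorem Slow.tr_relY (hD : D.Slow) : D.toStr.tr D.toStr.RelY = D.sped.toStr := by
  refine D.tr_eq_boost fun e he k x y => ?_
  simp only [Str.RelY, isCe_iff, D.velIs_iff he]
  constructor
  · rintro ⟨_, _, rfl, ⟨hk, rfl⟩, _, h⟩
    rw [len_ε_smul_b] at h
    exact ⟨hk, (Gal.boost_act _ _ _).trans h⟩
  · rintro ⟨hk, h⟩
    refine ⟨_, _, rfl, ⟨hk, rfl⟩, ?_⟩
    rw [len_ε_smul_b]
    -- The division in `Y` is defined because `|b| < c` in a slow world.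
    exact ⟨(sub_pos.2 (hD.1 k)).ne', (Gal.boost_act _ _ _).symm.trans h⟩

theorem rt_nsq (u : Fin 3 → K) : rt (nsq u) = len u := rfl

theorem len_slow {c : K} (hc : 0 < c) (u : Fin 3 → K) :
    len ((c / (1 + len u)) • u) = c * len u / (1 + len u) := by
  have h1 : 0 < 1 + len u := add_pos_of_pos_of_nonneg one_pos (len_nonneg u)
  rw [len_smul, abs_of_pos (div_pos hc h1)]
  ring

theorem len_fast {c : K} {u : Fin 3 → K} (hu : len u < c) :
    len ((c - len u)⁻¹ • u) = len u / (c - len u) := by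
  rw [len_smul, abs_of_pos (inv_pos.2 (sub_pos.2 hu))]
  ring

/-- With `l = |b|`, the slowed length is `c l / (1 + l)`, and `c - c l / (1 + l) = c / (1 + l)` is
the slowing factor itself, so the second factor is its inverse. -/
theorem sped_slowed (D : World B K) : D.slowed.sped = D := by
  refine D.boost_boost _ _ fun k => ?_
  change (D.c - rt _)⁻¹ * _ = 1
  simp only [rt_nsq, len_slow D.c_pos]
  have h1 : 0 < 1 + len (D.chart k).b := add_pos_of_pos_of_nonneg one_pos (len_nonneg _)
  have hc := D.c_pos
  rw [show D.c - D.c * len (D.chart k).b / (1 + len (D.chart k).b) =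
    D.c / (1 + len (D.chart k).b) by field_simp; ring]
  exact inv_mul_cancel₀ (div_pos hc h1).ne'

theorem slow_fast {c : K} (hc : 0 < c) {l : K} (hl : l < c) :
    c / (1 + l / (c - l)) * (c - l)⁻¹ = 1 := by
  have h1 : c - l ≠ 0 := (sub_pos.2 hl).ne'
  rw [show 1 + l / (c - l) = c / (c - l) by field_simp; ring, div_div_eq_mul_div,
    mul_div_cancel_left₀ _ hc.ne', mul_inv_cancel₀ h1]

end World

end Galilean


/-! ### Slowing and speeding exchange full and slow worlds. -/

section Galilean

variable {B K : Type} [Field K] [LinearOrder K] [IsStrictOrderedRing K] [Euclidean K]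

namespace World

variable {D : World B K}

theorem Full.slowed (hD : D.Full) : D.slowed.Slow := by
  have hc := D.c_pos
  constructor
  · intro k
    change len ((D.c / (1 + len (D.chart k).b)) • (D.chart k).b) < D.c
    have h1 : 0 < 1 + len (D.chart k).b := add_pos_of_pos_of_nonneg one_pos (len_nonneg _)
    rw [len_slow hc, div_lt_iff₀ h1]
    linarith
  · intro w hw
    change len w < D.c at hw
    -- The preimage of a slow velocity `w` under the slowing map is `w / (c - |w|)`.
    have h := (hD ((D.c - len w)⁻¹ • w)).boost fun n => D.c / (1 + rt n)
    rw [rt_nsq, len_fast hw, smul_smul, slow_fast hc hw, one_smul] at h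
    exact h

theorem Slow.sped (hD : D.Slow) : D.sped.Full := by
  intro w
  have hc := D.c_pos
  have h1 : 0 < 1 + len w := add_pos_of_pos_of_nonneg one_pos (len_nonneg _)
  have h := (hD.2 ((D.c / (1 + len w)) • w) (by
    rw [len_slow hc, div_lt_iff₀ h1]; linarith)).boost fun n => (D.c - rt n)⁻¹
  rw [rt_nsq, len_slow hc, smul_smul] at h
  rw [show D.c - D.c * len w / (1 + len w) = D.c / (1 + len w) by field_simp; ring,
    inv_mul_cancel₀ (div_pos hc h1).ne', one_smul] at h
  exact h

theorem Slow.slowed_sped (hD : D.Slow) : D.sped.slowed = D := by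
  refine D.boost_boost _ _ fun k => ?_
  change D.c / (1 + rt _) * _ = 1
  simp only [rt_nsq, len_fast (hD.1 k)]
  exact slow_fast D.c_pos (hD.1 k)

end World

/-! ## Every model is described by a world -/

theorem dot_of_nsq_sub {u v u' v' : Fin 3 → K} (hu : nsq u' = nsq u) (hv : nsq v' = nsq v)
    (h : nsq (u' - v') = nsq (u - v)) : u' ⬝ᵥ v' = u ⬝ᵥ v := by
  rw [nsq_sub, nsq_sub, hu, hv] at h
  linear_combination -h / 2

/-- Isometries are orthogonal up to a translation. -/
theorem exists_orthogonal_of_isometry (F : (Fin 3 → K) → (Fin 3 → K))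
    (hF : ∀ p q, nsq (F p - F q) = nsq (p - q)) :
    ∃ A : (Fin 3 → K) ≃ₗ[K] (Fin 3 → K), (∀ u v, A u ⬝ᵥ A v = u ⬝ᵥ v) ∧ ∀ p, F p = A p + F 0 := by
  have hn : ∀ p, nsq (F p - F 0) = nsq p := fun p => by rw [hF, sub_zero]
  have hd : ∀ p q, (F p - F 0) ⬝ᵥ (F q - F 0) = p ⬝ᵥ q := fun p q =>
    dot_of_nsq_sub (hn p) (hn q) (by rw [sub_sub_sub_cancel_right, hF])
  let f : (Fin 3 → K) →ₗ[K] (Fin 3 → K) :=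
    { toFun := fun p => F p - F 0
      map_add' := fun p q => by
        -- Linearity comes from the preserved inner products: the squared length of the defect
        -- expands in inner products, hence equals the same expression for the original vectors,
        -- which is zero.
        have key : ∀ u v w : Fin 3 → K, nsq (u - (v + w)) =
            nsq u + nsq v + nsq w - 2 * (u ⬝ᵥ v) - 2 * (u ⬝ᵥ w) + 2 * (v ⬝ᵥ w) := by
          intro u v w
          rw [nsq_sub, nsq_add, dotProduct_add]; ring
        rw [← sub_eq_zero, ← nsq_eq_zero, key, hn, hn, hn, hd, hd, hd, ← key, sub_self, nsq_zero]
      map_smul' := fun r p => by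
        have key : ∀ u v : Fin 3 → K, nsq (u - r • v) =
            nsq u - 2 * (r * (u ⬝ᵥ v)) + r * r * nsq v := by
          intro u v
          rw [nsq_sub, nsq_smul, dotProduct_smul, smul_eq_mul]
        rw [← sub_eq_zero, ← nsq_eq_zero, RingHom.id_apply, key, hn, hn, hd, ← key, sub_self,
          nsq_zero] }
  obtain ⟨A, hA, hdot⟩ := exists_orthogonal f hn
  exact ⟨A, hdot, fun p => by rw [hA]; exact (sub_add_cancel _ _).symm⟩

/-- Isometries of the time axis. -/
theorem exists_time_affine {f : Pt K → Pt K} (htime : ∀ x y, |f x 0 - f y 0| = |x 0 - y 0|) :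
    ∃ ε τ : K, ε * ε = 1 ∧ ∀ x, f x 0 = ε * x 0 + τ := by
  have hsq : ∀ x y, (f x 0 - f y 0) * (f x 0 - f y 0) = (x 0 - y 0) * (x 0 - y 0) := by
    intro x y
    rw [← abs_mul_abs_self, htime, abs_mul_abs_self]
  have h1 := hsq (pmk 1 0) (pmk 0 0)
  simp only [pmk_zero] at h1
  refine ⟨f (pmk 1 0) 0 - f (pmk 0 0) 0, f (pmk 0 0) 0, by rw [h1]; ring, fun x => ?_⟩
  have h2 := hsq x (pmk 0 0)
  have h3 := hsq x (pmk 1 0)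
  simp only [pmk_zero] at h2 h3
  set ε := f (pmk 1 0) 0 - f (pmk 0 0) 0
  -- Polarization in one dimension, from the squared durations between `x` and the two reference
  -- times `0` and `1`.
  have h4 : (f x 0 - f (pmk 0 0) 0) * ε = x 0 := by
    simp only [ε]; linear_combination (h1 + h2 - h3) / 2
  have h5 : ε * ε = 1 := by rw [h1]; ring
  linear_combination ε * h4 - (f x 0 - f (pmk 0 0) 0) * h5

/-- The time coordinates determine the factor in either form of collinearity: `a = t` in the first,
`1 - t = a t` in the second. -/
theorem collinear_sp {x y z : Pt K} {ε t : K} (hε : ε ≠ 0) (hy : y 0 - x 0 = ε)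
    (hz : z 0 - x 0 = ε * t) (h : ∃ a : K, z - x = a • (y - x) ∨ y - z = a • (z - x)) :
    sp z - sp x = t • (sp y - sp x) := by
  obtain ⟨a, h | h⟩ := h
  · have h0 : z 0 - x 0 = a * (y 0 - x 0) := congrFun h 0
    have hs : sp z - sp x = a • (sp y - sp x) := congrArg sp h
    rw [hy, hz, mul_comm] at h0
    rw [hs, mul_right_cancel₀ hε h0]
  · have h0 : y 0 - z 0 = a * (z 0 - x 0) := congrFun h 0
    have hs : sp y - sp z = a • (sp z - sp x) := congrArg sp h
    have h1 : 1 - t = a * t := by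
      refine mul_left_cancel₀ hε ?_
      linear_combination h0 - hy + (1 + a) * hz
    have h2 : t • (sp y - sp z) = (1 - t) • (sp z - sp x) := by rw [hs, h1, smul_smul, mul_comm]
    have h3 : t • (sp y - sp x) = t • (sp y - sp z) + t • (sp z - sp x) := by
      rw [← smul_add, sub_add_sub_cancel]
    rw [h3, h2, ← add_smul, sub_add_cancel, one_smul]

/-- A transformation that preserves durations, distances of simultaneous events, and
straightness of slow lines is Galilean. -/
theorem exists_gal {f : Pt K → Pt K} (htime : ∀ x y, |f x 0 - f y 0| = |x 0 - y 0|)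
    (hspace : ∀ x y, x 0 = y 0 → nsq (sp (f x) - sp (f y)) = nsq (sp x - sp y)) {c : K}
    (hc : 0 < c) (hline : ∀ p v t, len v < c → sp (f (pmk t (p + t • v))) - sp (f (pmk 0 p)) =
      t • (sp (f (pmk 1 (p + v))) - sp (f (pmk 0 p)))) :
    ∃ g : Gal K, ∀ x, g.act x = f x := by
  obtain ⟨ε, τ, hε, ht⟩ := exists_time_affine htime
  choose A hA hAF using fun t => exists_orthogonal_of_isometry (fun p => sp (f (pmk t p)))
    fun p q => hspace (pmk t p) (pmk t q) rfl
  have rest : ∀ t p, sp (f (pmk t p)) - sp (f (pmk 0 p)) =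
      t • (sp (f (pmk 1 p)) - sp (f (pmk 0 p))) := by
    intro t p
    simpa using hline p 0 t (by simpa using hc)
  -- On each time slice `f` is orthogonal up to translation. Comparing the images of the rest lines
  -- through `p` and through the origin shows that its linear part is affine in `t`.
  have hlin : ∀ t p, A t p = A 0 p + t • (A 1 p - A 0 p) := by
    intro t p
    have h1 := rest t p
    have h2 := rest t 0
    rw [hAF t p, hAF 0 p, hAF 1 p] at h1
    linear_combination (norm := module) h1 - h2
  -- Now compare a slow moving line through the origin with the rest line, at time `2`.
  have hslow : ∀ v, len v < c → A 2 v = A 1 v := by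
    intro v hv
    have h1 := hline 0 v 2 hv
    have h2 := rest 2 0
    rw [zero_add, zero_add, hAF 2, hAF 1 v, map_smul] at h1
    have h3 : (2 : K) • A 2 v = (2 : K) • A 1 v := by linear_combination (norm := module) h1 - h2
    exact smul_right_injective _ two_ne_zero h3
  have h21 : ∀ v, A 2 v = A 1 v := by
    intro v
    have h1 : 0 < 1 + len v := add_pos_of_pos_of_nonneg one_pos (len_nonneg v)
    -- Every vector is a positive multiple of a slow one, so linearity removes the speed limit.
    have h := hslow ((c / (1 + len v)) • v) (by
      rw [World.len_slow hc, div_lt_iff₀ h1]; linarith)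
    rw [map_smul, map_smul] at h
    exact smul_right_injective _ (div_pos hc h1).ne' h
  have h01 : ∀ v, A 1 v - A 0 v = 0 := by
    intro v
    have h := hlin 2 v
    rw [h21, two_smul] at h
    linear_combination (norm := module) -h
  refine ⟨⟨ε, τ, A 0, sp (f (pmk 1 0)) - sp (f (pmk 0 0)), sp (f (pmk 0 0)), hε, hA 0⟩,
    fun x => pt_ext (ht x).symm ?_⟩
  have h1 := hAF (x 0) (sp x)
  rw [pmk_sp, hlin, h01, smul_zero, add_zero, sub_eq_iff_eq_add.1 (rest (x 0) 0)] at h1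
  rw [h1, Gal.sp_act, add_assoc]

namespace Str

variable {S : Str B K}

theorem Same.symm {k h : B} {x y : Pt K} (H : S.Same k h x y) : S.Same h k y x :=
  fun a => (H a).symm

theorem Same.trans {k h l : B} {x y z : Pt K} (H : S.Same k h x y) (H' : S.Same h l y z) :
    S.Same k l x z := fun a => (H a).trans (H' a)

/-- The axioms that are shared by both theories, apart from those on light signals. -/
structure Classical (S : Str B K) : Prop where
  ev : ∀ k, S.iob k → ∀ h, S.iob h → ∀ x, ∃ y, S.Same k h x y
  self : ∀ k, S.iob k → ∀ x, S.w k k x ↔ sp x = 0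
  symD : ∀ k, S.iob k → ∀ h, S.iob h → ∀ x y x' y', x 0 = y 0 → x' 0 = y' 0 →
    S.Same k h x x' → S.Same k h y y' → len (sp x - sp y) = len (sp x' - sp y')
  line : ∀ k, S.iob k → ∀ h, S.iob h → ∀ x y z, S.w k h x → S.w k h y → S.w k h z →
    ∃ a : K, z - x = a • (y - x) ∨ y - z = a • (z - x)
  triv : ∀ (A : Matrix (Fin 3) (Fin 3) K) (a : Fin 3 → K) (τ : K),
    (∀ x y, len (sp (tmap A a τ x) - sp (tmap A a τ y)) = len (sp x - sp y)) →
      ∀ k, S.iob k → ∃ k', S.iob k' ∧ ∀ x y, S.Same k k' x y ↔ tmap A a τ x = y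
  noAcc : ∀ k h x, S.w k h x → S.iob k
  kinds : ∀ k, S.iob k → ¬ S.ph k
  absTime : ∀ k, S.iob k → ∀ h, S.iob h → ∀ x y x' y', S.Same k h x x' → S.Same k h y y' →
    |x 0 - y 0| = |x' 0 - y' 0|

namespace Classical

theorem of_sat {b : ℕ → B} {ρ : ℕ → K} (h : ∀ φ ∈ kinFull, sat S b ρ φ)
    (h' : sat S b ρ axAbsTime) : S.Classical := by
  simp only [kinFull, Set.mem_insert_iff, Set.mem_singleton_iff, forall_eq_or_imp, forall_eq] at h
  obtain ⟨_, h1, h2, h3, h4, h5, h6, h7⟩ := h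
  exact ⟨(sat_axEv S b ρ).1 h1, (sat_axSelf S b ρ).1 h2, (sat_axSymD S b ρ).1 h3,
    (sat_axLine S b ρ).1 h4, (sat_axTriv S b ρ).1 h5, (sat_axNoAcc S b ρ).1 h6,
    (sat_axKinds S b ρ).1 h7, (sat_axAbsTime S b ρ).1 h'⟩

/-- Comparing the pair `x, x` with the pair `x, y` in the coordinates of `k` itself, absolute time
makes the times equal and the symmetry of distances then makes the places equal. Light is not
needed. -/
theorem eq_of_same (hS : S.Classical) {k : B} (hk : S.iob k) {x y : Pt K}
    (h : S.Same k k x y) : x = y := by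
  have hr : S.Same k k x x := fun _ => Iff.rfl
  have h0 := hS.absTime k hk k hk x x x y hr h
  rw [sub_self, abs_zero, eq_comm, abs_eq_zero, sub_eq_zero] at h0
  have h1 := hS.symD k hk k hk x x x y rfl h0 hr h
  rw [sub_self, len_zero, eq_comm, len_eq_zero, sub_eq_zero] at h1
  exact pt_ext h0 h1

theorem w_iff (hS : S.Classical) {e h : B} (hh : S.iob h) {x y : Pt K}
    (hxy : S.Same e h x y) : S.w e h x ↔ sp y = 0 :=
  (hxy h).trans (hS.self h hh y)

/-- The worldview transformations from an ether observer are Galilean. -/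
theorem exists_chart (hS : S.Classical) {e : B} (he : S.iob e) {c : K} (hc : 0 < c)
    (hexp : ∀ x y, len (sp x - sp y) < c * |x 0 - y 0| → ∃ h, S.iob h ∧ S.w e h x ∧ S.w e h y)
    {k : B} (hk : S.iob k) : ∃ g : Gal K, ∀ x, S.Same e k x (g.act x) := by
  choose φ hφ using fun h : {h // S.iob h} => hS.ev e he h.1 h.2
  have htime : ∀ h x y, |φ h x 0 - φ h y 0| = |x 0 - y 0| := fun h x y =>
    (hS.absTime e he h.1 h.2 x y _ _ (hφ h x) (hφ h y)).symm
  have hw : ∀ h x, S.w e h.1 x ↔ sp (φ h x) = 0 := fun h x => hS.w_iff h.2 (hφ h x)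
  have hsurj : ∀ h y, ∃ x, φ h x = y := by
    intro h y
    obtain ⟨x, hx⟩ := hS.ev h.1 h.2 e he y
    exact ⟨x, (hS.eq_of_same h.2 (hx.trans (hφ h x))).symm⟩
  suffices H : ∃ g : Gal K, ∀ x, g.act x = φ ⟨k, hk⟩ x by
    obtain ⟨g, hg⟩ := H
    exact ⟨g, fun x => by rw [hg]; exact hφ ⟨k, hk⟩ x⟩
  refine exists_gal (htime _) (fun x y hxy => ?_) hc fun p v t hv => ?_
  · have h0 := htime ⟨k, hk⟩ x y
    rw [hxy, sub_self, abs_zero, abs_eq_zero, sub_eq_zero] at h0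
    exact len_inj.1 (hS.symD e he k hk x y _ _ hxy h0 (hφ ⟨k, hk⟩ x) (hφ ⟨k, hk⟩ y)).symm
  -- A slow line is straight in the coordinates of `k` because some inertial observer `h` travels
  -- along it.
  · obtain ⟨h, hh, h1, h2⟩ := hexp (pmk 0 p) (pmk 1 (p + v)) (by
      rw [sp_pmk, sp_pmk, sub_add_cancel_left, len_inj.2 (nsq_neg v)]
      simpa using hv)
    obtain ⟨ε, τ, hε, hετ⟩ := exists_time_affine (htime ⟨h, hh⟩)
    -- That the worldline of `h` has a point at time `t` has to be shown: take the point of his own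
    -- time axis whose clock reading corresponds to `t`. Collinearity then locates it at `p + t v`.
    obtain ⟨z, hz⟩ := hsurj ⟨h, hh⟩ (pmk (ε * t + τ) 0)
    have hε0 : ε ≠ 0 := fun h => by simp [h] at hε
    have h3 : S.w e h z := by rw [hw ⟨h, hh⟩ z, hz, sp_pmk]
    have hzt : z 0 = t := by
      have := hετ z
      rw [hz, pmk_zero, add_left_inj] at this
      exact (mul_left_cancel₀ hε0 this).symm
    have hz' : z = pmk t (p + t • v) := by
      refine pt_ext hzt ?_
      have := collinear_sp one_ne_zero (by simp) (by simp [hzt])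
        (hS.line e he h hh _ _ _ h1 h2 h3) (t := t)
      rw [sp_pmk, sp_pmk, add_sub_cancel_left, sub_eq_iff_eq_add'] at this
      exact this
    rw [hz'] at h3
    obtain ⟨ε', τ', hε', hετ'⟩ := exists_time_affine (htime ⟨k, hk⟩)
    have hε0' : ε' ≠ 0 := fun h => by simp [h] at hε'
    refine collinear_sp hε0' (by simp [hετ']) (by simp [hετ']) (hS.line k hk h hh _ _ _
      ((hφ ⟨k, hk⟩ _ h).1 h1) ((hφ ⟨k, hk⟩ _ h).1 h2) ((hφ ⟨k, hk⟩ _ h).1 h3))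

/-- The worldlines according to `e` and the Galilean charts from `e` recover the whole structure.
Bodies that are not inertial observers get the identity as a default chart; the last conclusion
keeps track of this because `Slow` bounds all charts. -/
theorem exists_world (hS : S.Classical) {e : B} (he : S.iob e) {c : K} (hc : 0 < c)
    (hexp : ∀ x y, len (sp x - sp y) < c * |x 0 - y 0| → ∃ h, S.iob h ∧ S.w e h x ∧ S.w e h y)
    (hlight : ∀ x y, (∃ p, S.ph p ∧ S.w e p x ∧ S.w e p y) ↔ len (sp x - sp y) = c * |x 0 - y 0|) :
    ∃ D : World B K, D.toStr = S ∧ D.e₀ = e ∧ D.c = c ∧ ∀ k, ¬ S.iob k → D.chart k = Gal.one K := by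
  have hchart : ∀ k, ∃ g : Gal K, (S.iob k → ∀ x, S.Same e k x (g.act x)) ∧
      (¬ S.iob k → g = Gal.one K) := by
    intro k
    by_cases hk : S.iob k
    · obtain ⟨g, hg⟩ := hS.exists_chart he hc hexp hk
      exact ⟨g, fun _ => hg, fun h => (h hk).elim⟩
    · exact ⟨Gal.one K, fun h => (hk h).elim, fun _ => rfl⟩
  choose g hg hg' using hchart
  have hact : ∀ k, S.iob k → ∀ {x y}, S.Same e k x y → y = (g k).act x := fun k hk x y h =>
    hS.eq_of_same hk (h.symm.trans (hg k hk x))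
  refine ⟨⟨S.iob, S.ph, fun p => S.w e p, g, e, c, he, ?_, hS.kinds, hc, hlight, ?_⟩, ?_, rfl, rfl,
    hg'⟩
  · refine Gal.act_inj fun x => ?_
    rw [Gal.one_act]
    exact (hact e he fun _ => Iff.rfl).symm
  · intro k hk A hA a τ
    have hmul : ∀ u, (LinearMap.toMatrix' A.toLinearMap).mulVec u = A u := fun u =>
      LinearMap.toMatrix'_mulVec A.toLinearMap u
    obtain ⟨k', hk', h⟩ := hS.triv (LinearMap.toMatrix' A.toLinearMap) a τ (fun x y => by
      simp only [tmap, sp_pmk, hmul, add_sub_add_right_eq_sub]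
      rw [← map_sub, len_inj]
      exact hA _ _) k hk
    refine ⟨k', hk', Gal.act_inj fun x => ?_⟩
    rw [Gal.post_act, ← hact k' hk' ((hg k hk x).trans ((h _ _).2 rfl)), tmap, hmul]
  · have key : ∀ k h x, (S.iob k ∧ (¬ S.iob h → S.w e h ((g k).inv x)) ∧
        (S.iob h → sp ((g h).act ((g k).inv x)) = 0)) ↔ S.w k h x := by
      intro k h x
      obtain ⟨x, rfl⟩ := (g k).act_surjective x
      rw [Gal.inv_act]
      by_cases hk : S.iob k
      · rw [← hg k hk x h]
        by_cases hh : S.iob h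
        · simp [hk, hh, hS.w_iff hh (hg h hh x)]
        · simp [hk, hh]
      · exact iff_of_false (fun h => hk h.1) fun h' => hk (hS.noAcc _ _ _ h')
    simp only [World.toStr, key]

theorem exists_full (hS : S.Classical) (hether : ∃ e, S.Ether e)
    (hexp : ∀ k, S.iob k → ∀ x y : Pt K, x 0 ≠ y 0 → ∃ h, S.iob h ∧ S.w k h x ∧ S.w k h y) :
    ∃ D : World B K, D.Full ∧ D.toStr = S := by
  obtain ⟨e, he, c, hc, hlight⟩ := hether
  obtain ⟨D, rfl, rfl, -, -⟩ := hS.exists_world he hc (fun x y h => hexp e he x y fun h0 => by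
    rw [h0, sub_self, abs_zero, mul_zero] at h
    exact (len_nonneg _).not_gt h) hlight
  refine ⟨D, fun w => .of_through ?_, rfl⟩
  obtain ⟨h, hh, h1, h2⟩ := hexp D.e₀ he 0 (pmk 1 w) (by simp)
  rw [← Gal.one_act (K := K) 0, ← D.chart_e₀, D.w_act_iob he hh] at h1
  rw [← Gal.one_act (pmk 1 w), ← D.chart_e₀, D.w_act_iob he hh] at h2
  exact ⟨h, hh, h1, h2⟩

theorem exists_slow (hS : S.Classical) (hether : ∃ e, S.Ether e)
    (hftl : ∀ k, S.iob k → ∀ e, S.Ether e → ∃ v c, S.SpeedIs e k v ∧ S.IsCe c ∧ v < c)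
    (hexp : ∀ e, S.Ether e → ∀ x y : Pt K, (∃ c, S.IsCe c ∧ len (sp x - sp y) < c * |x 0 - y 0|) →
      ∃ h, S.iob h ∧ S.w e h x ∧ S.w e h y) :
    ∃ D : World B K, D.Slow ∧ D.toStr = S := by
  obtain ⟨e, hee⟩ := hether
  obtain ⟨he, c, hc, hlight⟩ := id hee
  -- Applied to `e` itself, the ban on faster-than-light motion supplies a quantity satisfying
  -- `IsCe`. A signal with speed `c` according to `e` shows that it equals `c`.
  obtain ⟨_, c', _, hc', _⟩ := hftl e he e hee
  have hcc : c = c' := by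
    have h1 : (1 : K) = |(pmk 1 (c • ![1, 0, 0]) : Pt K) 0 - (pmk 0 0 : Pt K) 0| := by simp
    obtain ⟨p, hp, hx, hy⟩ := (hlight (pmk 1 (c • ![1, 0, 0])) (pmk 0 0)).2 (by
      rw [← h1, mul_one, sp_pmk, sp_pmk, sub_zero, len_eq_iff hc.le, nsq_smul, nsq_eq]; simp)
    refine hc' e hee p hp c ⟨⟨_, _, hx, hy, fun h => ?_⟩, fun x y hx hy =>
      (hlight x y).1 ⟨p, hp, hx, hy⟩⟩
    simpa using congrFun h 0
  subst hcc
  have hexp' := fun x y h => hexp e hee x y ⟨c, hc', h⟩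
  obtain ⟨D, rfl, rfl, rfl, hone⟩ := hS.exists_world he hc hexp' hlight
  refine ⟨D, ⟨fun k => ?_, fun w hw => .of_through ?_⟩, rfl⟩
  · by_cases hk : D.iob k
    · obtain ⟨v, c, hv, hc, hlt⟩ := hftl k hk D.e₀ hee
      rwa [(D.speedIs_iff hee hk v).1 hv, (D.isCe_iff c).1 hc] at hlt
    -- The default chart of a non-observer has `b = 0`.
    · rw [hone k hk]
      exact len_zero.trans_lt hc
  · obtain ⟨h, hh, h1, h2⟩ := hexp' 0 (pmk 1 w) (by
      have h0 : sp (0 : Pt K) = 0 := rfl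
      rw [sp_pmk, h0, zero_sub, len_inj.2 (nsq_neg w)]
      simpa using hw)
    rw [← Gal.one_act (K := K) 0, ← D.chart_e₀, D.w_act_iob he hh] at h1
    rw [← Gal.one_act (pmk 1 w), ← D.chart_e₀, D.w_act_iob he hh] at h2
    exact ⟨h, hh, h1, h2⟩

end Classical

end Str

end Galilean

/-! ## The theorem -/

theorem finite_kinFull : kinFull.Finite := by
  unfold kinFull
  exact Set.toFinite _

theorem finite_classicalKinFull : classicalKinFull.Finite :=
  finite_kinFull.union (Set.toFinite _)

theorem finite_classicalKinSTLFull : classicalKinSTLFull.Finite :=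
  finite_kinFull.union (Set.toFinite _)

/-- Completeness, the field of quantities and the normal form of models together: only truth in full
worlds has to be checked. -/
theorem proves_classicalKinFull {φ : Fml}
    (h : ∀ {B K : Type} [Field K] [LinearOrder K] [IsStrictOrderedRing K] [Euclidean K]
      (D : World B K), D.Full → ∀ b ρ, sat D.toStr b ρ φ) : Proves classicalKinFull φ := by
  refine Proves.complete finite_classicalKinFull fun B Q _ _ _ S b ρ hS => ?_
  have hkin : ∀ ψ ∈ kinFull, sat S b ρ ψ := fun ψ hψ => hS ψ (Or.inl hψ)
  have h1 := hS axAbsTime (Or.inr (by simp))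
  have h2 := hS axThExpPlus (Or.inr (by simp))
  have h3 := hS axEther (Or.inr (by simp))
  obtain ⟨_, _, _, _, rfl, rfl, rfl⟩ := exists_field (hkin axEField (by simp [kinFull]))
  obtain ⟨D, hD, rfl⟩ := (Str.Classical.of_sat hkin h1).exists_full ((sat_axEther S b ρ).1 h3)
    ((sat_axThExpPlus S b ρ).1 h2).2
  exact h D hD b ρ

theorem proves_classicalKinSTLFull {φ : Fml}
    (h : ∀ {B K : Type} [Field K] [LinearOrder K] [IsStrictOrderedRing K] [Euclidean K]
      (D : World B K), D.Slow → ∀ b ρ, sat D.toStr b ρ φ) : Proves classicalKinSTLFull φ := by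
  refine Proves.complete finite_classicalKinSTLFull fun B Q _ _ _ S b ρ hS => ?_
  have hkin : ∀ ψ ∈ kinFull, sat S b ρ ψ := fun ψ hψ => hS ψ (Or.inl hψ)
  have h1 := hS axAbsTime (Or.inr (by simp))
  have h2 := hS axEther (Or.inr (by simp))
  have h3 := hS axNoFTL (Or.inr (by simp))
  have h4 := hS axThExpSTL (Or.inr (by simp))
  obtain ⟨_, _, _, _, rfl, rfl, rfl⟩ := exists_field (hkin axEField (by simp [kinFull]))
  obtain ⟨D, hD, rfl⟩ := (Str.Classical.of_sat hkin h1).exists_slow ((sat_axEther S b ρ).1 h2)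
    ((sat_axNoFTL S b ρ).1 h3) ((sat_axThExpSTL S b ρ).1 h4).2
  exact h D hD b ρ

/-! ### The translations evaluated in worlds. -/

section Field

variable {B K : Type} [Field K] [LinearOrder K] [IsStrictOrderedRing K] [Euclidean K]

theorem World.sat_map_trStar (D : World B K) (b : ℕ → B) (ρ : ℕ → K) (φ : Fml) :
    sat D.toStr b ρ (trStar.map φ) ↔ sat D.slowed.toStr b ρ φ := by
  rw [Kin.sat_map_trStar, D.tr_relX]

theorem World.Slow.sat_map_trStar' {D : World B K} (hD : D.Slow) (b : ℕ → B) (ρ : ℕ → K)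
    (φ : Fml) : sat D.toStr b ρ (trStar'.map φ) ↔ sat D.sped.toStr b ρ φ := by
  rw [Kin.sat_map_trStar', hD.tr_relY]

/-- Slowing multiplies each `b` by a nonzero factor, so the ether observers, having `b = 0`, remain
the same, and the velocity `ε b` of the ether is multiplied by `c / (1 + |b|)`. -/
theorem World.sat_map_etherVelIs (D : World B K) (b : ℕ → B) (ρ : ℕ → K) :
    sat D.toStr b ρ (trStar.map etherVelIs) ↔ sat D.toStr b ρ etherSlowedVelIs := by
  rw [D.sat_map_trStar, sat_etherVelIs, sat_etherSlowedVelIs]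
  have hether : D.slowed.toStr.Ether (b 1) ↔ D.toStr.Ether (b 1) := by
    rw [ether_iff, ether_iff]
    refine and_congr_right fun _ => ?_
    change (D.c / (1 + len (D.chart (b 1)).b)) • (D.chart (b 1)).b = 0 ↔ _
    rw [smul_eq_zero_iff_right (div_ne_zero D.c_pos.ne' (one_add_len_ne_zero _))]
  rw [hether]
  refine and_congr_right fun he => ?_
  rw [D.slowed.velIs_iff (hether.2 he)]
  simp only [D.velIs_iff he, isCe_iff]
  have hV : (D.slowed.chart (b 0)).ε • (D.slowed.chart (b 0)).b =
      (D.c / (1 + len ((D.chart (b 0)).ε • (D.chart (b 0)).b))) •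
        (D.chart (b 0)).ε • (D.chart (b 0)).b := by
    rw [len_ε_smul_b, smul_comm]
    rfl
  rw [hV]
  constructor
  · rintro ⟨hk, h⟩
    exact ⟨_, _, rfl, ⟨hk, rfl⟩, h.symm⟩
  · rintro ⟨_, _, rfl, ⟨hk, rfl⟩, h⟩
    exact ⟨hk, h.symm⟩

end Field

end Kin

open Kin in
theorem mainTheorem3 :
    Kin.IsDefinitionalEquivalence Kin.trStar Kin.trStar'
        Kin.classicalKinSTLFull Kin.classicalKinFull ∧
      Kin.Proves Kin.classicalKinFull
        (Kin.Fml.iff (Kin.trStar.map Kin.etherVelIs) Kin.etherSlowedVelIs) := by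
  refine ⟨⟨fun φ hφ => proves_classicalKinFull fun D hD b ρ => ?_,
    fun φ hφ => proves_classicalKinSTLFull fun D hD b ρ => ?_,
    fun φ => proves_classicalKinSTLFull fun D hD b ρ => ?_,
    fun φ => proves_classicalKinFull fun D hD b ρ => ?_⟩,
    proves_classicalKinFull fun D hD b ρ => ?_⟩
  · exact (D.sat_map_trStar b ρ φ).2 (hφ.sound _ b ρ (hD.slowed.sat_of_mem b ρ))
  · exact (hD.sat_map_trStar' b ρ φ).2 (hφ.sound _ b ρ (hD.sped.sat_of_mem b ρ))
  -- The outer translation acts on the world before the inner one: a slow world is sped up, then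
  -- slowed down again.
  · rw [sat_iff_iff, hD.sat_map_trStar', D.sped.sat_map_trStar, hD.slowed_sped]
  · rw [sat_iff_iff, D.sat_map_trStar, hD.slowed.sat_map_trStar', D.sped_slowed]
  · rw [sat_iff_iff]
    exact D.sat_map_etherVelIs b ρ
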